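/- Let $1\le d\le 3$, let $\Omega\subset\mathbb R^d$ be a bounded Lipschitz domain, let $k\ge 1$, let $\mu>0$, $\lambda\ge 0$, and let $K$ be a measurable, bounded, symmetric positive definite matrix field on $\Omega$. Let $\mathcal T_h$ be a finite partition of $\Omega$ into closed, not necessarily convex polytopal elements $T$ (diameter $h_T$, unit outward normal $\mathbf n$) with flat faces $e$ (diameter $h_e$; faces are points if $d=1$), and let $h=\max_T h_T$. The partition is shape regular: with fixed positive constants $\rho_v,\rho_e,\kappa,\sigma,\gamma,\rho_s$, a fixed $\theta<\pi/2$ and fixed integers $m_0,N_0$, - $\rho_v h_T^d\le |T|$ for every element $T$, $\rho_e h_e^{d-1}\le |e|$ for every face $e$, and, if $d\ge2$, $\kappa h_T\le h_e$ for every face $e$ of $T$; - for every face $e$ of $T$ there is a pyramid contained in $T$ with base $e$, some apex $A$ and height at least $\sigma h_T$, such that the angle between $x-A$ and the outward normal is at most $\theta$ for all $x\in e$; - every $T$ is contained in a simplex $S(T)$ of diameter $h_{S(T)}\le\gamma h_T$ with $|S(T)|\ge\rho_s h_{S(T)}^d$, and each $S(T)$ meets at most $m_0$ of these simplices; - every element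 has at most $N_0$ faces. For an element $T$ with $N$ faces put $r=k-1+N$ if $T$ is convex and $r=k-1+2N$ otherwise. For a scalar weak function $q=\{q_0,q_b\}$ on $T$ ($q_0\in L^2(T)$, $q_b\in L^2(\partial T)$) and a vector weak function $\mathbf v=\{\mathbf v_0,\mathbf v_b\}$ ($\mathbf v_0\in[L^2(T)]^d$, $\mathbf v_b\in[L^2(\partial T)]^d$), the discrete weak gradients $\nabla_w q\in[P_r(T)]^d$, $\nabla_w\mathbf v\in[P_r(T)]^{d\times d}$ and the discrete weak divergence $\nabla_w\cdot\mathbf v\in P_r(T)$ are defined by $$(\nabla_w q,\mathbf w)_T=-(q_0,\nabla\cdot\mathbf w)_T+\langle q_b,\mathbf w\cdot\mathbf n\rangle_{\partial T}\quad\forall\,\mathbf w\in[P_r(T)]^d,$$ $$(\nabla_w\mathbf v,\varphi)_T=-(\mathbf v_0,\nabla\cdot\varphi)_T+\langle \mathbf v_b,\varphi\mathbf n\rangle_{\partial T}\quad\forall\,\varphi\in[P_r(T)]^{d\times d},$$ $$(\nabla_w\cdot\mathbf v,w)_T=-(\mathbf v_0,\nabla w)_T+\langle \mathbf v_b\cdot\mathbf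 n,w\rangle_{\partial T}\quad\forall\,w\in P_r(T),$$ and $\epsilon_w\mathbf v=\frac12\big(\nabla_w\mathbf v+(\nabla_w\mathbf v)^T\big)$. Let $$|||\mathbf v|||_{V_h}=\Big(\sum_{T\in\mathcal T_h}2\mu\|\epsilon_w\mathbf v\|_T^2+\lambda\|\nabla_w\cdot\mathbf v\|_T^2\Big)^{1/2},\qquad |||q|||_{W_h}=\Big(\sum_{T\in\mathcal T_h}(K\nabla_w q,\nabla_w q)_T\Big)^{1/2}.$$ For a (scalar or vector valued) function $v$ on $\Omega$, identified on each $T$ with the weak function $\{v|_T,v|_{\partial T}\}$ ($v|_{\partial T}$ being the trace), let $Q_hv=\{Q_0v,Q_bv\}$ on $T$, where $Q_0$ is the $L^2(T)$-projection onto polynomials of degree at most $k$ on $T$ and $Q_b$ is, on each face $e$ of $T$, the $L^2(e)$-projection of the trace onto polynomials of degree at most $k$ on $e$. Then there are constants $C$, independent of the partition (in particular of $h$) and of $\mathbf u$ and $p$ (they may depend on $\Omega,d,k,\mu,\lambda,K$ and the shape-regularity constants listed above), such that $$|||\mathbf u-Q_h\mathbf u|||_{V_h}\le C h^k\|\mathbf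 u\|_{k+1}\quad\text{for all }\mathbf u\in[H^{k+1}(\Omega)]^d,$$ $$|||p-Q_hp|||_{W_h}\le C h^k\|p\|_{k+1}\quad\text{for all }p\in H^{k+1}(\Omega),$$ where $\|\cdot\|_{k+1}$ is the norm of $H^{k+1}(\Omega)$, respectively $[H^{k+1}(\Omega)]^d$. -/

import Mathlib

open MeasureTheory Filter Topology
open scoped ContDiff BigOperators

noncomputable section

namespace WeakGalerkin

/-- Euclidean space `ℝ^d`. -/
abbrev Space (d : ℕ) := EuclideanSpace ℝ (Fin d)

/-! ### Domains and Sobolev spaces -/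

/-- A bounded domain with Lipschitz boundary: near each boundary point `Ω` is, in the direction of
some unit vector `ν`, the part lying strictly above the graph of a Lipschitz function `g` of the
coordinates orthogonal to `ν`. -/
def IsLipschitzDomain {d : ℕ} (Ω : Set (Space d)) : Prop :=
  IsOpen Ω ∧ IsConnected Ω ∧ Bornology.IsBounded Ω ∧
    ∀ x ∈ frontier Ω, ∃ (ν : Space d) (r : ℝ) (L : NNReal) (g : Space d → ℝ),
      ‖ν‖ = 1 ∧ 0 < r ∧ LipschitzWith L g ∧ (∀ (y : Space d) (t : ℝ), g (y + t • ν) = g y) ∧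
        ∀ y ∈ Metric.ball x r, y ∈ Ω ↔ g y < inner ℝ ν y

/-- The classical partial derivative `∂_i f`. -/
def partialDeriv {d : ℕ} (i : Fin d) (f : Space d → ℝ) : Space d → ℝ :=
  fun x => fderiv ℝ f x (EuclideanSpace.single i 1)

/-- The classical derivative `∂^α f = ∂_1^{α_1} ⋯ ∂_d^{α_d} f` of a multi-index `α`. -/
def multiDeriv {d : ℕ} (α : Fin d → ℕ) (f : Space d → ℝ) : Space d → ℝ :=
  (List.finRange d).foldr (fun i g => (partialDeriv i)^[α i] g) f

/-- `g` is the weak derivative `∂^α u` on the open set `Ω`. -/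
def IsWeakDeriv {d : ℕ} (Ω : Set (Space d)) (α : Fin d → ℕ) (u g : Space d → ℝ) : Prop :=
  ∀ φ : Space d → ℝ, ContDiff ℝ ∞ φ → HasCompactSupport φ → tsupport φ ⊆ Ω →
    ∫ x in Ω, u x * multiDeriv α φ x = (-1) ^ (∑ i, α i) * ∫ x in Ω, g x * φ x

/-- The multi-indices of length at most `m`. -/
def multiIndices (d m : ℕ) : Finset (Fin d → ℕ) :=
  (Fintype.piFinset fun _ => Finset.range (m + 1)).filter fun α => ∑ i, α i ≤ m

/-- `u ∈ H^m(Ω)`. -/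
def MemSobolev {d : ℕ} (m : ℕ) (Ω : Set (Space d)) (u : Space d → ℝ) : Prop :=
  MemLp u 2 (volume.restrict Ω) ∧
    ∀ α ∈ multiIndices d m, ∃ g, MemLp g 2 (volume.restrict Ω) ∧ IsWeakDeriv Ω α u g

open Classical in
/-- The weak derivative `∂^α u ∈ L²(Ω)` (it is unique almost everywhere). -/
def weakDeriv {d : ℕ} (Ω : Set (Space d)) (α : Fin d → ℕ) (u : Space d → ℝ) : Space d → ℝ :=
  if h : ∃ g, MemLp g 2 (volume.restrict Ω) ∧ IsWeakDeriv Ω α u g then h.choose else 0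

/-- The square of the norm of `H^m(Ω)`: the sum of `‖∂^α u‖²_{L²(Ω)}` over `|α| ≤ m`. -/
def sobolevNormSq {d : ℕ} (m : ℕ) (Ω : Set (Space d)) (u : Space d → ℝ) : ℝ :=
  ∑ α ∈ multiIndices d m, ∫ x in Ω, weakDeriv Ω α u x ^ 2

/-- The norm `‖u‖_m` of `H^m(Ω)`. -/
def sobolevNorm {d : ℕ} (m : ℕ) (Ω : Set (Space d)) (u : Space d → ℝ) : ℝ :=
  √(sobolevNormSq m Ω u)

/-- The norm `‖u‖_m` of `[H^m(Ω)]^d`. -/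
def sobolevNormVec {d : ℕ} (m : ℕ) (Ω : Set (Space d)) (u : Fin d → Space d → ℝ) : ℝ :=
  √(∑ i, sobolevNormSq m Ω (u i))

/-- The boundary trace of `u|_T`, through the precise representative: the value at `x ∈ ∂T` is the
limit of the averages of `u` over `T ∩ B(x, r)` as `r → 0`. For `u ∈ H¹` of a polytope this limit
exists and is the Sobolev trace at almost every point of `∂T`. -/
def trace {d : ℕ} (T : Set (Space d)) (u : Space d → ℝ) (x : Space d) : ℝ :=
  limUnder (𝓝[>] (0 : ℝ)) fun r => ⨍ y in T ∩ Metric.ball x r, u y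

/-! ### Polytopal meshes -/

/-- A (closed, bounded, not necessarily convex) polytope of any dimension: a finite union of convex
hulls of finite sets which is the closure of its relative interior, the latter being connected. -/
def IsPolytope {d : ℕ} (s : Set (Space d)) : Prop :=
  (∃ F : Finset (Finset (Space d)), s = ⋃ t ∈ F, convexHull ℝ (t : Set (Space d))) ∧
    closure (intrinsicInterior ℝ s) = s ∧ IsConnected (intrinsicInterior ℝ s)

/-- `(d-1)`-dimensional surface measure (counting measure of points if `d = 1`). -/
def surfaceMeasure (d : ℕ) : Measure (Space d) := Measure.euclideanHausdorffMeasure (d - 1)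

/-- `n` is the (constant) unit outward normal vector of `T` on the flat boundary piece `e`. -/
def IsOutwardNormal {d : ℕ} (T e : Set (Space d)) (n : Space d) : Prop :=
  ‖n‖ = 1 ∧ (∃ c : ℝ, ∀ x ∈ e, inner ℝ n x = c) ∧
    ∀ᵐ x ∂((surfaceMeasure d).restrict e),
      ∀ᶠ t in 𝓝[>] (0 : ℝ), x + t • n ∉ T ∧ x - t • n ∈ T

/-- A finite partition of `Ω` into closed polytopal elements, together with its edges/faces: flat
polytopes of dimension `d - 1` which do not overlap and make up the boundaries of the elements.
A flat side of an element may be subdivided into several faces (hanging nodes). -/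
structure PolytopalMesh {d : ℕ} (Ω : Set (Space d)) where
  elems : Finset (Set (Space d))
  faces : Finset (Set (Space d))
  normal : Set (Space d) → Set (Space d) → Space d
  elem_polytope : ∀ T ∈ elems, IsPolytope T ∧ (interior T).Nonempty
  elem_cover : ⋃ T ∈ elems, T = closure Ω
  elem_disjoint : ∀ T ∈ elems, ∀ T' ∈ elems, T ≠ T' → Disjoint (interior T) (interior T')
  face_polytope : ∀ e ∈ faces, IsPolytope e ∧ 0 < surfaceMeasure d e
  face_disjoint : ∀ e ∈ faces, ∀ e' ∈ faces, e ≠ e' →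
    Disjoint (intrinsicInterior ℝ e) (intrinsicInterior ℝ e')
  face_of_elem : ∀ e ∈ faces, ∃ T ∈ elems, e ⊆ frontier T
  frontier_eq : ∀ T ∈ elems, frontier T = ⋃ e ∈ {e | e ∈ faces ∧ e ⊆ frontier T}, e
  normal_spec : ∀ T ∈ elems, ∀ e ∈ faces, e ⊆ frontier T → IsOutwardNormal T e (normal T e)

namespace PolytopalMesh

variable {d : ℕ} {Ω : Set (Space d)} (M : PolytopalMesh Ω)

open Classical in
/-- The faces of the element `T`. -/
def facesOf (T : Set (Space d)) : Finset (Set (Space d)) :=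
  M.faces.filter fun e => e ⊆ frontier T

/-- The mesh size `h = max_T h_T`, where `h_T` is the diameter of `T`. -/
def meshSize : ℝ := ⨆ T : M.elems, Metric.diam (T : Set (Space d))

open Classical in
/-- The degree `r` of the discrete weak derivatives on `T`: with `N` the number of faces of `T`,
it is `k - 1 + N` if `T` is convex and `k - 1 + 2N` if not. -/
def weakDegree (k : ℕ) (T : Set (Space d)) : ℕ :=
  if Convex ℝ T then k - 1 + (M.facesOf T).card else k - 1 + 2 * (M.facesOf T).card

end PolytopalMesh

/-- The constants that quantify the shape regularity of a mesh. -/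
structure RegularityConstants where
  ρv : ℝ
  ρe : ℝ
  κ : ℝ
  σ : ℝ
  θ : ℝ
  γ : ℝ
  ρs : ℝ
  overlap : ℕ
  maxFaces : ℕ
  ρv_pos : 0 < ρv
  ρe_pos : 0 < ρe
  κ_pos : 0 < κ
  σ_pos : 0 < σ
  θ_lt : θ < Real.pi / 2
  γ_pos : 0 < γ
  ρs_pos : 0 < ρs

/-- Shape regularity of a polytopal mesh, with given constants. -/
structure PolytopalMesh.ShapeRegular {d : ℕ} {Ω : Set (Space d)} (M : PolytopalMesh Ω)
    (c : RegularityConstants) : Prop where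
  /-- The volume of an element is comparable to `h_T^d`. -/
  volume_elem : ∀ T ∈ M.elems, c.ρv * Metric.diam T ^ d ≤ volume.real T
  /-- The area of a face is comparable to `h_e^(d-1)`. -/
  area_face : ∀ e ∈ M.faces, c.ρe * Metric.diam e ^ (d - 1) ≤ (surfaceMeasure d).real e
  /-- The diameter of a face of `T` is comparable to `h_T` (void for `d = 1`, where faces are
  points). -/
  diam_face : 2 ≤ d → ∀ T ∈ M.elems, ∀ e ∈ M.facesOf T, c.κ * Metric.diam T ≤ Metric.diam e
  /-- Over each face `e` of `T` there stands a pyramid with base `e` and apex `A`, contained in `T`,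
  of height at least `σ h_T`, and the angle between `x - A`, `x ∈ e`, and the outward normal is at
  most `θ < π/2`. -/
  pyramid : ∀ T ∈ M.elems, ∀ e ∈ M.facesOf T, ∃ A : Space d,
    convexJoin ℝ {A} e ⊆ T ∧
      ∀ x ∈ e, c.σ * Metric.diam T ≤ inner ℝ (M.normal T e) (x - A) ∧
        InnerProductGeometry.angle (x - A) (M.normal T e) ≤ c.θ
  /-- Each element has a circumscribed shape regular simplex `S(T)` of comparable diameter, and each
  of these simplices meets only a bounded number of them. -/
  simplex : ∃ S : Set (Space d) → Set (Space d), ∀ T ∈ M.elems,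
    (∃ v : Fin (d + 1) → Space d, AffineIndependent ℝ v ∧ S T = convexHull ℝ (Set.range v)) ∧
      T ⊆ S T ∧ Metric.diam (S T) ≤ c.γ * Metric.diam T ∧
      c.ρs * Metric.diam (S T) ^ d ≤ volume.real (S T) ∧
      Set.ncard {T' | T' ∈ M.elems ∧ (S T ∩ S T').Nonempty} ≤ c.overlap
  /-- The number of faces of an element is bounded. -/
  card_faces : ∀ T ∈ M.elems, (M.facesOf T).card ≤ c.maxFaces

/-! ### Weak functions, discrete weak derivatives, projections -/

/-- A scalar weak function `{q_0, q_b}` on an element: the interior function `q_0` and, for each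
face `e` of the element, the boundary function `q_b|_e`. A vector valued weak function
`{v_0, v_b}` is a family `Fin d → WeakFn d` of its components. -/
abbrev WeakFn (d : ℕ) := (Space d → ℝ) × (Set (Space d) → Space d → ℝ)

/-- Polynomials in `d` variables. -/
abbrev Poly (d : ℕ) := MvPolynomial (Fin d) ℝ

/-- The value of a polynomial at a point. -/
def Poly.val {d : ℕ} (p : Poly d) (x : Space d) : ℝ := MvPolynomial.eval (fun i => x i) p

/-- `P` is the `L²(m)`-projection of `u` onto the polynomials of total degree at most `k`. -/
def IsL2Proj {d : ℕ} (m : Measure (Space d)) (k : ℕ) (u : Space d → ℝ) (P : Poly d) : Prop :=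
  P.totalDegree ≤ k ∧
    ∀ w : Poly d, w.totalDegree ≤ k → ∫ x, P.val x * w.val x ∂m = ∫ x, u x * w.val x ∂m

open Classical in
/-- The `L²(m)`-projection of `u` onto the polynomials of total degree at most `k`. -/
def l2Proj {d : ℕ} (m : Measure (Space d)) (k : ℕ) (u : Space d → ℝ) : Space d → ℝ :=
  if h : ∃ P, IsL2Proj m k u P then h.choose.val else 0

/-- The weak function `{u|_T, u|_∂T}` of a function `u`. -/
def toWeakFn {d : ℕ} (T : Set (Space d)) (u : Space d → ℝ) : WeakFn d :=
  (u, fun _ => trace T u)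

/-- The projection `Q_h u = {Q_0 u, Q_b u}` on the element `T`, onto `P_k(T)` in the interior and
onto `P_k(e)` on each face `e`. -/
def projWeakFn {d : ℕ} (k : ℕ) (T : Set (Space d)) (u : Space d → ℝ) : WeakFn d :=
  (l2Proj (volume.restrict T) k u,
    fun e => l2Proj ((surfaceMeasure d).restrict e) k (trace T u))

namespace PolytopalMesh

variable {d : ℕ} {Ω : Set (Space d)} (M : PolytopalMesh Ω)

/-- `G` is the discrete weak gradient of degree `r` on `T` of the scalar weak function `q`:
`(G, w)_T = -(q_0, ∇·w)_T + ⟨q_b, w·n⟩_∂T` for all `w ∈ [P_r(T)]^d`. -/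
def IsWeakGrad (r : ℕ) (T : Set (Space d)) (q : WeakFn d) (G : Fin d → Poly d) : Prop :=
  (∀ j, (G j).totalDegree ≤ r) ∧ ∀ w : Fin d → Poly d, (∀ j, (w j).totalDegree ≤ r) →
    ∫ x in T, ∑ j, (G j).val x * (w j).val x =
      -(∫ x in T, q.1 x * ∑ j, Poly.val (MvPolynomial.pderiv j (w j)) x)
        + ∑ e ∈ M.facesOf T,
            ∫ x in e, q.2 e x * ∑ j, (w j).val x * M.normal T e j ∂(surfaceMeasure d)

/-- `G` is the discrete weak gradient of degree `r` on `T` of the vector weak function `v`: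
`(G, φ)_T = -(v_0, ∇·φ)_T + ⟨v_b, φ n⟩_∂T` for all `φ ∈ [P_r(T)]^{d×d}`, where the divergence is
taken by rows. -/
def IsWeakGradVec (r : ℕ) (T : Set (Space d)) (v : Fin d → WeakFn d)
    (G : Fin d → Fin d → Poly d) : Prop :=
  (∀ i j, (G i j).totalDegree ≤ r) ∧
    ∀ φ : Fin d → Fin d → Poly d, (∀ i j, (φ i j).totalDegree ≤ r) →
      ∫ x in T, ∑ i, ∑ j, (G i j).val x * (φ i j).val x =
        -(∫ x in T, ∑ i, (v i).1 x * ∑ j, Poly.val (MvPolynomial.pderiv j (φ i j)) x)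
          + ∑ e ∈ M.facesOf T,
              ∫ x in e, ∑ i, (v i).2 e x * ∑ j, (φ i j).val x * M.normal T e j
                ∂(surfaceMeasure d)

/-- `D` is the discrete weak divergence of degree `r` on `T` of the vector weak function `v`:
`(D, w)_T = -(v_0, ∇w)_T + ⟨v_b·n, w⟩_∂T` for all `w ∈ P_r(T)`. -/
def IsWeakDiv (r : ℕ) (T : Set (Space d)) (v : Fin d → WeakFn d) (D : Poly d) : Prop :=
  D.totalDegree ≤ r ∧ ∀ w : Poly d, w.totalDegree ≤ r →
    ∫ x in T, D.val x * w.val x =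
      -(∫ x in T, ∑ i, (v i).1 x * Poly.val (MvPolynomial.pderiv i w) x)
        + ∑ e ∈ M.facesOf T,
            ∫ x in e, (∑ i, (v i).2 e x * M.normal T e i) * w.val x ∂(surfaceMeasure d)

open Classical in
/-- The discrete weak gradient of a scalar weak function. -/
def weakGrad (r : ℕ) (T : Set (Space d)) (q : WeakFn d) : Fin d → Poly d :=
  if h : ∃ G, M.IsWeakGrad r T q G then h.choose else 0

open Classical in
/-- The discrete weak gradient of a vector weak function. -/
def weakGradVec (r : ℕ) (T : Set (Space d)) (v : Fin d → WeakFn d) : Fin d → Fin d → Poly d :=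
  if h : ∃ G, M.IsWeakGradVec r T v G then h.choose else 0

open Classical in
/-- The discrete weak divergence of a vector weak function. -/
def weakDiv (r : ℕ) (T : Set (Space d)) (v : Fin d → WeakFn d) : Poly d :=
  if h : ∃ D, M.IsWeakDiv r T v D then h.choose else 0

/-- The `(i,j)` entry, at `x`, of the discrete weak strain tensor
`ε_w v = (∇_w v + (∇_w v)ᵀ) / 2`. -/
def weakStrain (r : ℕ) (T : Set (Space d)) (v : Fin d → WeakFn d) (i j : Fin d)
    (x : Space d) : ℝ :=
  ((M.weakGradVec r T v i j).val x + (M.weakGradVec r T v j i).val x) / 2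

/-- The energy norm `|||v|||_{V_h}` of a vector weak function given by its restrictions `v T` to the
elements `T`: the square root of the sum of `2μ ‖ε_w v‖²_T + lam ‖∇_w·v‖²_T` over all `T`. -/
def energyNormV (k : ℕ) (μ lam : ℝ) (v : Set (Space d) → Fin d → WeakFn d) : ℝ :=
  √(∑ T ∈ M.elems,
    (2 * μ * (∫ x in T, ∑ i, ∑ j, M.weakStrain (M.weakDegree k T) T (v T) i j x ^ 2)
      + lam * ∫ x in T, (M.weakDiv (M.weakDegree k T) T (v T)).val x ^ 2))

/-- The energy norm `|||q|||_{W_h}` of a scalar weak function given by its restrictions `q T` to the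
elements `T`: the square root of the sum of `(K ∇_w q, ∇_w q)_T` over all `T`. -/
def energyNormW (k : ℕ) (K : Space d → Matrix (Fin d) (Fin d) ℝ)
    (q : Set (Space d) → WeakFn d) : ℝ :=
  √(∑ T ∈ M.elems,
    ∫ x in T, ∑ i, ∑ j, K x i j * (M.weakGrad (M.weakDegree k T) T (q T) j).val x
      * (M.weakGrad (M.weakDegree k T) T (q T) i).val x)

end PolytopalMesh

end WeakGalerkin

end

open MeasureTheory Filter Topology
open scoped ContDiff BigOperators ENNReal

noncomputable section

namespace WeakGalerkin

/-! ### Weak gradients and difference quotients -/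

/-! For fixed `T` and `j`, the `j`-th component of the discrete weak gradient of `q` is the
representer in `P_r(T)`, for the inner product of `L²(T)`, of the functional `w ↦ -(q_0, ∂_j w)_T +
⟨q_b, w n_j⟩_∂T` (`weakForm`). Testing with the component itself turns a bound `weakForm(w)² ≤ ε_T
‖w‖²_T` into a bound of its squared norm by `ε_T`, and strain, divergence and the quadratic form of
`K` are controlled by the components. So it is enough to find, for `q = u - Q_h u`, numbers `ε_T`
with `∑ ε_T ≤ C h^(2k) ‖u‖²_{k+1}` (`exists_weakForm_bound`). Of the degree `r` only an upper bound
in terms of `k` and the number of faces matters.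

On one element, Cauchy-Schwarz is combined with the inverse estimates `‖∂_j w‖_T ≤ C h_T^(-1) ‖w‖_T`
and `‖w‖_e ≤ C h_T^(-1/2) ‖w‖_T`. These hold uniformly for all sets of diameter `H` and volume at
least `ρ H^d`, by a compactness argument of Remez type (`Poly.exists_sq_add_gradSq_le`). As `Q_0`
and `Q_b` are best approximations, both projection errors are at most the error of one polynomial
`p` of degree `k`, and the trace inequality `exists_trace_estimate` bounds the error on a face by `C
h_T^(-1) (‖u - p‖²_T + h_T² ‖∇(u - p)‖²_T)`.

The trace is a limit of averages over `T ∩ B(x, r)`. Near almost every point of a face this set is a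
half ball up to a null set. The Poincaré inequality on half balls makes the averages converge;
pushing the half balls into the pyramid over the face, integrating over the face and letting `r → 0`
with Fatou's lemma gives the inequality. Everything rests on the formula `u(z + h) - u(z) = ∫₀¹ ∇u(z
+ t h)·h dt` for weakly differentiable `u` (`HasWeakGrad.sub_eq_integral`).

The polynomial `p` comes from a Bramble–Hilbert argument (`exists_bramble_hilbert`), carried out not
on `T`, which need not be star-shaped, but on a set `D_T ⊆ Ω` of diameter comparable to `h_T` that
contains the interior of `T` and is star-shaped with respect to a ball. The Lipschitz boundary
provides `D_T` if `h_T ≤ h₀`; for larger elements `p = 0` is good enough.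

In the sum over the elements, sets `D_T` of very different sizes may overlap without a uniform bound
on their number. But the `h_T` of those `D_T` that contain a given point add up to at most `N h`:
elements of comparable size are counted by volume, and the sizes form a geometric series
(`exists_sum_radii_le`). Since `h_T^(2k) ≤ h^(2k-1) h_T` for `k ≥ 1`, this weaker overlap property
suffices. -/

/-- `g` is the weak gradient of `u` on `Ω`. -/
def HasWeakGrad {d : ℕ} (Ω : Set (Space d)) (u : Space d → ℝ) (g : Fin d → Space d → ℝ) : Prop :=
  ∀ (i : Fin d) (φ : Space d → ℝ), ContDiff ℝ ∞ φ → HasCompactSupport φ → tsupport φ ⊆ Ω →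
    ∫ x in Ω, u x * partialDeriv i φ x = -∫ x in Ω, g i x * φ x

theorem fderiv_apply_eq_sum_partialDeriv {d : ℕ} (φ : Space d → ℝ) (x h : Space d) :
    fderiv ℝ φ x h = ∑ i, h i * partialDeriv i φ x := by
  have : h = ∑ i, h i • EuclideanSpace.single i (1 : ℝ) := by
    ext j
    simp [Finset.sum_apply, Pi.single_apply]
  conv_lhs => rw [this]
  simp [partialDeriv, map_sum]

/-- Extending `u` and `g` by zero lets the directional form of the definition live on the whole
space, where translations are unrestricted. -/
theorem HasWeakGrad.integral_indicator_fderiv {d : ℕ} {Ω : Set (Space d)} (hΩ : MeasurableSet Ω)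
    {u : Space d → ℝ} {g : Fin d → Space d → ℝ} (hug : HasWeakGrad Ω u g)
    (hu : IntegrableOn u Ω) (hg : ∀ i, IntegrableOn (g i) Ω) (h : Space d)
    {φ : Space d → ℝ} (hφ : ContDiff ℝ ∞ φ) (hc : HasCompactSupport φ) (hs : tsupport φ ⊆ Ω) :
    ∫ x, Ω.indicator u x * fderiv ℝ φ x h
      = -∫ x, (∑ i, Ω.indicator (g i) x * h i) * φ x := by
  have hφb : ∃ C, ∀ x, ‖φ x‖ ≤ C := hc.exists_bound_of_continuous hφ.continuous
  have hdc : ∀ i, Continuous (partialDeriv i φ) := fun i =>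
    (hφ.continuous_fderiv (by simp)).clm_apply continuous_const
  have hds : ∀ i, HasCompactSupport (partialDeriv i φ) := fun i => hc.fderiv_apply (𝕜 := ℝ) _
  have key : ∀ i, ∫ x, h i * (Ω.indicator u x * partialDeriv i φ x)
      = -∫ x, Ω.indicator (g i) x * h i * φ x := by
    intro i
    have h1 := hug i φ hφ hc hs
    rw [← integral_indicator hΩ, ← integral_indicator hΩ] at h1
    simp only [Set.indicator_mul_left] at h1
    rw [integral_const_mul, h1, mul_neg, ← integral_const_mul]
    congr 2
    ext x
    ring
  have hui : Integrable (Ω.indicator u) := (integrable_indicator_iff hΩ).2 hu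
  have hgi : ∀ i, Integrable (Ω.indicator (g i)) := fun i => (integrable_indicator_iff hΩ).2 (hg i)
  simp only [fderiv_apply_eq_sum_partialDeriv, Finset.mul_sum, Finset.sum_mul]
  rw [integral_finsetSum, integral_finsetSum, ← Finset.sum_neg_distrib]
  · refine Finset.sum_congr rfl fun i _ => ?_
    rw [← key i]
    congr 1
    ext x
    ring
  · intro i _
    obtain ⟨C, hC⟩ := hφb
    exact ((hgi i).mul_const _).mul_bdd (c := C) hφ.continuous.aestronglyMeasurable
      (Eventually.of_forall hC)
  · intro i _
    obtain ⟨C, hC⟩ := (hds i).exists_bound_of_continuous (hdc i)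
    have : Integrable fun x => Ω.indicator u x * partialDeriv i φ x :=
      hui.mul_bdd (c := C) (hdc i).aestronglyMeasurable (Eventually.of_forall hC)
    refine (this.const_mul (h i)).congr (Eventually.of_forall fun x => ?_)
    simp only
    ring

/-- The map `(t, z) ↦ (t, z + t h)` preserves the measure. -/
theorem measurePreserving_shear {d : ℕ} (ν : Measure ℝ) [SFinite ν] (h : Space d) :
    MeasurePreserving (fun p : ℝ × Space d => (p.1, p.2 + p.1 • h))
      (ν.prod volume) (ν.prod volume) := by
  refine (MeasurePreserving.id ν).skew_product (g := fun t z => z + t • h) (by fun_prop) ?_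
  exact Eventually.of_forall fun t => (measurePreserving_add_right volume (t • h)).map_eq

theorem integrable_comp_shear {d : ℕ} {G : Space d → ℝ} (hG : Integrable G) (h : Space d) :
    Integrable (fun p : ℝ × Space d => G (p.2 + p.1 • h))
      ((volume.restrict (Set.uIoc (0 : ℝ) 1)).prod volume) := by
  have : IsFiniteMeasure (volume.restrict (Set.uIoc (0 : ℝ) 1)) :=
    ⟨by simp⟩
  have h1 : Integrable (fun p : ℝ × Space d => G p.2)
      ((volume.restrict (Set.uIoc (0 : ℝ) 1)).prod volume) := by
    exact hG.comp_snd _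
  exact ((measurePreserving_shear _ h).integrable_comp h1.aestronglyMeasurable).2 h1

/-- By duality, without smoothing `u`. Tested against `φ` supported in `Z`, the difference moves
onto `φ` as `φ(y - h) - φ(y)`, which is an integral of derivatives of the translates `φ(· - t h)`.
Each translate is supported in `Ω`, because the segments from `Z` in direction `h` stay there, so it
is admissible in the definition of the weak gradient. Fubini's theorem then shows that the
difference of the two sides is orthogonal to all test functions on `Z`. -/
theorem HasWeakGrad.sub_eq_integral {d : ℕ} {Ω : Set (Space d)} (hΩ : MeasurableSet Ω)
    {u : Space d → ℝ} {g : Fin d → Space d → ℝ} (hug : HasWeakGrad Ω u g)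
    (hu : IntegrableOn u Ω) (hg : ∀ i, IntegrableOn (g i) Ω) {Z : Set (Space d)} (hZ : IsOpen Z)
    (h : Space d) (hZΩ : ∀ z ∈ Z, ∀ t ∈ Set.Icc (0 : ℝ) 1, z + t • h ∈ Ω) :
    ∀ᵐ z, z ∈ Z → Ω.indicator u (z + h) - Ω.indicator u z
      = ∫ t in (0 : ℝ)..1, ∑ i, Ω.indicator (g i) (z + t • h) * h i := by
  set U := Ω.indicator u with hU
  set G : Space d → ℝ := fun z => ∑ i, Ω.indicator (g i) z * h i with hG
  have hUi : Integrable U := (integrable_indicator_iff hΩ).2 hu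
  have hGi : Integrable G := integrable_finsetSum _ fun i _ =>
    ((integrable_indicator_iff hΩ).2 (hg i)).mul_const _
  have hshear := integrable_comp_shear hGi h
  have hΓi : Integrable fun z => ∫ t in (0 : ℝ)..1, G (z + t • h) := by
    simp only [intervalIntegral.integral_of_le zero_le_one]
    have := hshear.integral_prod_right
    simpa [Set.uIoc_of_le (zero_le_one' ℝ)] using this
  have hUh : Integrable fun z => U (z + h) := hUi.comp_add_right h
  have hloc : LocallyIntegrableOn
      (fun z => U (z + h) - U z - ∫ t in (0 : ℝ)..1, G (z + t • h)) Z :=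
    ((hUh.sub hUi).sub hΓi).locallyIntegrable.locallyIntegrableOn _
  have := hZ.ae_eq_zero_of_integral_contDiff_smul_eq_zero hloc ?_
  · filter_upwards [this] with z hz hzZ
    exact sub_eq_zero.1 (hz hzZ)
  intro φ hφ hc hs
  obtain ⟨Cφ, hCφ⟩ := hc.exists_bound_of_continuous hφ.continuous
  have hdc : Continuous fun x => fderiv ℝ φ x h :=
    (hφ.continuous_fderiv (by simp)).clm_apply continuous_const
  obtain ⟨Cd, hCd⟩ := (hc.fderiv_apply (𝕜 := ℝ) h).exists_bound_of_continuous hdc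
  have hbdd : ∀ {f : Space d → ℝ}, Integrable f → Integrable fun x => φ x * f x := fun hf =>
    hf.bdd_mul (c := Cφ) hφ.continuous.aestronglyMeasurable (Eventually.of_forall hCφ)
  simp only [smul_eq_mul, mul_sub]
  have hsub : Integrable fun x => φ x * U (x + h) - φ x * U x := (hbdd hUh).sub (hbdd hUi)
  rw [integral_sub hsub (hbdd hΓi), integral_sub (hbdd hUh) (hbdd hUi), sub_eq_zero]
  have e1 : ∫ z, φ z * U (z + h) = ∫ y, φ (y - h) * U y := by
    rw [← integral_sub_right_eq_self (fun z => φ z * U (z + h)) h]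
    simp
  have ftc : ∀ y, φ (y - h) - φ y = -∫ t in (0 : ℝ)..1, fderiv ℝ φ (y - t • h) h := by
    intro y
    have hd : ∀ t ∈ Set.uIcc (0 : ℝ) 1,
        HasDerivAt (fun t : ℝ => φ (y - t • h)) (-fderiv ℝ φ (y - t • h) h) t := by
      intro t _
      have h1 : HasFDerivAt φ (fderiv ℝ φ (y - t • h)) (y - t • h) :=
        (hφ.differentiable (by simp)).differentiableAt.hasFDerivAt
      have h2 : HasDerivAt (fun t : ℝ => y - t • h) (-h) t := by
        simpa using ((hasDerivAt_id t).smul_const h).const_sub y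
      have h3 := h1.comp_hasDerivAt t h2
      rw [map_neg] at h3
      exact h3
    have hci : Continuous fun t : ℝ => -fderiv ℝ φ (y - t • h) h := by
      have : Continuous fun t : ℝ => y - t • h := by fun_prop
      exact (hdc.comp this).neg
    have := intervalIntegral.integral_eq_sub_of_hasDerivAt hd (hci.intervalIntegrable _ _)
    simp only [one_smul, zero_smul, sub_zero, intervalIntegral.integral_neg] at this
    exact this.symm
  have hprod1 : Integrable (fun p : ℝ × Space d => U p.2 * fderiv ℝ φ (p.2 - p.1 • h) h)
      ((volume.restrict (Set.uIoc (0 : ℝ) 1)).prod volume) := by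
    have : IsFiniteMeasure (volume.restrict (Set.uIoc (0 : ℝ) 1)) :=
      ⟨by simp⟩
    have h1 : Integrable (fun p : ℝ × Space d => U p.2)
        ((volume.restrict (Set.uIoc (0 : ℝ) 1)).prod volume) := by
      exact hUi.comp_snd _
    have hcc : Continuous fun p : ℝ × Space d => p.2 - p.1 • h := by fun_prop
    exact h1.mul_bdd (c := Cd) (hdc.comp hcc).aestronglyMeasurable
      (Eventually.of_forall fun p => hCd _)
  have hprod2 : Integrable (fun p : ℝ × Space d => φ p.2 * G (p.2 + p.1 • h))
      ((volume.restrict (Set.uIoc (0 : ℝ) 1)).prod volume) :=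
    hshear.bdd_mul (c := Cφ) (hφ.continuous.comp continuous_snd).aestronglyMeasurable
      (Eventually.of_forall fun p => hCφ _)
  have e2 : (∫ z, φ z * U (z + h)) - ∫ z, φ z * U z
      = -∫ y, ∫ t in (0 : ℝ)..1, U y * fderiv ℝ φ (y - t • h) h := by
    have hφh : Integrable fun y => φ (y - h) * U y :=
      hUi.bdd_mul (c := Cφ) (hφ.continuous.comp (by fun_prop)).aestronglyMeasurable
        (Eventually.of_forall fun y => hCφ _)
    rw [e1, ← integral_sub hφh (hbdd hUi), ← integral_neg]
    congr 1
    ext y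
    rw [← sub_mul, ftc y, intervalIntegral.integral_const_mul]
    ring
  have swap1 : ∫ y, ∫ t in (0 : ℝ)..1, U y * fderiv ℝ φ (y - t • h) h
      = ∫ t in (0 : ℝ)..1, ∫ y, U y * fderiv ℝ φ (y - t • h) h := by
    exact (intervalIntegral_integral_swap hprod1).symm
  have swap2 : ∫ y, ∫ t in (0 : ℝ)..1, φ y * G (y + t • h)
      = ∫ t in (0 : ℝ)..1, ∫ y, φ y * G (y + t • h) := by
    exact (intervalIntegral_integral_swap hprod2).symm
  have e3 : ∀ t ∈ Set.uIcc (0 : ℝ) 1, ∫ y, U y * fderiv ℝ φ (y - t • h) h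
      = -∫ y, φ y * G (y + t • h) := by
    intro t ht
    rw [Set.uIcc_of_le zero_le_one] at ht
    set ψ : Space d → ℝ := fun y => φ (y - t • h) with hψ
    have hψd : ContDiff ℝ ∞ ψ := hφ.comp (by fun_prop)
    have hψc : HasCompactSupport ψ := by
      have := hc.comp_homeomorph (Homeomorph.subRight (t • h))
      exact this
    have hψs : tsupport ψ ⊆ Ω := by
      intro y hy
      have hy' := tsupport_comp_subset_preimage φ (f := fun y => y - t • h) (by fun_prop) hy
      have := hZΩ _ (hs hy') t ht
      simpa using this
    have hfd : ∀ y, fderiv ℝ ψ y h = fderiv ℝ φ (y - t • h) h := fun y => by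
      rw [hψ, fderiv_comp_sub]
    have := hug.integral_indicator_fderiv hΩ hu hg h hψd hψc hψs
    simp only [hfd] at this
    rw [this, ← integral_add_right_eq_self _ (t • h)]
    congr 2
    ext y
    simp [hψ, hG]
    ring
  have e4 : ∫ z, φ z * ∫ t in (0 : ℝ)..1, G (z + t • h)
      = ∫ y, ∫ t in (0 : ℝ)..1, φ y * G (y + t • h) := by
    congr 1
    ext y
    rw [intervalIntegral.integral_const_mul]
  rw [e2, e4, swap1, swap2, intervalIntegral.integral_congr e3, intervalIntegral.integral_neg,
    neg_neg]

/-! ### The Cauchy-Schwarz inequality for integrals -/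

theorem enorm_sq_eq_ofReal (r : ℝ) : ‖r‖ₑ ^ 2 = ENNReal.ofReal (r ^ 2) := by
  rw [Real.enorm_eq_ofReal_abs, ← ENNReal.ofReal_pow (abs_nonneg r), sq_abs]

theorem lintegral_mul_sq_le {α : Type*} [MeasurableSpace α] {ν : Measure α} {f g : α → ℝ≥0∞}
    (hf : AEMeasurable f ν) (hg : AEMeasurable g ν) :
    (∫⁻ x, f x * g x ∂ν) ^ 2 ≤ (∫⁻ x, f x ^ 2 ∂ν) * ∫⁻ x, g x ^ 2 ∂ν := by
  have h := ENNReal.lintegral_mul_le_Lp_mul_Lq ν Real.HolderConjugate.two_two hf hg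
  simp only [Pi.mul_apply, ENNReal.rpow_two] at h
  calc (∫⁻ x, f x * g x ∂ν) ^ 2
      ≤ ((∫⁻ x, f x ^ 2 ∂ν) ^ (1 / 2 : ℝ) * (∫⁻ x, g x ^ 2 ∂ν) ^ (1 / 2 : ℝ)) ^ 2 := by gcongr
    _ = _ := by
      rw [mul_pow, ← ENNReal.rpow_two, ← ENNReal.rpow_two, ← ENNReal.rpow_mul,
        ← ENNReal.rpow_mul]
      norm_num

theorem enorm_integral_sq_le {α : Type*} [MeasurableSpace α] {ν : Measure α} {f : α → ℝ}
    (hf : AEMeasurable f ν) :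
    ‖∫ x, f x ∂ν‖ₑ ^ 2 ≤ ν Set.univ * ∫⁻ x, ‖f x‖ₑ ^ 2 ∂ν := by
  have h := lintegral_mul_sq_le (ν := ν) (f := fun _ => 1) (g := fun x => ‖f x‖ₑ)
    aemeasurable_const hf.enorm
  simp only [one_mul, one_pow, lintegral_one] at h
  exact (pow_le_pow_left₀ zero_le (enorm_integral_le_lintegral_enorm f) 2).trans h

theorem enorm_sum_mul_sq_le {d : ℕ} (g : Fin d → ℝ) (h : Space d) :
    ‖∑ i, g i * h i‖ₑ ^ 2 ≤ ‖h‖ₑ ^ 2 * ∑ i, ‖g i‖ₑ ^ 2 := by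
  have h1 : ‖h‖ₑ ^ 2 = ENNReal.ofReal (∑ i, h i ^ 2) := by
    rw [← ofReal_norm, ← ENNReal.ofReal_pow (norm_nonneg _), EuclideanSpace.norm_sq_eq]
    simp
  rw [h1, enorm_sq_eq_ofReal]
  simp only [enorm_sq_eq_ofReal]
  rw [← ENNReal.ofReal_sum_of_nonneg fun i _ => sq_nonneg _,
    ← ENNReal.ofReal_mul (Finset.sum_nonneg fun i _ => sq_nonneg _)]
  refine ENNReal.ofReal_le_ofReal ?_
  rw [mul_comm]
  exact Finset.sum_mul_sq_le_sq_mul_sq _ _ _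

/-! ### The Poincaré inequality on star-shaped domains -/

theorem lintegral_comp_affine {d : ℕ} (f : Space d → ℝ≥0∞) (a : Space d)
    {t : ℝ} (ht : t ≠ 0) :
    ∫⁻ x, f (a + t • x) = ENNReal.ofReal (|t ^ d|⁻¹) * ∫⁻ x, f x := by
  have := Measure.map_addHaar_smul (volume : Measure (Space d)) ht
  calc ∫⁻ x, f (a + t • x) = ∫⁻ y, f (a + y) ∂(Measure.map (fun x => t • x) volume) :=
        ((Homeomorph.smulOfNeZero t ht :
          Space d ≃ₜ Space d).toMeasurableEquiv.measurableEmbedding.lintegral_map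
          (fun y => f (a + y))).symm
    _ = ENNReal.ofReal (|t ^ d|⁻¹) * ∫⁻ y, f (a + y) := by
        rw [this, lintegral_smul_measure]
        simp [abs_inv]
    _ = _ := by rw [lintegral_add_left_eq_self f a]

/-- The square of the length of the gradient, extended by zero. -/
def gradSq {d : ℕ} (Ω : Set (Space d)) (g : Fin d → Space d → ℝ) (z : Space d) : ℝ≥0∞ :=
  ∑ i, ‖Ω.indicator (g i) z‖ₑ ^ 2

theorem measurable_gradSq {d : ℕ} {Ω : Set (Space d)} (hΩ : MeasurableSet Ω)
    {g : Fin d → Space d → ℝ} (hg : ∀ i, Measurable (g i)) : Measurable (gradSq Ω g) := by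
  unfold gradSq
  exact Finset.measurable_sum _ fun i _ => ((hg i).indicator hΩ).enorm.pow_const 2

theorem HasWeakGrad.enorm_sub_sq_le {d : ℕ} {Ω : Set (Space d)} (hΩ : MeasurableSet Ω)
    {u : Space d → ℝ} {g : Fin d → Space d → ℝ} (hug : HasWeakGrad Ω u g)
    (hu : IntegrableOn u Ω) (hg : ∀ i, IntegrableOn (g i) Ω)
    (hgm : ∀ i, Measurable (g i)) {Z : Set (Space d)} (hZ : IsOpen Z)
    (h : Space d) (hZΩ : ∀ z ∈ Z, ∀ t ∈ Set.Icc (0 : ℝ) 1, z + t • h ∈ Ω) :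
    ∀ᵐ z, z ∈ Z → ‖Ω.indicator u (z + h) - Ω.indicator u z‖ₑ ^ 2
      ≤ ‖h‖ₑ ^ 2 * ∫⁻ t in Set.Ioc (0 : ℝ) 1, gradSq Ω g (z + t • h) := by
  filter_upwards [hug.sub_eq_integral hΩ hu hg hZ h hZΩ] with z hz hzZ
  rw [hz hzZ, intervalIntegral.integral_of_le zero_le_one]
  have hm : ∀ i, Measurable fun t : ℝ => Ω.indicator (g i) (z + t • h) := fun i =>
    ((hgm i).indicator hΩ).comp (by fun_prop)
  refine (enorm_integral_sq_le (Finset.measurable_sum _ fun i _ =>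
    (hm i).mul_const _).aemeasurable).trans ?_
  simp only [MeasurableSet.univ, Measure.restrict_apply, Set.univ_inter, Real.volume_Ioc, sub_zero,
    ENNReal.ofReal_one, one_mul]
  rw [← lintegral_const_mul]
  · exact lintegral_mono fun t => enorm_sum_mul_sq_le _ _
  · exact (measurable_gradSq hΩ hgm).comp (by fun_prop)

theorem HasWeakGrad.congr_ae {d : ℕ} {Ω : Set (Space d)} {u u' : Space d → ℝ}
    {g g' : Fin d → Space d → ℝ} (hug : HasWeakGrad Ω u g) (hu : u =ᵐ[volume.restrict Ω] u')
    (hg : ∀ i, g i =ᵐ[volume.restrict Ω] g' i) : HasWeakGrad Ω u' g' := by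
  intro i φ hφ hc hs
  have h := hug i φ hφ hc hs
  have e1 : ∫ x in Ω, u x * partialDeriv i φ x = ∫ x in Ω, u' x * partialDeriv i φ x :=
    integral_congr_ae (hu.mono fun x hx => by simp [hx])
  have e2 : ∫ x in Ω, g i x * φ x = ∫ x in Ω, g' i x * φ x :=
    integral_congr_ae ((hg i).mono fun x hx => by simp [hx])
  rw [← e1, ← e2, h]

/-- The difference formula bounds `|u x - u y|²` by `R²` times the mean of `|∇u|²` over the segment
from `y` to `x`. Only segments issuing from `B` occur, so star-shapedness with respect to `B` is all
that is needed. Both variables are integrated before `t`, because for each `t` one of them can be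
traded for the point `y + t (x - y)` with a bounded Jacobian. -/
theorem HasWeakGrad.lintegral_sub_sq_le_of_measurable {d : ℕ} {Ω D B : Set (Space d)}
    (hΩ : MeasurableSet Ω)
    {u : Space d → ℝ} {g : Fin d → Space d → ℝ} (hug : HasWeakGrad Ω u g)
    (hu : IntegrableOn u Ω) (hg : ∀ i, IntegrableOn (g i) Ω) (hum : Measurable u)
    (hgm : ∀ i, Measurable (g i)) (hD : IsOpen D) (hB : IsOpen B) (hDΩ : D ⊆ Ω) (hBD : B ⊆ D)
    (hstar : ∀ b ∈ B, ∀ z ∈ D, ∀ t ∈ Set.Icc (0 : ℝ) 1, b + t • (z - b) ∈ D) {R : ℝ}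
    (hR : ∀ x ∈ D, ∀ y ∈ D, ‖x - y‖ ≤ R) :
    ∫⁻ y in B, ∫⁻ x in D, ‖u x - u y‖ₑ ^ 2
      ≤ ENNReal.ofReal (R ^ 2 * 2 ^ d) * volume D * ∫⁻ z in D, ∑ i, ‖g i z‖ₑ ^ 2 := by
  classical
  set N : Space d → ℝ≥0∞ := D.indicator fun z => ∑ i, ‖g i z‖ₑ ^ 2 with hN
  have hgs : Measurable fun z => ∑ i, ‖g i z‖ₑ ^ 2 :=
    Finset.measurable_sum _ fun i _ => (hgm i).enorm.pow_const 2
  have hNm : Measurable N := hgs.indicator hD.measurableSet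
  set χ : Space d × Space d → ℝ≥0∞ := (B ×ˢ D).indicator 1 with hχ
  have hχm : Measurable χ := measurable_one.indicator (hB.measurableSet.prod hD.measurableSet)
  have hχ1 : ∀ p, χ p ≤ 1 := fun p => Set.indicator_le_self' (by simp) p
  have hFm : Measurable fun p : Space d × Space d => χ p * ‖u p.2 - u p.1‖ₑ ^ 2 :=
    hχm.mul (((hum.comp measurable_snd).sub (hum.comp measurable_fst)).enorm.pow_const 2)
  have e0 : ∫⁻ y in B, ∫⁻ x in D, ‖u x - u y‖ₑ ^ 2
      = ∫⁻ y, ∫⁻ x, χ (y, x) * ‖u x - u y‖ₑ ^ 2 := by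
    rw [← lintegral_indicator hB.measurableSet]
    refine lintegral_congr fun y => ?_
    by_cases hy : y ∈ B
    · rw [Set.indicator_of_mem hy, ← lintegral_indicator hD.measurableSet]
      refine lintegral_congr fun x => ?_
      by_cases hx : x ∈ D <;> simp [hχ, hx, hy]
    · simp [hχ, hy]
  -- Passes from pairs `(y, x)` to a start `y` and a displacement `h = x - y`, since the difference
  -- formula holds almost everywhere for each fixed `h`.
  have sh : ∀ F : Space d × Space d → ℝ≥0∞, Measurable F →
      ∫⁻ y, ∫⁻ x, F (y, x) = ∫⁻ h : Space d, ∫⁻ y, F (y, y + h) := by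
    intro F hF
    have hm : Measurable fun p : Space d × Space d => F (p.2, p.2 + p.1) :=
      hF.comp (by fun_prop)
    rw [lintegral_lintegral_swap (f := fun h y => F (y, y + h)) hm.aemeasurable]
    refine lintegral_congr fun y => ?_
    exact (lintegral_add_left_eq_self (μ := volume) (fun x => F (y, x)) y).symm
  have step : ∀ h : Space d, ∫⁻ y, χ (y, y + h) * ‖u (y + h) - u y‖ₑ ^ 2
      ≤ ∫⁻ y, ENNReal.ofReal (R ^ 2) *
        ∫⁻ t in Set.Ioc (0 : ℝ) 1, χ (y, y + h) * N (y + t • h) := by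
    intro h
    refine lintegral_mono_ae ?_
    have hZ : IsOpen {z | z ∈ B ∧ z + h ∈ D} :=
      hB.inter (hD.preimage (by fun_prop : Continuous fun z => z + h))
    have hseg : ∀ z ∈ {z | z ∈ B ∧ z + h ∈ D}, ∀ t ∈ Set.Icc (0 : ℝ) 1, z + t • h ∈ D := by
      rintro z ⟨hz1, hz2⟩ t ht
      simpa using hstar z hz1 _ hz2 t ht
    filter_upwards [hug.enorm_sub_sq_le hΩ hu hg hgm hZ h
      fun z hz t ht => hDΩ (hseg z hz t ht)] with z hz
    by_cases hzZ : z ∈ {z | z ∈ B ∧ z + h ∈ D}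
    · have h1 := hz hzZ
      have hzD : z ∈ D := hBD hzZ.1
      rw [Set.indicator_of_mem (hDΩ hzZ.2), Set.indicator_of_mem (hDΩ hzD)] at h1
      have hχv : χ (z, z + h) = 1 := by simp [hχ, hzZ.1, hzZ.2]
      simp only [hχv, one_mul]
      refine h1.trans (mul_le_mul' ?_ ?_)
      · rw [← ofReal_norm, ← ENNReal.ofReal_pow (norm_nonneg _)]
        refine ENNReal.ofReal_le_ofReal ?_
        have := hR _ hzZ.2 _ hzD
        rw [add_sub_cancel_left] at this
        gcongr
      · refine setLIntegral_mono_ae (hNm.comp (by fun_prop)).aemeasurable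
          (Eventually.of_forall fun t ht => ?_)
        have hm := hseg z hzZ t ⟨ht.1.le, ht.2⟩
        simp [hN, gradSq, hm, hDΩ hm]
    · have hχv : χ (z, z + h) = 0 := by
        simp only [Set.mem_ofPred_eq] at hzZ
        simp [hχ, hzZ]
      simp [hχv]
  have hKm : Measurable fun q : (Space d × Space d) × ℝ =>
      χ (q.1.1, q.1.2) * N (q.1.1 + q.2 • (q.1.2 - q.1.1)) :=
    (hχm.comp (by fun_prop)).mul (hNm.comp (by fun_prop))
  have hKt : ∀ t ∈ Set.Ioc (0 : ℝ) 1, ∫⁻ y, ∫⁻ x, χ (y, x) * N (y + t • (x - y))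
      ≤ ENNReal.ofReal (2 ^ d) * volume D * ∫⁻ z, N z := by
    intro t ht
    have hKtm : Measurable fun p : Space d × Space d => χ p * N (p.1 + t • (p.2 - p.1)) :=
      hχm.mul (hNm.comp (by fun_prop))
    have hc : ∀ s : ℝ, 1 / 2 ≤ s → ENNReal.ofReal (|s ^ d|⁻¹) ≤ ENNReal.ofReal (2 ^ d) := by
      intro s hs
      refine ENNReal.ofReal_le_ofReal ?_
      rw [abs_of_nonneg (by positivity), ← inv_pow]
      gcongr
      rw [inv_le_comm₀ (by linarith) (by norm_num)]
      linarith
    -- For `t ≥ 1/2` the point `y + t (x - y)` replaces `x`, with Jacobian factor `t^(-d)`; for `t ≤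
    -- 1/2` it replaces `y`, with factor `(1 - t)^(-d)`. Both are at most `2^d`.
    rcases le_total (1 / 2) t with h2 | h2
    · calc ∫⁻ y, ∫⁻ x, χ (y, x) * N (y + t • (x - y))
          ≤ ∫⁻ y, B.indicator (fun _ => ENNReal.ofReal (2 ^ d) * ∫⁻ z, N z) y := by
            refine lintegral_mono fun y => ?_
            by_cases hy : y ∈ B
            · rw [Set.indicator_of_mem hy]
              calc ∫⁻ x, χ (y, x) * N (y + t • (x - y)) ≤ ∫⁻ x, N ((y - t • y) + t • x) := by
                    refine lintegral_mono fun x => ?_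
                    refine (mul_le_mul' (hχ1 _) le_rfl).trans ?_
                    rw [one_mul, smul_sub, show y + (t • x - t • y) = y - t • y + t • x by abel]
                _ ≤ _ := by
                    rw [lintegral_comp_affine _ _ (by linarith : t ≠ 0)]
                    exact mul_le_mul' (hc t h2) le_rfl
            · rw [Set.indicator_of_notMem hy]
              simp [hχ, hy]
        _ = ENNReal.ofReal (2 ^ d) * (∫⁻ z, N z) * volume B := by
            rw [lintegral_indicator_const hB.measurableSet]
        _ ≤ ENNReal.ofReal (2 ^ d) * (∫⁻ z, N z) * volume D := by gcongr
        _ = _ := by ring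
    · rw [lintegral_lintegral_swap hKtm.aemeasurable]
      calc ∫⁻ x, ∫⁻ y, χ (y, x) * N (y + t • (x - y))
          ≤ ∫⁻ x, D.indicator (fun _ => ENNReal.ofReal (2 ^ d) * ∫⁻ z, N z) x := by
            refine lintegral_mono fun x => ?_
            by_cases hx : x ∈ D
            · rw [Set.indicator_of_mem hx]
              calc ∫⁻ y, χ (y, x) * N (y + t • (x - y)) ≤ ∫⁻ y, N (t • x + (1 - t) • y) := by
                    refine lintegral_mono fun y => ?_
                    refine (mul_le_mul' (hχ1 _) le_rfl).trans ?_
                    rw [one_mul, smul_sub, sub_smul, one_smul,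
                      show y + (t • x - t • y) = t • x + (y - t • y) by abel]
                _ ≤ _ := by
                    rw [lintegral_comp_affine _ _ (by linarith : (1 - t) ≠ 0)]
                    exact mul_le_mul' (hc (1 - t) (by linarith)) le_rfl
            · rw [Set.indicator_of_notMem hx]
              simp [hχ, hx]
        _ = ENNReal.ofReal (2 ^ d) * (∫⁻ z, N z) * volume D := by
            rw [lintegral_indicator_const hD.measurableSet]
        _ = _ := by ring
  have eN : ∫⁻ z, N z = ∫⁻ z in D, ∑ i, ‖g i z‖ₑ ^ 2 := lintegral_indicator hD.measurableSet _
  have hG2 : Measurable fun p : Space d × Space d => ENNReal.ofReal (R ^ 2) *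
      ∫⁻ t in Set.Ioc (0 : ℝ) 1, χ (p.1, p.2) * N (p.1 + t • (p.2 - p.1)) :=
    (hKm.lintegral_prod_right' (ν := volume.restrict (Set.Ioc (0 : ℝ) 1))).const_mul _
  calc ∫⁻ y in B, ∫⁻ x in D, ‖u x - u y‖ₑ ^ 2
      = ∫⁻ h : Space d, ∫⁻ y, χ (y, y + h) * ‖u (y + h) - u y‖ₑ ^ 2 := by rw [e0, sh _ hFm]
    _ ≤ ∫⁻ h : Space d, ∫⁻ y, ENNReal.ofReal (R ^ 2) *
          ∫⁻ t in Set.Ioc (0 : ℝ) 1, χ (y, y + h) * N (y + t • h) := lintegral_mono step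
    _ = ∫⁻ y, ∫⁻ x, ENNReal.ofReal (R ^ 2) *
          ∫⁻ t in Set.Ioc (0 : ℝ) 1, χ (y, x) * N (y + t • (x - y)) := by
        rw [sh _ hG2]
        simp
    _ = ENNReal.ofReal (R ^ 2) * ∫⁻ p : Space d × Space d,
          ∫⁻ t in Set.Ioc (0 : ℝ) 1, χ (p.1, p.2) * N (p.1 + t • (p.2 - p.1)) := by
        rw [lintegral_lintegral (f := fun y x => ENNReal.ofReal (R ^ 2) *
          ∫⁻ t in Set.Ioc (0 : ℝ) 1, χ (y, x) * N (y + t • (x - y))) hG2.aemeasurable,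
          lintegral_const_mul _
            (hKm.lintegral_prod_right' (ν := volume.restrict (Set.Ioc (0 : ℝ) 1)))]
        rfl
    _ = ENNReal.ofReal (R ^ 2) * ∫⁻ t in Set.Ioc (0 : ℝ) 1,
          ∫⁻ y, ∫⁻ x, χ (y, x) * N (y + t • (x - y)) := by
        congr 1
        rw [lintegral_lintegral_swap hKm.aemeasurable]
        refine lintegral_congr fun t => ?_
        exact (lintegral_lintegral (f := fun y x => χ (y, x) * N (y + t • (x - y)))
          (hχm.mul (hNm.comp (by fun_prop))).aemeasurable).symm
    _ ≤ ENNReal.ofReal (R ^ 2) * ∫⁻ t in Set.Ioc (0 : ℝ) 1,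
          ENNReal.ofReal (2 ^ d) * volume D * ∫⁻ z, N z := by
        exact mul_le_mul' le_rfl (setLIntegral_mono measurable_const hKt)
    _ = _ := by
        rw [setLIntegral_const, ENNReal.ofReal_mul (sq_nonneg R), eN]
        simp
        ring

theorem HasWeakGrad.lintegral_sub_sq_le {d : ℕ} {Ω D B : Set (Space d)}
    (hΩ : MeasurableSet Ω)
    {u : Space d → ℝ} {g : Fin d → Space d → ℝ} (hug : HasWeakGrad Ω u g)
    (hu : IntegrableOn u Ω) (hg : ∀ i, IntegrableOn (g i) Ω)
    (hD : IsOpen D) (hB : IsOpen B) (hDΩ : D ⊆ Ω) (hBD : B ⊆ D)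
    (hstar : ∀ b ∈ B, ∀ z ∈ D, ∀ t ∈ Set.Icc (0 : ℝ) 1, b + t • (z - b) ∈ D) {R : ℝ}
    (hR : ∀ x ∈ D, ∀ y ∈ D, ‖x - y‖ ≤ R) :
    ∫⁻ y in B, ∫⁻ x in D, ‖u x - u y‖ₑ ^ 2
      ≤ ENNReal.ofReal (R ^ 2 * 2 ^ d) * volume D * ∫⁻ z in D, ∑ i, ‖g i z‖ₑ ^ 2 := by
  set u' := hu.aemeasurable.mk u with hu'
  set g' : Fin d → Space d → ℝ := fun i => (hg i).aemeasurable.mk (g i) with hg'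
  have eu : u =ᵐ[volume.restrict Ω] u' := hu.aemeasurable.ae_eq_mk
  have eg : ∀ i, g i =ᵐ[volume.restrict Ω] g' i := fun i => (hg i).aemeasurable.ae_eq_mk
  have main := (hug.congr_ae eu eg).lintegral_sub_sq_le_of_measurable hΩ (hu.congr eu)
    (fun i => (hg i).congr (eg i)) hu.aemeasurable.measurable_mk
    (fun i => (hg i).aemeasurable.measurable_mk) hD hB hDΩ hBD hstar hR
  have euD : u =ᵐ[volume.restrict D] u' := ae_restrict_of_ae_restrict_of_subset hDΩ eu
  have euB : u =ᵐ[volume.restrict B] u' := ae_restrict_of_ae_restrict_of_subset hBD euD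
  have e1 : ∫⁻ y in B, ∫⁻ x in D, ‖u x - u y‖ₑ ^ 2 = ∫⁻ y in B, ∫⁻ x in D, ‖u' x - u' y‖ₑ ^ 2 := by
    refine lintegral_congr_ae (euB.mono fun y hy => ?_)
    refine lintegral_congr_ae (euD.mono fun x hx => ?_)
    simp only [hx, hy]
  have e2 : ∫⁻ z in D, ∑ i, ‖g i z‖ₑ ^ 2 = ∫⁻ z in D, ∑ i, ‖g' i z‖ₑ ^ 2 := by
    refine lintegral_congr_ae ?_
    have : ∀ᵐ z ∂(volume.restrict D), ∀ i, g i z = g' i z :=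
      ae_all_iff.2 fun i => ae_restrict_of_ae_restrict_of_subset hDΩ (eg i)
    filter_upwards [this] with z hz
    simp only [hz]
  rw [e1, e2]
  exact main

/-! ### Surface measure on hyperplanes -/

/-- The affine hyperplane `{x | n · x = c}`. -/
def hyperplane {d : ℕ} (n : Space d) (c : ℝ) : Set (Space d) := {x | inner ℝ n x = c}

theorem mem_hyperplane {d : ℕ} {n : Space d} {c : ℝ} {x : Space d} :
    x ∈ hyperplane n c ↔ inner ℝ n x = c := Iff.rfl

/-- An isometric chart of the hyperplane: through it surface measure becomes Lebesgue measure in `d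
- 1` variables. -/
theorem exists_hyperplane_param {d : ℕ} (hd : 1 ≤ d) {n : Space d} (hn : ‖n‖ = 1) (c : ℝ) :
    ∃ L : EuclideanSpace ℝ (Fin (d - 1)) →ₗᵢ[ℝ] Space d,
      Set.range (fun y => c • n + L y) = hyperplane n c := by
  have hn0 : n ≠ 0 := fun h => by simp [h] at hn
  have : Fact (Module.finrank ℝ (Space d) = d - 1 + 1) := ⟨by simp; omega⟩
  let b := OrthonormalBasis.fromOrthogonalSpanSingleton (𝕜 := ℝ) (d - 1) hn0
  refine ⟨(ℝ ∙ n)ᗮ.subtypeₗᵢ.comp b.repr.symm.toLinearIsometry, ?_⟩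
  ext x
  simp only [Set.mem_range, mem_hyperplane]
  constructor
  · rintro ⟨y, rfl⟩
    have h := Submodule.mem_orthogonal_singleton_iff_inner_right.1 (b.repr.symm y).2
    rw [inner_add_right, inner_smul_right, real_inner_self_eq_norm_sq, hn]
    have h' : inner ℝ n (((ℝ ∙ n)ᗮ.subtypeₗᵢ.comp b.repr.symm.toLinearIsometry) y) = 0 := h
    rw [h']
    ring
  · intro hx
    have hw : x - c • n ∈ (ℝ ∙ n)ᗮ := by
      rw [Submodule.mem_orthogonal_singleton_iff_inner_right, inner_sub_right, inner_smul_right,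
        real_inner_self_eq_norm_sq, hn, hx]
      ring
    refine ⟨b.repr ⟨_, hw⟩, ?_⟩
    simp

theorem isometry_const_add {d m : ℕ} (a : Space d) (L : EuclideanSpace ℝ (Fin m) →ₗᵢ[ℝ] Space d) :
    Isometry fun y => a + L y := by
  refine Isometry.of_dist_eq fun x y => ?_
  simp

theorem surfaceMeasure_image {d : ℕ} (a : Space d)
    (L : EuclideanSpace ℝ (Fin (d - 1)) →ₗᵢ[ℝ] Space d) (s : Set (EuclideanSpace ℝ (Fin (d - 1)))) :
    surfaceMeasure d ((fun y => a + L y) '' s) = volume s := by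
  rw [surfaceMeasure, (isometry_const_add a L).euclideanHausdorffMeasure_image,
    EuclideanSpace.euclideanHausdorffMeasure_eq_volume]

theorem exists_surfaceMeasure_inter_closedBall_le {d : ℕ} (hd : 1 ≤ d) :
    ∃ C : ℝ, 0 < C ∧ ∀ (n : Space d) (c : ℝ) (z : Space d) (r : ℝ), ‖n‖ = 1 → 0 ≤ r →
      surfaceMeasure d (hyperplane n c ∩ Metric.closedBall z r) ≤ ENNReal.ofReal (C * r ^ (d - 1)) := by
  set v₁ := (volume (Metric.ball (0 : EuclideanSpace ℝ (Fin (d - 1))) 1)).toReal with hv₁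
  have hv0 : 0 ≤ v₁ := ENNReal.toReal_nonneg
  -- The factor `2^(d-1)` pays for recentring the ball at a point of the hyperplane, since `z` need
  -- not lie on it; the summand `1` only makes the constant positive.
  refine ⟨2 ^ (d - 1) * v₁ + 1, by positivity, fun n c z r hn hr => ?_⟩
  obtain ⟨L, hL⟩ := exists_hyperplane_param hd hn c
  rcases (hyperplane n c ∩ Metric.closedBall z r).eq_empty_or_nonempty with h | ⟨x0, hx0, hxz⟩
  · simp [h]
  rw [← hL] at hx0
  obtain ⟨y0, rfl⟩ := hx0
  have hsub : hyperplane n c ∩ Metric.closedBall z r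
      ⊆ (fun y => c • n + L y) '' Metric.closedBall y0 (2 * r) := by
    rintro x ⟨hx, hxr⟩
    rw [← hL] at hx
    obtain ⟨y, rfl⟩ := hx
    refine ⟨y, ?_, rfl⟩
    have h1 := (isometry_const_add (c • n) L).dist_eq y y0
    rw [Metric.mem_closedBall, ← h1]
    have := dist_triangle_right (c • n + L y) (c • n + L y0) z
    rw [Metric.mem_closedBall] at hxr hxz
    linarith
  refine (measure_mono hsub).trans ?_
  rw [surfaceMeasure_image, Measure.addHaar_closedBall _ _ (by positivity)]
  have e : volume (Metric.ball (0 : EuclideanSpace ℝ (Fin (d - 1))) 1) = ENNReal.ofReal v₁ :=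
    (ENNReal.ofReal_toReal measure_ball_lt_top.ne).symm
  rw [e, ← ENNReal.ofReal_mul (by positivity)]
  refine ENNReal.ofReal_le_ofReal ?_
  rw [finrank_euclideanSpace_fin, mul_pow]
  have : 0 ≤ r ^ (d - 1) := by positivity
  nlinarith

/-- In the chart the frontier of a convex set is a null set, so almost every point of `s` is
relatively interior. -/
theorem ae_convex_subset_hyperplane {d : ℕ} (hd : 1 ≤ d) {n : Space d} (hn : ‖n‖ = 1) {c : ℝ}
    {s : Set (Space d)} (hs : Convex ℝ s) (hsn : s ⊆ hyperplane n c) :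
    ∀ᵐ x ∂(surfaceMeasure d), x ∈ s → ∃ δ > 0, hyperplane n c ∩ Metric.ball x δ ⊆ s := by
  obtain ⟨L, hL⟩ := exists_hyperplane_param hd hn c
  set f : EuclideanSpace ℝ (Fin (d - 1)) → Space d := fun y => c • n + L y with hf
  have hconv : Convex ℝ (f ⁻¹' s) := by
    have h1 : Convex ℝ ((fun z => c • n + z) ⁻¹' s) := hs.translate_preimage_right _
    exact h1.linear_preimage L.toLinearMap
  have h0 : surfaceMeasure d (f '' frontier (f ⁻¹' s)) = 0 := by
    rw [surfaceMeasure_image, hconv.addHaar_frontier volume]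
  filter_upwards [measure_eq_zero_iff_ae_notMem.1 h0] with x hx hxs
  have hxr := hsn hxs
  rw [← hL] at hxr
  obtain ⟨y, rfl⟩ := hxr
  have hy : y ∈ interior (f ⁻¹' s) := by
    by_contra hy
    exact hx ⟨y, ⟨subset_closure hxs, hy⟩, rfl⟩
  obtain ⟨δ, hδ, hb⟩ := Metric.mem_nhds_iff.1 (mem_interior_iff_mem_nhds.1 hy)
  refine ⟨δ, hδ, ?_⟩
  rintro z ⟨hz, hzb⟩
  rw [← hL] at hz
  obtain ⟨w, rfl⟩ := hz
  refine hb ?_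
  rw [Metric.mem_ball] at hzb ⊢
  rwa [← (isometry_const_add (c • n) L).dist_eq w y]

/-- In the chart of the first hyperplane the second one cuts out a proper affine subspace, which is
null. Hence almost every point of a face avoids the faces that lie in other hyperplanes. -/
theorem surfaceMeasure_hyperplane_inter {d : ℕ} (hd : 1 ≤ d) {n n' : Space d} (hn : ‖n‖ = 1)
    {c c' : ℝ} (h : ¬ hyperplane n c ⊆ hyperplane n' c') :
    surfaceMeasure d (hyperplane n c ∩ hyperplane n' c') = 0 := by
  obtain ⟨L, hL⟩ := exists_hyperplane_param hd hn c
  set f : EuclideanSpace ℝ (Fin (d - 1)) → Space d := fun y => c • n + L y with hf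
  have hsub : hyperplane n c ∩ hyperplane n' c' ⊆ f '' (f ⁻¹' hyperplane n' c') := by
    rintro x ⟨hx, hx'⟩
    rw [← hL] at hx
    obtain ⟨y, rfl⟩ := hx
    exact ⟨y, hx', rfl⟩
  refine measure_mono_null hsub ?_
  rw [surfaceMeasure_image]
  let S : AffineSubspace ℝ (EuclideanSpace ℝ (Fin (d - 1))) :=
    { carrier := f ⁻¹' hyperplane n' c'
      smul_vsub_vadd_mem' := by
        intro t p q r hp hq hr
        simp only [Set.mem_preimage, mem_hyperplane, hf, inner_add_right, vsub_eq_sub,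
          vadd_eq_add, map_add, map_smul, map_sub, inner_smul_right, inner_sub_right] at hp hq hr ⊢
        have e : (inner ℝ n' (L p) : ℝ) - inner ℝ n' (L q) = 0 := by linarith
        rw [e]
        linarith }
  have hS : S ≠ ⊤ := by
    intro hS
    apply h
    intro x hx
    rw [← hL] at hx
    obtain ⟨y, rfl⟩ := hx
    have : y ∈ S := by rw [hS]; trivial
    exact this
  exact Measure.addHaar_affineSubspace volume S hS

/-- With `a = n·n'`, the points `c n` and `c n + (n' - a n)` of the first hyperplane must both lie
in the second. This forces `a² = 1`, hence `n' = a n`. -/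
theorem hyperplane_eq_of_subset {d : ℕ} {n n' : Space d} (hn : ‖n‖ = 1) (hn' : ‖n'‖ = 1)
    {c c' : ℝ} (h : hyperplane n c ⊆ hyperplane n' c') : hyperplane n' c' ⊆ hyperplane n c := by
  have nn : (inner ℝ n n : ℝ) = 1 := by rw [real_inner_self_eq_norm_sq, hn]; norm_num
  have nn' : (inner ℝ n' n' : ℝ) = 1 := by rw [real_inner_self_eq_norm_sq, hn']; norm_num
  set a : ℝ := inner ℝ n n' with ha
  have ha' : (inner ℝ n' n : ℝ) = a := real_inner_comm _ _
  have h0 : c • n ∈ hyperplane n c := by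
    rw [mem_hyperplane, inner_smul_right, nn, mul_one]
  have h1 : c • n + (n' - a • n) ∈ hyperplane n c := by
    rw [mem_hyperplane, inner_add_right, inner_sub_right, inner_smul_right, inner_smul_right, nn,
      ← ha]
    ring
  have e0 := h h0
  have e1 := h h1
  rw [mem_hyperplane, inner_smul_right, ha'] at e0
  rw [mem_hyperplane, inner_add_right, inner_sub_right, inner_smul_right, inner_smul_right, nn',
    ha'] at e1
  have ea : a * a = 1 := by linarith
  have hw : n' - a • n = 0 := by
    rw [← norm_eq_zero, ← sq_eq_zero_iff, ← real_inner_self_eq_norm_sq, inner_sub_left,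
      inner_sub_right, inner_sub_right, inner_smul_left, inner_smul_right, inner_smul_right, nn',
      inner_smul_left, nn, ha', ← ha]
    simp
    linarith
  have hn'e : n' = a • n := sub_eq_zero.1 hw
  intro x hx
  rw [mem_hyperplane] at hx ⊢
  rw [hn'e, inner_smul_left] at hx
  simp only [conj_trivial] at hx
  have : a * (a * inner ℝ n x) = a * (c * a) := by rw [hx, e0]
  rw [← mul_assoc, ea] at this
  rw [one_mul] at this
  rw [this, show a * (c * a) = c * (a * a) by ring, ea, mul_one]

theorem volume_hyperplane {d : ℕ} {n : Space d} (hn : ‖n‖ = 1) (c : ℝ) :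
    volume (hyperplane n c) = 0 := by
  have nn : (inner ℝ n n : ℝ) = 1 := by rw [real_inner_self_eq_norm_sq, hn]; norm_num
  let S : AffineSubspace ℝ (Space d) :=
    { carrier := hyperplane n c
      smul_vsub_vadd_mem' := by
        intro t p q r hp hq hr
        simp only [mem_hyperplane, inner_add_right, vsub_eq_sub,
          vadd_eq_add, inner_smul_right, inner_sub_right] at hp hq hr ⊢
        rw [hp, hq, hr]
        ring }
  have hS : S ≠ ⊤ := by
    intro hS
    have h1 : (c + 1) • n ∈ S := by rw [hS]; trivial
    have h2 : inner ℝ n ((c + 1) • n) = c := h1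
    rw [inner_smul_right, nn] at h2
    linarith
  exact Measure.addHaar_affineSubspace volume S hS

/-! ### Geometry of elements near their faces -/

theorem IsPolytope.isCompact {d : ℕ} {s : Set (Space d)} (hs : IsPolytope s) : IsCompact s := by
  obtain ⟨⟨F, rfl⟩, -⟩ := hs
  exact F.isCompact_biUnion fun t _ => (t.finite_toSet).isCompact_convexHull (𝕜 := ℝ)

/-- The graph description excludes slits: just below a boundary point there is an open set that
misses `Ω`, so the point is not interior to the closure. Elements are only known to lie in the
closure of `Ω`; their interiors therefore lie in `Ω`. -/
theorem IsLipschitzDomain.interior_closure_subset {d : ℕ} {Ω : Set (Space d)}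
    (hΩ : IsLipschitzDomain Ω) : interior (closure Ω) ⊆ Ω := by
  intro x hx
  by_contra hxΩ
  have hxf : x ∈ frontier Ω :=
    ⟨interior_subset hx, fun h => hxΩ (interior_subset h)⟩
  obtain ⟨ν, r, L, g, hν, hr, hg, hinv, hball⟩ := hΩ.2.2.2 x hxf
  have hgx : inner ℝ ν x ≤ g x := by
    by_contra h
    exact hxΩ ((hball x (Metric.mem_ball_self hr)).2 (not_le.1 h))
  obtain ⟨ε, hε, hb⟩ := Metric.mem_nhds_iff.1 (mem_interior_iff_mem_nhds.1 hx)
  set t := min ε r / 2 with ht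
  have hm : 0 < min ε r := lt_min hε hr
  have ht0 : 0 < t := by positivity
  set y := x + (-t) • ν with hy
  have hyx : dist y x = t := by
    rw [hy, dist_eq_norm, add_sub_cancel_left, norm_smul, hν, norm_neg, Real.norm_eq_abs,
      abs_of_pos ht0, mul_one]
  have hy1 : y ∈ Metric.ball x ε := by
    rw [Metric.mem_ball, hyx]
    linarith [min_le_left ε r]
  have hy2 : y ∈ Metric.ball x r := by
    rw [Metric.mem_ball, hyx]
    linarith [min_le_right ε r]
  have hopen : IsOpen {z | inner ℝ ν z < g z} := isOpen_lt (by fun_prop) hg.continuous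
  have hyo : y ∈ {z | inner ℝ ν z < g z} := by
    have h1 : g y = g x := hinv x (-t)
    have h2 : (inner ℝ ν y : ℝ) = inner ℝ ν x - t := by
      rw [hy, inner_add_right, inner_smul_right, real_inner_self_eq_norm_sq, hν]
      ring
    change inner ℝ ν y < g y
    rw [h1, h2]
    linarith
  obtain ⟨w, ⟨hw1, hw2⟩, hw3⟩ := mem_closure_iff.1 (hb hy1) _ (hopen.inter Metric.isOpen_ball)
    ⟨hyo, hy2⟩
  exact absurd ((hball w hw2).1 hw3) (not_lt.2 (le_of_lt hw1))

theorem PolytopalMesh.subset_closure {d : ℕ} {Ω : Set (Space d)} (M : PolytopalMesh Ω)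
    {T : Set (Space d)} (hT : T ∈ M.elems) : T ⊆ closure Ω := by
  rw [← M.elem_cover]
  exact Set.subset_biUnion_of_mem (u := fun T => T) hT

theorem PolytopalMesh.interior_subset {d : ℕ} {Ω : Set (Space d)} (hΩ : IsLipschitzDomain Ω)
    (M : PolytopalMesh Ω) {T : Set (Space d)} (hT : T ∈ M.elems) : interior T ⊆ Ω :=
  (interior_mono (M.subset_closure hT)).trans hΩ.interior_closure_subset

theorem PolytopalMesh.mem_facesOf {d : ℕ} {Ω : Set (Space d)} (M : PolytopalMesh Ω)
    {T e : Set (Space d)} : e ∈ M.facesOf T ↔ e ∈ M.faces ∧ e ⊆ frontier T := by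
  simp [PolytopalMesh.facesOf]

theorem PolytopalMesh.exists_face {d : ℕ} {Ω : Set (Space d)} (M : PolytopalMesh Ω)
    {T : Set (Space d)} (hT : T ∈ M.elems) {x : Space d} (hx : x ∈ frontier T) :
    ∃ e ∈ M.facesOf T, x ∈ e := by
  rw [M.frontier_eq T hT] at hx
  simp only [Set.mem_iUnion] at hx
  obtain ⟨e, he, hxe⟩ := hx
  exact ⟨e, M.mem_facesOf.2 he, hxe⟩

theorem PolytopalMesh.isOutwardNormal {d : ℕ} {Ω : Set (Space d)} (M : PolytopalMesh Ω)
    {T e : Set (Space d)} (hT : T ∈ M.elems) (he : e ∈ M.facesOf T) :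
    IsOutwardNormal T e (M.normal T e) :=
  M.normal_spec T hT e (M.mem_facesOf.1 he).1 (M.mem_facesOf.1 he).2

theorem PolytopalMesh.exists_subset_hyperplane {d : ℕ} {Ω : Set (Space d)} (M : PolytopalMesh Ω)
    {T e : Set (Space d)} (hT : T ∈ M.elems) (he : e ∈ M.facesOf T) :
    ∃ c, e ⊆ hyperplane (M.normal T e) c := (M.isOutwardNormal hT he).2.1

theorem PolytopalMesh.volume_frontier {d : ℕ} {Ω : Set (Space d)} (M : PolytopalMesh Ω)
    {T : Set (Space d)} (hT : T ∈ M.elems) : volume (frontier T) = 0 := by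
  have hsub : frontier T ⊆ ⋃ e ∈ M.facesOf T, e := by
    intro x hx
    obtain ⟨e, he, hxe⟩ := M.exists_face hT hx
    exact Set.mem_biUnion he hxe
  refine measure_mono_null hsub ?_
  refine (measure_biUnion_null_iff (Finset.countable_toSet (M.facesOf T))).2 fun e he => ?_
  obtain ⟨c, hc⟩ := M.exists_subset_hyperplane hT he
  exact measure_mono_null hc (volume_hyperplane (M.isOutwardNormal hT he).1 c)

theorem IsPreconnected.exists_mem_frontier {X : Type*} [TopologicalSpace X] {t s : Set X}
    (ht : IsPreconnected t) (h1 : (t ∩ s).Nonempty) (h2 : (t ∩ sᶜ).Nonempty) :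
    ∃ z ∈ t, z ∈ frontier s := by
  by_contra! h
  have hsub : t ⊆ interior s ∪ (closure s)ᶜ := by
    intro z hz
    by_cases hc : z ∈ closure s
    · exact Or.inl (by_contra fun hi => h z hz ⟨hc, hi⟩)
    · exact Or.inr hc
  obtain ⟨a, ha, has⟩ := h1
  obtain ⟨b, hb, hbs⟩ := h2
  have ha' : a ∈ interior s := (hsub ha).resolve_right fun hc => hc (subset_closure has)
  have hb' : b ∈ (closure s)ᶜ := (hsub hb).resolve_left fun hi => hbs (interior_subset hi)
  obtain ⟨z, -, hz1, hz2⟩ := ht _ _ isOpen_interior isClosed_closure.isOpen_compl hsub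
    ⟨a, ha, ha'⟩ ⟨b, hb, hb'⟩
  exact hz2 (subset_closure (interior_subset hz1))

/-- The open half ball below `x` in direction `n`. -/
def halfBall {d : ℕ} (n x : Space d) (r : ℝ) : Set (Space d) :=
  {y | y ∈ Metric.ball x r ∧ inner ℝ n (y - x) < 0}

theorem isOpen_halfBall {d : ℕ} (n x : Space d) (r : ℝ) : IsOpen (halfBall n x r) :=
  Metric.isOpen_ball.inter (isOpen_lt (f := fun y => inner ℝ n (y - x)) (by fun_prop)
    continuous_const)

theorem convex_halfBall {d : ℕ} (n x : Space d) (r : ℝ) : Convex ℝ (halfBall n x r) := by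
  refine (convex_ball x r).inter ?_
  have : Convex ℝ {y : Space d | inner ℝ n y < inner ℝ n x} :=
    convex_halfSpace_lt (f := fun y => inner ℝ n y) ⟨fun a b => inner_add_right _ _ _,
      fun c a => inner_smul_right _ _ _⟩ _
  have e : {y : Space d | inner ℝ n (y - x) < 0} = {y : Space d | inner ℝ n y < inner ℝ n x} := by
    ext y
    simp [inner_sub_right]
  change Convex ℝ {y : Space d | inner ℝ n (y - x) < 0}
  rw [e]
  exact this

theorem ball_subset_halfBall {d : ℕ} {n : Space d} (hn : ‖n‖ = 1) (x : Space d) {r : ℝ} :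
    Metric.ball (x - (r / 2) • n) (r / 2) ⊆ halfBall n x r := by
  intro y hy
  rw [Metric.mem_ball, dist_eq_norm] at hy
  have hr : 0 < r / 2 := (norm_nonneg _).trans_lt hy
  have e : y - x = (y - (x - (r / 2) • n)) - (r / 2) • n := by abel
  constructor
  · rw [Metric.mem_ball, dist_eq_norm, e]
    refine (norm_sub_le _ _).trans_lt ?_
    rw [norm_smul, hn, Real.norm_eq_abs, abs_of_pos hr]
    linarith
  · rw [e, inner_sub_right, inner_smul_right, real_inner_self_eq_norm_sq, hn]
    have := real_inner_le_norm n (y - (x - (r / 2) • n))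
    rw [hn] at this
    linarith

/-- Almost every `x ∈ e` is relatively interior to a convex piece of `e`, and every face of `T`
through `x` lies in the hyperplane of `e`. So the frontier of `T` near `x` lies in this hyperplane,
and each open half ball, being connected and disjoint from the frontier, lies inside `T` or outside
`T`. -/
theorem PolytopalMesh.ae_face_local {d : ℕ} (hd : 1 ≤ d) {Ω : Set (Space d)}
    (M : PolytopalMesh Ω) {T e : Set (Space d)} (hT : T ∈ M.elems) (he : e ∈ M.facesOf T) :
    ∀ᵐ x ∂(surfaceMeasure d), x ∈ e → ∃ r > 0,
      (∀ y ∈ Metric.ball x r, inner ℝ (M.normal T e) (y - x) < 0 → y ∈ T) ∧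
      (∀ y ∈ Metric.ball x r, 0 < inner ℝ (M.normal T e) (y - x) → y ∉ T) ∧
      ∀ y ∈ Metric.ball x r, inner ℝ (M.normal T e) (y - x) = 0 → y ∈ e := by
  classical
  set n := M.normal T e with hn
  have hface := M.face_polytope e (M.mem_facesOf.1 he).1
  have hec : IsCompact e := hface.1.isCompact
  obtain ⟨hn1, ⟨c, hc⟩, hae⟩ := M.isOutwardNormal hT he
  rw [← hn] at hn1 hc hae
  rw [ae_restrict_iff' hec.measurableSet] at hae
  obtain ⟨F, hF⟩ := hface.1.1
  have hrel : ∀ᵐ x ∂(surfaceMeasure d), ∀ t ∈ F, x ∈ convexHull ℝ (t : Set (Space d)) →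
      ∃ δ > 0, hyperplane n c ∩ Metric.ball x δ ⊆ convexHull ℝ (t : Set (Space d)) := by
    refine (ae_ball_iff F.countable_toSet).2 fun t ht => ?_
    refine ae_convex_subset_hyperplane hd hn1 (convex_convexHull ℝ _) fun x hx => hc x ?_
    rw [hF]
    exact Set.mem_biUnion (Finset.mem_coe.1 ht) hx
  have hother : ∀ᵐ x ∂(surfaceMeasure d), ∀ e' ∈ M.facesOf T, ∀ c', e' ⊆ hyperplane (M.normal T e') c'
      → x ∈ e → x ∈ e' → hyperplane n c ⊆ hyperplane (M.normal T e') c' := by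
    refine (ae_ball_iff (Finset.countable_toSet _)).2 fun e' he' => ?_
    obtain ⟨c1, hc1⟩ := M.exists_subset_hyperplane hT he'
    by_cases hsub : hyperplane n c ⊆ hyperplane (M.normal T e') c1
    · refine Eventually.of_forall fun x c' hc' _ hx => ?_
      have e1 : c' = c1 := (hc' hx).symm.trans (hc1 hx)
      rw [e1]
      exact hsub
    · have := surfaceMeasure_hyperplane_inter hd hn1 hsub
      filter_upwards [measure_eq_zero_iff_ae_notMem.1 this] with x hx c' hc' hxe hxe'
      exact absurd ⟨hc x hxe, hc1 hxe'⟩ hx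
  filter_upwards [hae, hrel, hother] with x h1 h2 h3 hxe
  have hxc : inner ℝ n x = c := hc x hxe
  obtain ⟨t, htF, hxt⟩ : ∃ t ∈ F, x ∈ convexHull ℝ (t : Set (Space d)) := by
    have := hxe
    rw [hF] at this
    simpa using this
  obtain ⟨δ, hδ, hδs⟩ := h2 t htF hxt
  -- faces not containing `x` stay away from `x`
  have hclosed : IsClosed (⋃ e' ∈ (M.facesOf T).filter fun e' => x ∉ e', e') := by
    refine Set.Finite.isClosed_biUnion (Finset.finite_toSet _) fun e' he' => ?_
    exact (M.face_polytope e' (M.mem_facesOf.1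
      (Finset.mem_filter.1 (Finset.mem_coe.1 he')).1).1).1.isCompact.isClosed
  have hxn : x ∉ ⋃ e' ∈ (M.facesOf T).filter fun e' => x ∉ e', e' := by
    simp only [Set.mem_iUnion, Finset.mem_filter, not_exists]
    exact fun e' he' => he'.2
  obtain ⟨ρ, hρ, hρs⟩ := Metric.mem_nhds_iff.1 (hclosed.isOpen_compl.mem_nhds hxn)
  have hfront : ∀ y ∈ Metric.ball x ρ, y ∈ frontier T → inner ℝ n (y - x) = 0 := by
    intro y hy hyf
    obtain ⟨e', he', hye'⟩ := M.exists_face hT hyf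
    have hxe' : x ∈ e' := by
      by_contra hxe'
      refine hρs hy ?_
      exact Set.mem_biUnion (Finset.mem_filter.2 ⟨he', hxe'⟩) hye'
    obtain ⟨c', hc'⟩ := M.exists_subset_hyperplane hT he'
    have hsub := h3 e' he' c' hc' hxe hxe'
    have := hyperplane_eq_of_subset hn1 (M.isOutwardNormal hT he').1 hsub (hc' hye')
    rw [inner_sub_right, hxc]
    rw [mem_hyperplane] at this
    linarith
  have hev := h1 hxe
  have hevρ : ∀ᶠ t in 𝓝[>] (0 : ℝ), t < ρ := mem_nhdsWithin_of_mem_nhds (Iio_mem_nhds hρ)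
  -- The points `x ± τ n`, one outside and one inside `T` by the definition of the outward normal,
  -- decide which half ball is which.
  obtain ⟨τ, ⟨⟨hτ1, hτ2⟩, hτρ⟩, hτ0⟩ :=
    ((hev.and hevρ).and (self_mem_nhdsWithin (a := (0 : ℝ)) (s := Set.Ioi 0))).exists
  have hτ0 : 0 < τ := hτ0
  have hnn : (inner ℝ n n : ℝ) = 1 := by rw [real_inner_self_eq_norm_sq, hn1]; norm_num
  have hτn : ‖τ • n‖ = τ := by rw [norm_smul, hn1, Real.norm_eq_abs, abs_of_pos hτ0, mul_one]
  have hlow : ∀ y ∈ halfBall n x ρ, y ∈ T := by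
    intro y hy
    by_contra hyT
    have hne : (halfBall n x ρ ∩ T).Nonempty := by
      refine ⟨x - τ • n, ⟨?_, ?_⟩, hτ2⟩
      · rw [Metric.mem_ball, dist_eq_norm, sub_sub_cancel_left, norm_neg, hτn]
        exact hτρ
      · rw [sub_sub_cancel_left, inner_neg_right, inner_smul_right, hnn]
        linarith
    obtain ⟨z, hz, hzf⟩ := IsPreconnected.exists_mem_frontier (convex_halfBall n x ρ).isPreconnected
      hne ⟨y, hy, hyT⟩
    have := hfront z hz.1 hzf
    linarith [hz.2]
  have hup : ∀ y ∈ halfBall (-n) x ρ, y ∉ T := by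
    intro y hy hyT
    have hne : (halfBall (-n) x ρ ∩ Tᶜ).Nonempty := by
      refine ⟨x + τ • n, ⟨?_, ?_⟩, hτ1⟩
      · rw [Metric.mem_ball, dist_eq_norm, add_sub_cancel_left, hτn]
        exact hτρ
      · rw [add_sub_cancel_left, inner_neg_left, inner_smul_right, hnn]
        linarith
    obtain ⟨z, hz, hzf⟩ := IsPreconnected.exists_mem_frontier
      (convex_halfBall (-n) x ρ).isPreconnected ⟨y, hy, hyT⟩ hne
    have h4 := hfront z hz.1 hzf
    have h5 := hz.2
    rw [inner_neg_left] at h5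
    linarith
  refine ⟨min δ ρ, lt_min hδ hρ, ?_, ?_, ?_⟩
  · intro y hy hyn
    exact hlow y ⟨Metric.ball_subset_ball (min_le_right _ _) hy, hyn⟩
  · intro y hy hyn
    refine hup y ⟨Metric.ball_subset_ball (min_le_right _ _) hy, ?_⟩
    rw [inner_neg_left]
    linarith
  · intro y hy hyn
    rw [hF]
    refine Set.mem_biUnion htF (hδs ⟨?_, Metric.ball_subset_ball (min_le_left _ _) hy⟩)
    rw [mem_hyperplane]
    rw [inner_sub_right] at hyn
    linarith

/-- A cone over a neighbourhood of `x` in a hyperplane contains translated half balls around the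
segment from `x` to its apex. -/
theorem exists_halfBall_subset_convexJoin {d : ℕ} {e : Set (Space d)} {n A x : Space d}
    (hn : ‖n‖ = 1) {δ : ℝ} (hδ : 0 < δ) (hη : 0 < inner ℝ n (x - A))
    (hball : ∀ y ∈ Metric.ball x δ, inner ℝ n (y - x) = 0 → y ∈ e) :
    ∃ r > 0, ∀ s ∈ Set.Icc (1 / 2 : ℝ) 1, halfBall n (A + s • (x - A)) r ⊆ convexJoin ℝ {A} e := by
  set η : ℝ := inner ℝ n (x - A) with hηd
  have hD : 0 < 1 + ‖x - A‖ / η := by positivity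
  -- The first bound on the radius keeps `s' ≥ 1/4` below; the second keeps `x'` within `δ` of `x`.
  refine ⟨min (η / 4) (δ / (4 * (1 + ‖x - A‖ / η))), lt_min (by positivity) (by positivity), ?_⟩
  rintro s ⟨hs1, hs2⟩ w ⟨hw, hwn⟩
  set y := w - (A + s • (x - A)) with hy
  rw [Metric.mem_ball, dist_eq_norm, ← hy] at hw
  have hw1 : ‖y‖ < η / 4 := hw.trans_le (min_le_left _ _)
  have hw2 : ‖y‖ < δ / (4 * (1 + ‖x - A‖ / η)) := hw.trans_le (min_le_right _ _)
  set q : ℝ := inner ℝ n y with hq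
  have hqa : |q| ≤ ‖y‖ := by
    have := abs_real_inner_le_norm n y
    rwa [hn, one_mul] at this
  have hq1 : -(1 / 4) ≤ q / η := by
    rw [le_div_iff₀ hη]
    linarith [neg_abs_le q]
  have hq2 : q / η ≤ 0 := div_nonpos_of_nonpos_of_nonneg hwn.le hη.le
  -- The height of `w` over the apex is `s' η`, so the ray from `A` through `w` meets the hyperplane
  -- through `x` at `A + s'⁻¹ (w - A)`.
  set s' : ℝ := s + q / η with hs'
  have hs'1 : 1 / 4 ≤ s' := by linarith
  have hs'0 : s' ≠ 0 := by linarith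
  have hs'2 : s' ≤ 1 := by linarith
  have hwA : w - A = s • (x - A) + y := by rw [hy]; abel
  set x' := A + s'⁻¹ • (w - A) with hx'
  have hwx' : w = A + s' • (x' - A) := by
    rw [hx', add_sub_cancel_left, smul_smul, mul_inv_cancel₀ hs'0, one_smul]
    abel
  have hx'x : x' - x = s'⁻¹ • (y - (q / η) • (x - A)) := by
    have : x' - x = s'⁻¹ • ((w - A) - s' • (x - A)) := by
      rw [smul_sub, smul_smul, inv_mul_cancel₀ hs'0, one_smul, hx']
      abel
    rw [this, hwA, hs', add_smul]
    congr 1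
    abel
  have hmem : x' ∈ e := by
    refine hball x' ?_ ?_
    · rw [Metric.mem_ball, dist_eq_norm, hx'x, norm_smul, norm_inv, Real.norm_eq_abs,
        abs_of_nonneg (by linarith : (0 : ℝ) ≤ s')]
      have h1 : ‖y - (q / η) • (x - A)‖ ≤ ‖y‖ * (1 + ‖x - A‖ / η) := by
        refine (norm_sub_le _ _).trans ?_
        rw [norm_smul, norm_div, Real.norm_eq_abs, Real.norm_eq_abs, abs_of_pos hη]
        have : |q| / η * ‖x - A‖ ≤ ‖y‖ * (‖x - A‖ / η) := by
          rw [div_mul_eq_mul_div, mul_div_assoc]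
          gcongr
        linarith
      have h2 : s'⁻¹ ≤ 4 := by
        rw [inv_le_comm₀ (by linarith) (by norm_num)]
        linarith
      rw [lt_div_iff₀ (by positivity)] at hw2
      calc s'⁻¹ * ‖y - (q / η) • (x - A)‖ ≤ 4 * (‖y‖ * (1 + ‖x - A‖ / η)) := by gcongr
        _ < δ := by linarith
    · rw [hx'x, inner_smul_right, inner_sub_right, inner_smul_right, ← hηd, ← hq,
        div_mul_cancel₀ _ hη.ne', sub_self, mul_zero]
  rw [mem_convexJoin]
  refine ⟨A, rfl, x', hmem, ?_⟩
  rw [segment_eq_image']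
  exact ⟨s', ⟨by linarith, hs'2⟩, hwx'.symm⟩

/-! ### Averages and Tonelli estimates near a face -/

theorem measurable_lintegral_closedBall {d : ℕ} {X : Type*} [MeasurableSpace X]
    {z : X → Space d} (hz : Measurable z) {f : Space d → ℝ≥0∞} (hf : Measurable f) (r : ℝ) :
    Measurable fun p => ∫⁻ y in Metric.closedBall (z p) r, f y := by
  have hS : MeasurableSet {q : X × Space d | dist q.2 (z q.1) ≤ r} :=
    measurableSet_le (measurable_snd.dist (hz.comp measurable_fst)) measurable_const
  have hm : Measurable ({q : X × Space d | dist q.2 (z q.1) ≤ r}.indicator fun q => f q.2) :=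
    (hf.comp measurable_snd).indicator hS
  have := hm.lintegral_prod_right' (ν := volume)
  convert this using 2 with p
  rw [← lintegral_indicator Metric.isClosed_closedBall.measurableSet]
  refine lintegral_congr fun y => ?_
  by_cases h : dist y (z p) ≤ r <;> simp [Set.indicator, h]

/-- Tonelli: `f y` is counted with the measure of those `p` whose ball contains `y`. -/
theorem lintegral_lintegral_closedBall_le {d : ℕ} {X : Type*} [MeasurableSpace X] {κ : Measure X}
    [SFinite κ] {z : X → Space d} (hz : Measurable z) {f : Space d → ℝ≥0∞} (hf : Measurable f)
    (r : ℝ) {C : ℝ≥0∞} (hC : ∀ y, κ {p | dist y (z p) ≤ r} ≤ C) :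
    ∫⁻ p, (∫⁻ y in Metric.closedBall (z p) r, f y) ∂κ ≤ C * ∫⁻ y, f y := by
  have hS : MeasurableSet {q : X × Space d | dist q.2 (z q.1) ≤ r} :=
    measurableSet_le (measurable_snd.dist (hz.comp measurable_fst)) measurable_const
  have hm : Measurable ({q : X × Space d | dist q.2 (z q.1) ≤ r}.indicator fun q => f q.2) :=
    (hf.comp measurable_snd).indicator hS
  calc ∫⁻ p, (∫⁻ y in Metric.closedBall (z p) r, f y) ∂κ
      = ∫⁻ p, (∫⁻ y, {q : X × Space d | dist q.2 (z q.1) ≤ r}.indicator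
          (fun q => f q.2) (p, y)) ∂κ := by
        refine lintegral_congr fun p => ?_
        rw [← lintegral_indicator Metric.isClosed_closedBall.measurableSet]
        refine lintegral_congr fun y => ?_
        by_cases h : dist y (z p) ≤ r <;> simp [Set.indicator, h]
    _ = ∫⁻ y, (∫⁻ p, {q : X × Space d | dist q.2 (z q.1) ≤ r}.indicator
          (fun q => f q.2) (p, y) ∂κ) :=
        lintegral_lintegral_swap (f := fun p y =>
          {q : X × Space d | dist q.2 (z q.1) ≤ r}.indicator (fun q => f q.2) (p, y)) hm.aemeasurable
    _ ≤ ∫⁻ y, C * f y := by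
        refine lintegral_mono fun y => ?_
        have hSy : MeasurableSet {p | dist y (z p) ≤ r} :=
          measurableSet_le (measurable_const.dist hz) measurable_const
        calc ∫⁻ p, {q : X × Space d | dist q.2 (z q.1) ≤ r}.indicator (fun q => f q.2) (p, y) ∂κ
            = ∫⁻ p, {p | dist y (z p) ≤ r}.indicator (fun _ => f y) p ∂κ := by
              refine lintegral_congr fun p => ?_
              by_cases h : dist y (z p) ≤ r <;> simp [Set.indicator, h]
          _ = f y * κ {p | dist y (z p) ≤ r} := lintegral_indicator_const hSy _
          _ ≤ C * f y := by
              rw [mul_comm]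
              exact mul_le_mul' (hC y) le_rfl
    _ = _ := lintegral_const_mul _ hf

theorem enorm_average_sq_le {α : Type*} [MeasurableSpace α] {ν : Measure α}
    {f : α → ℝ} (hf : AEMeasurable f ν) :
    ‖⨍ x, f x ∂ν‖ₑ ^ 2 ≤ (ν Set.univ)⁻¹ * ∫⁻ x, ‖f x‖ₑ ^ 2 ∂ν := by
  rw [average]
  have h := enorm_integral_sq_le (ν := (ν Set.univ)⁻¹ • ν) (f := f) (hf.smul_measure _)
  refine h.trans ?_
  rw [lintegral_smul_measure, Measure.smul_apply, smul_eq_mul, smul_eq_mul]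
  calc _ ≤ 1 * ((ν Set.univ)⁻¹ * ∫⁻ x, ‖f x‖ₑ ^ 2 ∂ν) :=
        mul_le_mul' (ENNReal.inv_mul_le_one _) le_rfl
    _ = _ := one_mul _

/-- The difference of the averages is the double average of `u x - u y`; Cauchy-Schwarz is applied
in each variable. It turns the double integral of the Poincaré inequality into a comparison of
averages. -/
theorem enorm_average_sub_sq_le {α : Type*} [MeasurableSpace α] {ν ν' : Measure α}
    [IsFiniteMeasure ν] [IsFiniteMeasure ν'] [NeZero ν] [NeZero ν'] {u : α → ℝ}
    (hu : Integrable u ν) (hu' : Integrable u ν') :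
    ‖(⨍ x, u x ∂ν) - ⨍ y, u y ∂ν'‖ₑ ^ 2
      ≤ (ν' Set.univ)⁻¹ * ((ν Set.univ)⁻¹ * ∫⁻ y, ∫⁻ x, ‖u x - u y‖ₑ ^ 2 ∂ν ∂ν') := by
  have e1 : ∀ y, ⨍ x, (u x - u y) ∂ν = (⨍ x, u x ∂ν) - u y := by
    intro y
    have : ⨍ x, (u x - u y) ∂ν = (⨍ x, u x ∂ν) - ⨍ _, u y ∂ν := by
      simp only [average_eq, ← smul_sub]
      rw [integral_sub hu (integrable_const _)]
    rw [this, average_const]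
  have e2 : (⨍ x, u x ∂ν) - ⨍ y, u y ∂ν' = ⨍ y, (⨍ x, (u x - u y) ∂ν) ∂ν' := by
    simp only [e1]
    have : ⨍ y, ((⨍ x, u x ∂ν) - u y) ∂ν' = (⨍ _, (⨍ x, u x ∂ν) ∂ν') - ⨍ y, u y ∂ν' := by
      simp only [average_eq, ← smul_sub]
      rw [integral_sub (integrable_const _) hu']
    rw [this, average_const]
  rw [e2]
  have hm : AEMeasurable (fun y => ⨍ x, (u x - u y) ∂ν) ν' := by
    simp only [e1]
    exact aemeasurable_const.sub hu'.aemeasurable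
  refine (enorm_average_sq_le hm).trans (mul_le_mul' le_rfl ?_)
  rw [← lintegral_const_mul' _ _ (ENNReal.inv_ne_top.2 (NeZero.ne _))]
  refine lintegral_mono fun y => ?_
  exact enorm_average_sq_le (hu.aemeasurable.sub aemeasurable_const)

/-- A face `e` with normal `n` of an element `T ⊆ closure Ω`, over which there stands a pyramid of
height at least `η` and apex `A`. -/
structure IsPyramidFace {d : ℕ} (Ω T e : Set (Space d)) (n A : Space d) (η H : ℝ) : Prop where
  unit : ‖n‖ = 1
  isCompact : IsCompact e
  isCompact_elem : IsCompact T
  interior_subset : interior T ⊆ Ω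
  height_pos : 0 < η
  height : ∀ x ∈ e, η ≤ inner ℝ n (x - A)
  flat : ∃ c, e ⊆ hyperplane n c
  apex : convexJoin ℝ {A} e ⊆ T
  dist_le : ∀ x ∈ e, ‖x - A‖ ≤ H
  ae_local : ∀ᵐ x ∂(surfaceMeasure d), x ∈ e → ∃ r > 0,
      (∀ y ∈ Metric.ball x r, inner ℝ n (y - x) < 0 → y ∈ T) ∧
      (∀ y ∈ Metric.ball x r, 0 < inner ℝ n (y - x) → y ∉ T) ∧
      ∀ y ∈ Metric.ball x r, inner ℝ n (y - x) = 0 → y ∈ e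

theorem surfaceMeasure_lt_top_of_subset_hyperplane {d : ℕ} (hd : 1 ≤ d) {e : Set (Space d)}
    {n : Space d} {c : ℝ} (hn : ‖n‖ = 1) (he : Bornology.IsBounded e) (hc : e ⊆ hyperplane n c) :
    surfaceMeasure d e < ⊤ := by
  obtain ⟨C, -, hC⟩ := exists_surfaceMeasure_inter_closedBall_le hd
  obtain ⟨R, hR⟩ := he.subset_closedBall 0
  have h1 : e ⊆ hyperplane n c ∩ Metric.closedBall 0 (max R 0) :=
    fun x hx => ⟨hc hx, Metric.closedBall_subset_closedBall (le_max_left _ _) (hR hx)⟩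
  exact (measure_mono h1).trans_lt
    ((hC n c 0 (max R 0) hn (le_max_right _ _)).trans_lt ENNReal.ofReal_lt_top)

theorem IsPyramidFace.surfaceMeasure_lt_top {d : ℕ} (hd : 1 ≤ d) {Ω T e : Set (Space d)}
    {n A : Space d} {η H : ℝ} (h : IsPyramidFace Ω T e n A η H) : surfaceMeasure d e < ⊤ := by
  obtain ⟨c, hc⟩ := h.flat
  exact surfaceMeasure_lt_top_of_subset_hyperplane hd h.unit h.isCompact.isBounded hc

theorem exists_volume_halfBall_ge (d : ℕ) :
    ∃ C : ℝ, 0 < C ∧ ∀ (n x : Space d) (r : ℝ), ‖n‖ = 1 → 0 < r →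
      ENNReal.ofReal (C * r ^ d) ≤ volume (halfBall n x r) := by
  set v := (volume (Metric.ball (0 : Space d) 1)).toReal with hv
  have hv0 : 0 < v := ENNReal.toReal_pos
    (Metric.measure_ball_pos volume _ one_pos).ne' measure_ball_lt_top.ne
  refine ⟨v * (1 / 2) ^ d, by positivity, fun n x r hn hr => ?_⟩
  refine le_trans (le_of_eq ?_) (measure_mono (ball_subset_halfBall hn x))
  rw [Measure.addHaar_ball_of_pos _ _ (by positivity), finrank_euclideanSpace_fin,
    ← ENNReal.ofReal_toReal (measure_ball_lt_top (μ := volume) (x := (0 : Space d)) (r := 1)).ne,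
    ← ENNReal.ofReal_mul (by positivity)]
  congr 1
  rw [← hv, div_pow, div_pow, one_pow]
  ring

theorem volume_halfBall_lt_top {d : ℕ} (n x : Space d) (r : ℝ) : volume (halfBall n x r) < ⊤ :=
  (measure_mono fun _ hy => hy.1).trans_lt measure_ball_lt_top

/-- The integral of `f` over balls with centers on the segment from `x` towards `A`. -/
def rayIntegral {d : ℕ} (A : Space d) (f : Space d → ℝ≥0∞) (r l : ℝ) (x : Space d) : ℝ≥0∞ :=
  ∫⁻ t in Set.Ioc (0 : ℝ) 1, ∫⁻ y in Metric.closedBall (A + (1 - l * t) • (x - A)) r, f y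

theorem measurable_rayIntegral_comp {d : ℕ} {X : Type*} [MeasurableSpace X] (A : Space d)
    {f : Space d → ℝ≥0∞} (hf : Measurable f) (r : ℝ) {a : X → ℝ} (ha : Measurable a)
    {b : X → Space d} (hb : Measurable b) : Measurable fun q => rayIntegral A f r (a q) (b q) := by
  have h1 : Measurable fun q : X × ℝ => 1 - a q.1 * q.2 :=
    measurable_const.sub ((ha.comp measurable_fst).mul measurable_snd)
  have h2 : Measurable fun q : X × ℝ => b q.1 - A :=
    (hb.comp measurable_fst).sub measurable_const
  have hz : Measurable fun q : X × ℝ => A + (1 - a q.1 * q.2) • (b q.1 - A) :=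
    measurable_const.add (h1.smul h2)
  exact (measurable_lintegral_closedBall hz hf r).lintegral_prod_right'
    (ν := volume.restrict (Set.Ioc (0 : ℝ) 1))

/-- For a fixed `y`, the centre of the ball is within `r` of `y` only for `t` in an interval of
length `2 r / (l η)`, as the centre moves along the normal at speed at least `l η`, and for each
such `t` only for `x` in a disc of radius `2 r` of the hyperplane. The product of the two measures
is the constant. The power `r^d` will cancel against the volume of a half ball. -/
theorem exists_lintegral_rayIntegral_le {d : ℕ} (hd : 1 ≤ d) :
    ∃ C : ℝ, 0 < C ∧ ∀ (Ω T e : Set (Space d)) (n A : Space d) (η H : ℝ),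
      IsPyramidFace Ω T e n A η H → ∀ (f : Space d → ℝ≥0∞), Measurable f → ∀ r l : ℝ, 0 ≤ r →
        0 < l → l ≤ 1 / 2 →
        ∫⁻ x in e, rayIntegral A f r l x ∂(surfaceMeasure d)
          ≤ ENNReal.ofReal (C * r / (l * η) * r ^ (d - 1)) * ∫⁻ y, f y := by
  obtain ⟨C, hC0, hC⟩ := exists_surfaceMeasure_inter_closedBall_le hd
  refine ⟨2 * C * 2 ^ (d - 1), by positivity, ?_⟩
  intro Ω T e n A η H he f hf r l hr hl hl2
  obtain ⟨c, hc⟩ := he.flat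
  have hfin : IsFiniteMeasure ((surfaceMeasure d).restrict e) :=
    ⟨by simpa using he.surfaceMeasure_lt_top hd⟩
  set ν := (surfaceMeasure d).restrict e with hν
  set κ := (volume.restrict (Set.Ioc (0 : ℝ) 1)).prod ν with hκ
  have hz : Measurable fun p : ℝ × Space d => A + (1 - l * p.1) • (p.2 - A) := by fun_prop
  set b : ℝ := c - inner ℝ n A with hb
  have hη := he.height_pos
  have key : ∀ y, κ {p : ℝ × Space d | dist y (A + (1 - l * p.1) • (p.2 - A)) ≤ r}
      ≤ ENNReal.ofReal (2 * C * 2 ^ (d - 1) * r / (l * η) * r ^ (d - 1)) := by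
    intro y
    have hS : MeasurableSet {p : ℝ × Space d | dist y (A + (1 - l * p.1) • (p.2 - A)) ≤ r} :=
      measurableSet_le (measurable_const.dist hz) measurable_const
    rw [hκ, Measure.prod_apply hS]
    rcases e.eq_empty_or_nonempty with hemp | ⟨x0, hx0⟩
    · simp [hν, hemp]
    have hbη : η ≤ b := by
      have := he.height x0 hx0
      rw [inner_sub_right, hc hx0] at this
      exact this
    have hb0 : 0 < b := hη.trans_le hbη
    set m : ℝ := (1 - inner ℝ n (y - A) / b) / l with hm
    calc ∫⁻ t in Set.Ioc (0 : ℝ) 1,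
          ν (Prod.mk t ⁻¹' {p : ℝ × Space d | dist y (A + (1 - l * p.1) • (p.2 - A)) ≤ r})
        ≤ ∫⁻ t in Set.Ioc (0 : ℝ) 1, (Metric.closedBall m (r / (l * η))).indicator
            (fun _ => ENNReal.ofReal (C * (2 * r) ^ (d - 1))) t := by
          refine setLIntegral_mono (measurable_const.indicator
            Metric.isClosed_closedBall.measurableSet) fun t ht => ?_
          -- Undoing the contraction by `1 - l t` towards `A` at most doubles distances, whence the
          -- radius `2 r`.
          have hlt : 1 / 2 ≤ 1 - l * t := by nlinarith [ht.1, ht.2]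
          have hlt0 : 0 < 1 - l * t := by linarith
          set S : Set (Space d) :=
            Prod.mk t ⁻¹' {p : ℝ × Space d | dist y (A + (1 - l * p.1) • (p.2 - A)) ≤ r} with hSt
          have hSm : MeasurableSet S := measurable_prodMk_left hS
          rw [hν, Measure.restrict_apply hSm]
          by_cases htb : t ∈ Metric.closedBall m (r / (l * η))
          · rw [Set.indicator_of_mem htb]
            refine le_trans (measure_mono ?_)
              (hC n c (A + (1 - l * t)⁻¹ • (y - A)) (2 * r) he.unit (by positivity))
            rintro x ⟨hxS, hxe⟩
            refine ⟨hc hxe, ?_⟩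
            have hxS : dist y (A + (1 - l * t) • (x - A)) ≤ r := hxS
            rw [dist_comm, dist_eq_norm] at hxS
            rw [Metric.mem_closedBall, dist_eq_norm]
            have : x - (A + (1 - l * t)⁻¹ • (y - A))
                = (1 - l * t)⁻¹ • (A + (1 - l * t) • (x - A) - y) := by
              have h0 : (1 - l * t)⁻¹ • (A + (1 - l * t) • (x - A) - y)
                  = (1 - l * t)⁻¹ • ((1 - l * t) • (x - A)) - (1 - l * t)⁻¹ • (y - A) := by
                rw [← smul_sub]
                congr 1
                abel
              rw [h0, smul_smul, inv_mul_cancel₀ hlt0.ne', one_smul]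
              abel
            rw [this, norm_smul, norm_inv, Real.norm_eq_abs, abs_of_pos hlt0]
            have h2 : (1 - l * t)⁻¹ ≤ 2 := by
              rw [inv_le_comm₀ hlt0 (by norm_num)]
              linarith
            exact mul_le_mul h2 hxS (norm_nonneg _) (by norm_num)
          · rw [Set.indicator_of_notMem htb]
            have : S ∩ e = ∅ := by
              rw [Set.eq_empty_iff_forall_notMem]
              rintro x ⟨hxS, hxe⟩
              apply htb
              have hxS : dist y (A + (1 - l * t) • (x - A)) ≤ r := hxS
              rw [dist_comm, dist_eq_norm] at hxS
              have h1 := (abs_real_inner_le_norm n (A + (1 - l * t) • (x - A) - y))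
              rw [he.unit, one_mul, show A + (1 - l * t) • (x - A) - y
                = (1 - l * t) • (x - A) - (y - A) by abel, inner_sub_right, inner_smul_right,
                inner_sub_right n x A, hc hxe, ← hb] at h1
              have h2 : |(1 - l * t) * b - inner ℝ n (y - A)| ≤ r := by
                refine h1.trans ?_
                rwa [show (1 - l * t) • (x - A) - (y - A) = A + (1 - l * t) • (x - A) - y by abel]
              rw [Metric.mem_closedBall, Real.dist_eq]
              have h3 : t - m = -((1 - l * t) * b - inner ℝ n (y - A)) / (l * b) := by
                rw [hm]
                field_simp
                ring
              rw [h3, abs_div, abs_neg, abs_of_pos (by positivity : 0 < l * b)]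
              gcongr
            rw [this]
            simp
      _ ≤ ∫⁻ t, (Metric.closedBall m (r / (l * η))).indicator
            (fun _ => ENNReal.ofReal (C * (2 * r) ^ (d - 1))) t := setLIntegral_le_lintegral _ _
      _ = ENNReal.ofReal (C * (2 * r) ^ (d - 1)) * volume (Metric.closedBall m (r / (l * η))) :=
          lintegral_indicator_const Metric.isClosed_closedBall.measurableSet _
      _ = _ := by
          rw [Real.volume_closedBall, ← ENNReal.ofReal_mul (by positivity)]
          congr 1
          rw [mul_pow]
          ring
  have hmain := lintegral_lintegral_closedBall_le (κ := κ) hz hf r key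
  refine le_trans (le_of_eq ?_) hmain
  rw [hκ, lintegral_prod _ (measurable_lintegral_closedBall hz hf r).aemeasurable]
  unfold rayIntegral
  rw [lintegral_lintegral_swap]
  exact ((measurable_lintegral_closedBall hz hf r).comp measurable_swap).aemeasurable

/-! ### The trace on a face -/

/-- The values at the scales `4^(-j)` form a Cauchy sequence, and the same hypothesis controls the
oscillation between consecutive scales, so the limit exists along all radii and not only along the
sequence. -/
theorem exists_tendsto_of_geometric {f : ℝ → ℝ} {q C : ℝ} (hq0 : 0 ≤ q) (hq : q < 1)
    (j0 : ℕ)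
    (h : ∀ j ≥ j0, ∀ s ∈ Set.Icc ((1 / 4 : ℝ) ^ (j + 1)) ((1 / 4 : ℝ) ^ j),
      |f s - f ((1 / 4 : ℝ) ^ j)| ≤ C * q ^ j) :
    ∃ l, Tendsto f (𝓝[>] 0) (𝓝 l) := by
  set a : ℕ → ℝ := fun j => f ((1 / 4 : ℝ) ^ (j + j0)) with ha
  have hd : ∀ j, dist (a j) (a (j + 1)) ≤ C * q ^ j0 * q ^ j := by
    intro j
    rw [dist_comm, Real.dist_eq]
    have := h (j + j0) (by omega) ((1 / 4 : ℝ) ^ (j + j0 + 1))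
      ⟨le_rfl, pow_le_pow_of_le_one (by norm_num) (by norm_num) (by omega)⟩
    rw [pow_add q j j0] at this
    calc _ ≤ C * (q ^ j * q ^ j0) := by
          simpa [ha, add_right_comm] using this
      _ = _ := by ring
  obtain ⟨l, hl⟩ := cauchySeq_tendsto_of_complete (cauchySeq_of_le_geometric q _ hq hd)
  refine ⟨l, ?_⟩
  rw [Metric.tendsto_nhdsWithin_nhds]
  intro ε hε
  set K : ℝ := C * (1 + 1 / (1 - q)) with hK
  have hq1 : 0 < 1 - q := by linarith
  have hlim : Tendsto (fun j => K * q ^ j) atTop (𝓝 0) := by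
    simpa using (tendsto_pow_atTop_nhds_zero_of_lt_one hq0 hq).const_mul K
  obtain ⟨J, hJ⟩ := eventually_atTop.1 (hlim.eventually (Iio_mem_nhds hε))
  refine ⟨(1 / 4 : ℝ) ^ (max J j0), by positivity, fun s hs hsd => ?_⟩
  have hs0 : 0 < s := hs
  rw [Real.dist_eq, sub_zero, abs_of_pos hs0] at hsd
  obtain ⟨j, hj1, hj2⟩ := exists_nat_pow_near_of_lt_one hs0
    (hsd.le.trans (pow_le_one₀ (by norm_num) (by norm_num))) (by norm_num : (0 : ℝ) < 1 / 4)
    (by norm_num)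
  have hjJ : max J j0 ≤ j := by
    by_contra hlt
    have : (1 / 4 : ℝ) ^ (max J j0) ≤ (1 / 4) ^ (j + 1) :=
      pow_le_pow_of_le_one (by norm_num) (by norm_num) (by omega)
    linarith
  have hjj0 : j0 ≤ j := (le_max_right _ _).trans hjJ
  have h1 := h j hjj0 s ⟨hj1.le, hj2⟩
  have h2 := dist_le_of_le_geometric_of_tendsto q _ hq hd hl (j - j0)
  have e1 : a (j - j0) = f ((1 / 4) ^ j) := by simp [ha, Nat.sub_add_cancel hjj0]
  have e2 : C * q ^ j0 * q ^ (j - j0) = C * q ^ j := by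
    rw [mul_assoc, ← pow_add, Nat.add_sub_cancel' hjj0]
  rw [e1, e2, Real.dist_eq] at h2
  rw [Real.dist_eq]
  have h3 := hJ j ((le_max_left _ _).trans hjJ)
  calc |f s - l| ≤ |f s - f ((1 / 4) ^ j)| + |f ((1 / 4) ^ j) - l| := abs_sub_le _ _ _
    _ ≤ C * q ^ j + C * q ^ j / (1 - q) := add_le_add h1 h2
    _ = K * q ^ j := by rw [hK]; ring
    _ < ε := h3

theorem inter_ball_ae_eq_halfBall {d : ℕ} {T : Set (Space d)} {n x : Space d} (hn : ‖n‖ = 1)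
    {r₀ : ℝ} (h1 : ∀ y ∈ Metric.ball x r₀, inner ℝ n (y - x) < 0 → y ∈ T)
    (h2 : ∀ y ∈ Metric.ball x r₀, 0 < inner ℝ n (y - x) → y ∉ T) {r : ℝ} (hr : r ≤ r₀) :
    (T ∩ Metric.ball x r : Set (Space d)) =ᵐ[volume] halfBall n x r := by
  have h0 := measure_eq_zero_iff_ae_notMem.1 (volume_hyperplane hn (inner ℝ n x))
  filter_upwards [h0] with y hy
  have hy' : (inner ℝ n (y - x) : ℝ) ≠ 0 := by
    intro h
    rw [inner_sub_right] at h
    exact hy (sub_eq_zero.1 h)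
  have : y ∈ T ∩ Metric.ball x r ↔ y ∈ halfBall n x r := by
    constructor
    · rintro ⟨hyT, hyb⟩
      refine ⟨hyb, lt_of_le_of_ne (not_lt.1 fun hpos => ?_) hy'⟩
      exact h2 y (Metric.ball_subset_ball hr hyb) hpos hyT
    · rintro ⟨hyb, hyn⟩
      exact ⟨h1 y (Metric.ball_subset_ball hr hyb) hyn, hyb⟩
  exact propext this

theorem halfBall_subset_interior {d : ℕ} {T : Set (Space d)} {n x : Space d}
    {r₀ : ℝ} (h1 : ∀ y ∈ Metric.ball x r₀, inner ℝ n (y - x) < 0 → y ∈ T) {r : ℝ} (hr : r ≤ r₀) :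
    halfBall n x r ⊆ interior T :=
  interior_maximal (fun y hy => h1 y (Metric.ball_subset_ball hr hy.1) hy.2) (isOpen_halfBall n x r)

/-- The Poincaré inequality on the convex half ball of radius `r`. The volume of the large half ball
cancels, and that of the small one, comparable to `r^d` because `s ≥ r / 4`, remains in the
denominator. -/
theorem exists_enorm_average_halfBall_sub_sq_le (d : ℕ) :
    ∃ C : ℝ, 0 < C ∧ ∀ (Ω : Set (Space d)) (u : Space d → ℝ) (g : Fin d → Space d → ℝ),
      MeasurableSet Ω → HasWeakGrad Ω u g → IntegrableOn u Ω → (∀ i, IntegrableOn (g i) Ω) →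
      ∀ (n x : Space d) (r s : ℝ), ‖n‖ = 1 → 0 < r → r / 4 ≤ s → s ≤ r → halfBall n x r ⊆ Ω →
        ‖(⨍ y in halfBall n x r, u y) - ⨍ y in halfBall n x s, u y‖ₑ ^ 2
          ≤ ENNReal.ofReal (C * (r ^ 2 / r ^ d)) * ∫⁻ y in halfBall n x r, ∑ i, ‖g i y‖ₑ ^ 2 := by
  obtain ⟨c, hc0, hc⟩ := exists_volume_halfBall_ge d
  refine ⟨4 * 2 ^ d * (c * (1 / 4) ^ d)⁻¹, by positivity, ?_⟩
  intro Ω u g hΩ hug hu hg n x r s hn hr hs1 hs2 hsub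
  have hs0 : 0 < s := by linarith
  have hvr : 0 < volume (halfBall n x r) :=
    (ENNReal.ofReal_pos.2 (by positivity)).trans_le (hc n x r hn hr)
  have hvs : 0 < volume (halfBall n x s) :=
    (ENNReal.ofReal_pos.2 (by positivity)).trans_le (hc n x s hn hs0)
  have hss : halfBall n x s ⊆ halfBall n x r := fun y hy =>
    ⟨Metric.ball_subset_ball hs2 hy.1, hy.2⟩
  have i1 : IsFiniteMeasure (volume.restrict (halfBall n x r)) :=
    ⟨by simpa using volume_halfBall_lt_top n x r⟩
  have i2 : IsFiniteMeasure (volume.restrict (halfBall n x s)) :=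
    ⟨by simpa using volume_halfBall_lt_top n x s⟩
  have i3 : NeZero (volume.restrict (halfBall n x r)) :=
    ⟨by simpa using hvr.ne'⟩
  have i4 : NeZero (volume.restrict (halfBall n x s)) :=
    ⟨by simpa using hvs.ne'⟩
  have h1 := enorm_average_sub_sq_le (ν := volume.restrict (halfBall n x r))
    (ν' := volume.restrict (halfBall n x s)) (u := u) (hu.mono_set hsub)
    (hu.mono_set (hss.trans hsub))
  have hstar : ∀ b ∈ halfBall n x s, ∀ z ∈ halfBall n x r, ∀ t ∈ Set.Icc (0 : ℝ) 1,
      b + t • (z - b) ∈ halfBall n x r := fun b hb z hz t ht =>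
    (convex_halfBall n x r).add_smul_sub_mem (hss hb) hz ht
  have hR : ∀ y ∈ halfBall n x r, ∀ z ∈ halfBall n x r, ‖y - z‖ ≤ 2 * r := by
    intro y hy z hz
    have := dist_triangle_right y z x
    have h3 := Metric.mem_ball.1 hy.1
    have h4 := Metric.mem_ball.1 hz.1
    rw [← dist_eq_norm]
    linarith
  have h2 := hug.lintegral_sub_sq_le hΩ hu hg (isOpen_halfBall n x r) (isOpen_halfBall n x s)
    hsub hss hstar hR
  simp only [MeasurableSet.univ, Measure.restrict_apply, Set.univ_inter] at h1
  refine h1.trans ?_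
  set I := ∫⁻ y in halfBall n x r, ∑ i, ‖g i y‖ₑ ^ 2 with hI
  calc (volume (halfBall n x s))⁻¹ * ((volume (halfBall n x r))⁻¹ *
        ∫⁻ y in halfBall n x s, ∫⁻ x in halfBall n x r, ‖u x - u y‖ₑ ^ 2)
      ≤ (ENNReal.ofReal (c * s ^ d))⁻¹ * ((volume (halfBall n x r))⁻¹ *
          (ENNReal.ofReal ((2 * r) ^ 2 * 2 ^ d) * volume (halfBall n x r) * I)) := by
        gcongr
        exact hc n x s hn hs0
    _ = (ENNReal.ofReal (c * s ^ d))⁻¹ * ENNReal.ofReal ((2 * r) ^ 2 * 2 ^ d) * I *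
          ((volume (halfBall n x r))⁻¹ * volume (halfBall n x r)) := by ring
    _ = ENNReal.ofReal ((c * s ^ d)⁻¹ * ((2 * r) ^ 2 * 2 ^ d)) * I := by
        rw [ENNReal.inv_mul_cancel hvr.ne' (volume_halfBall_lt_top n x r).ne, mul_one,
          ← ENNReal.ofReal_inv_of_pos (by positivity), ← ENNReal.ofReal_mul (by positivity)]
    _ ≤ _ := by
        refine mul_le_mul' (ENNReal.ofReal_le_ofReal ?_) le_rfl
        have : (c * s ^ d)⁻¹ ≤ (c * (r / 4) ^ d)⁻¹ := by gcongr
        calc (c * s ^ d)⁻¹ * ((2 * r) ^ 2 * 2 ^ d)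
            ≤ (c * (r / 4) ^ d)⁻¹ * ((2 * r) ^ 2 * 2 ^ d) := by gcongr
          _ = _ := by
            rw [div_pow, div_pow, one_pow]
            field_simp
            ring

/-- The average over `B(x, r)` near the face changes between the scales `4^(-j)` and `4^(-j-1)` by
an amount whose square is at most `C r_j^(2-d)` times the energy `∫_{B(x, r_j)} |∇u|²`. Integrated
over the face, this energy is at most `D r_j^(d-1)` times the total one, which gains a factor `r_j`
and makes the changes summable at almost every `x`. -/
theorem ae_exists_tendsto_average {d : ℕ} (hd : 1 ≤ d) {Ω T e : Set (Space d)}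
    (hΩ : MeasurableSet Ω) {n A : Space d} {η H : ℝ} (he : IsPyramidFace Ω T e n A η H)
    {u : Space d → ℝ} {g : Fin d → Space d → ℝ} (hug : HasWeakGrad Ω u g)
    (hu : IntegrableOn u Ω) (hg : ∀ i, IntegrableOn (g i) Ω) (hgm : ∀ i, Measurable (g i))
    (hW : ∫⁻ z in interior T, ∑ i, ‖g i z‖ₑ ^ 2 ≠ ⊤) :
    ∀ᵐ x ∂((surfaceMeasure d).restrict e),
      ∃ l, Tendsto (fun r => ⨍ y in T ∩ Metric.ball x r, u y) (𝓝[>] 0) (𝓝 l) := by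
  obtain ⟨C, hC0, hC⟩ := exists_enorm_average_halfBall_sub_sq_le d
  obtain ⟨D, hD0, hD⟩ := exists_surfaceMeasure_inter_closedBall_le hd
  obtain ⟨c, hc⟩ := he.flat
  have hfin : IsFiniteMeasure ((surfaceMeasure d).restrict e) :=
    ⟨by simpa using he.surfaceMeasure_lt_top hd⟩
  set ν := (surfaceMeasure d).restrict e with hν
  set W : Space d → ℝ≥0∞ := (interior T).indicator fun z => ∑ i, ‖g i z‖ₑ ^ 2 with hWd
  have hWm : Measurable W :=
    (Finset.measurable_sum _ fun i _ => (hgm i).enorm.pow_const 2).indicator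
      isOpen_interior.measurableSet
  have hWi : ∫⁻ z, W z ≠ ⊤ := by rwa [hWd, lintegral_indicator isOpen_interior.measurableSet]
  set r : ℕ → ℝ := fun j => (1 / 4 : ℝ) ^ j with hr
  have hr0 : ∀ j, 0 < r j := fun j => by positivity
  -- The weight `2^j` is affordable, as `2^j r_j = 2^(-j)` is still summable; finiteness of `S x`
  -- then forces geometric decay of the single terms.
  set S : Space d → ℝ≥0∞ := fun x => ∑' j : ℕ, ENNReal.ofReal (2 ^ j * (r j ^ 2 / r j ^ d)) *
    ∫⁻ y in Metric.closedBall x (r j), W y with hS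
  have hSm : ∀ j : ℕ, Measurable fun x : Space d => ENNReal.ofReal (2 ^ j * (r j ^ 2 / r j ^ d)) *
      ∫⁻ y in Metric.closedBall x (r j), W y := fun j =>
    (measurable_lintegral_closedBall measurable_id hWm (r j)).const_mul _
  have hball : ∀ j, ∫⁻ x, (∫⁻ y in Metric.closedBall x (r j), W y) ∂ν
      ≤ ENNReal.ofReal (D * r j ^ (d - 1)) * ∫⁻ y, W y := by
    intro j
    refine lintegral_lintegral_closedBall_le measurable_id hWm (r j) fun y => ?_
    have hSy : MeasurableSet {p : Space d | dist y (id p) ≤ r j} :=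
      measurableSet_le (measurable_const.dist measurable_id) measurable_const
    rw [hν, Measure.restrict_apply hSy]
    refine le_trans (measure_mono ?_) (hD n c y (r j) he.unit (hr0 j).le)
    rintro p ⟨hp1, hp2⟩
    refine ⟨hc hp2, ?_⟩
    rw [Metric.mem_closedBall, dist_comm]
    exact hp1
  have hSi : ∫⁻ x, S x ∂ν ≠ ⊤ := by
    have h1 : ∫⁻ x, S x ∂ν ≤ ∑' j : ℕ, ENNReal.ofReal (D * (1 / 2) ^ j) * ∫⁻ y, W y := by
      rw [hS, lintegral_tsum fun j => (hSm j).aemeasurable]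
      refine ENNReal.tsum_le_tsum fun j => ?_
      have hmj : Measurable fun x : Space d => ∫⁻ y in Metric.closedBall x (r j), W y :=
        measurable_lintegral_closedBall measurable_id hWm (r j)
      rw [lintegral_const_mul _ hmj]
      refine (mul_le_mul' le_rfl (hball j)).trans (le_of_eq ?_)
      rw [← mul_assoc, ← ENNReal.ofReal_mul (by have := hr0 j; positivity)]
      congr 2
      obtain ⟨m, rfl⟩ : ∃ m, d = m + 1 := ⟨d - 1, by omega⟩
      have hrj := (hr0 j).ne'
      have e1 : (2 : ℝ) ^ j * r j = (1 / 2) ^ j := by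
        rw [hr, ← mul_pow]
        norm_num
      rw [Nat.add_sub_cancel, ← e1, pow_succ (r j) m]
      field_simp
    refine ne_top_of_le_ne_top ?_ h1
    rw [ENNReal.tsum_mul_right]
    refine ENNReal.mul_ne_top ?_ hWi
    have hsum : Summable fun j : ℕ => D * (1 / 2 : ℝ) ^ j :=
      (summable_geometric_of_lt_one (by norm_num) (by norm_num)).mul_left D
    exact hsum.tsum_ofReal_ne_top
  have hSae : ∀ᵐ x ∂ν, S x < ⊤ := ae_lt_top (Measurable.tsum hSm) hSi
  have hloc : ∀ᵐ x ∂ν, ∃ r > 0,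
      (∀ y ∈ Metric.ball x r, inner ℝ n (y - x) < 0 → y ∈ T) ∧
      (∀ y ∈ Metric.ball x r, 0 < inner ℝ n (y - x) → y ∉ T) ∧
      ∀ y ∈ Metric.ball x r, inner ℝ n (y - x) = 0 → y ∈ e :=
    (ae_restrict_iff' he.isCompact.measurableSet).2 he.ae_local
  filter_upwards [hSae, hloc] with x hSx hx
  obtain ⟨r₀, hr₀, hx1, hx2, -⟩ := hx
  have hlim : ∃ l, Tendsto (fun s => ⨍ y in halfBall n x s, u y) (𝓝[>] 0) (𝓝 l) := by
    obtain ⟨j0, hj0⟩ : ∃ j0, r j0 < r₀ := exists_pow_lt_of_lt_one hr₀ (by norm_num)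
    -- The squares of the increments are at most `C S(x) 2^(-j)`, so the increments decay with ratio
    -- `√(1/2)`.
    set q : ℝ := √(1 / 2) with hq
    have hq2 : q ^ 2 = 1 / 2 := Real.sq_sqrt (by norm_num)
    have hq0 : 0 ≤ q := Real.sqrt_nonneg _
    have hq1 : q < 1 := by nlinarith
    refine exists_tendsto_of_geometric hq0 hq1 (C := √(C * (S x).toReal)) j0 ?_
    intro j hj s hs
    have hrj : r j ≤ r₀ :=
      (pow_le_pow_of_le_one (by norm_num) (by norm_num) hj).trans hj0.le
    have hsubT := halfBall_subset_interior hx1 hrj (n := n)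
    have hsub := hsubT.trans he.interior_subset
    have hs1 : r j / 4 ≤ s := by
      have := hs.1
      rw [pow_succ] at this
      calc r j / 4 = (1 / 4) ^ j * (1 / 4) := by rw [hr]; ring
        _ ≤ s := this
    have h3 := hC Ω u g hΩ hug hu hg n x (r j) s he.unit (hr0 j) hs1 hs.2 hsub
    have hWle : ∫⁻ y in halfBall n x (r j), ∑ i, ‖g i y‖ₑ ^ 2
        ≤ ∫⁻ y in Metric.closedBall x (r j), W y := by
      calc ∫⁻ y in halfBall n x (r j), ∑ i, ‖g i y‖ₑ ^ 2
          = ∫⁻ y in halfBall n x (r j), W y := by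
            refine setLIntegral_congr_fun (isOpen_halfBall n x _).measurableSet fun y hy => ?_
            rw [hWd, Set.indicator_of_mem (hsubT hy)]
        _ ≤ _ := lintegral_mono_set fun y hy => Metric.ball_subset_closedBall hy.1
    have h4 : ENNReal.ofReal (2 ^ j * (r j ^ 2 / r j ^ d)) *
        ∫⁻ y in Metric.closedBall x (r j), W y ≤ S x := ENNReal.le_tsum j
    have h5 : ‖(⨍ y in halfBall n x (r j), u y) - ⨍ y in halfBall n x s, u y‖ₑ ^ 2
        ≤ ENNReal.ofReal (C * (S x).toReal * (1 / 2) ^ j) := by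
      refine h3.trans ((mul_le_mul' le_rfl hWle).trans ?_)
      have hrp : 0 ≤ r j ^ 2 / r j ^ d := by have := hr0 j; positivity
      calc ENNReal.ofReal (C * (r j ^ 2 / r j ^ d)) * ∫⁻ y in Metric.closedBall x (r j), W y
          = ENNReal.ofReal (C * (1 / 2) ^ j) * (ENNReal.ofReal (2 ^ j * (r j ^ 2 / r j ^ d)) *
              ∫⁻ y in Metric.closedBall x (r j), W y) := by
            rw [← mul_assoc, ← ENNReal.ofReal_mul (by positivity)]
            congr 2
            have : (1 / 2 : ℝ) ^ j * 2 ^ j = 1 := by rw [← mul_pow]; norm_num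
            linear_combination (-C * (r j ^ 2 / r j ^ d)) * this
        _ ≤ ENNReal.ofReal (C * (1 / 2) ^ j) * S x := mul_le_mul' le_rfl h4
        _ = _ := by
            conv_lhs => rw [← ENNReal.ofReal_toReal hSx.ne]
            rw [← ENNReal.ofReal_mul (by positivity)]
            congr 1
            ring
    rw [enorm_sq_eq_ofReal, ENNReal.ofReal_le_ofReal_iff (by positivity)] at h5
    rw [abs_sub_comm]
    refine abs_le_of_sq_le_sq ?_ (by positivity)
    rw [mul_pow, Real.sq_sqrt (by positivity), ← pow_mul, mul_comm j 2, pow_mul, hq2]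
    exact h5
  obtain ⟨l, hl⟩ := hlim
  refine ⟨l, hl.congr' ?_⟩
  have : ∀ᶠ s in 𝓝[>] (0 : ℝ), s < r₀ := mem_nhdsWithin_of_mem_nhds (Iio_mem_nhds hr₀)
  filter_upwards [this] with s hs
  rw [setAverage_congr (inter_ball_ae_eq_halfBall he.unit hx1 hx2 hs.le)]

/-! ### The `L²` bound of the trace on a face. -/

theorem enorm_sq_le_two_mul (a b : ℝ) : ‖a‖ₑ ^ 2 ≤ 2 * ‖b‖ₑ ^ 2 + 2 * ‖b - a‖ₑ ^ 2 := by
  simp only [enorm_sq_eq_ofReal]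
  rw [show (2 : ℝ≥0∞) = ENNReal.ofReal 2 by simp, ← ENNReal.ofReal_mul (by norm_num),
    ← ENNReal.ofReal_mul (by norm_num), ← ENNReal.ofReal_add (by positivity) (by positivity)]
  refine ENNReal.ofReal_le_ofReal ?_
  nlinarith [sq_nonneg (a - 2 * b)]

theorem setLIntegral_closedBall_add {d : ℕ} (f : Space d → ℝ≥0∞) (x h : Space d) (r : ℝ) :
    ∫⁻ y in Metric.closedBall x r, f (y + h) = ∫⁻ y in Metric.closedBall (x + h) r, f y := by
  rw [← lintegral_indicator Metric.isClosed_closedBall.measurableSet,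
    ← lintegral_indicator Metric.isClosed_closedBall.measurableSet,
    ← lintegral_add_right_eq_self ((Metric.closedBall (x + h) r).indicator f) h]
  refine lintegral_congr fun y => ?_
  simp [Set.indicator, Metric.mem_closedBall]

/-- An average over a small half ball at a face is bounded by integrals along the pyramid. -/
theorem IsPyramidFace.enorm_average_sq_le {d : ℕ} {Ω T e : Set (Space d)}
    (hΩ : MeasurableSet Ω) {n A : Space d} {η H : ℝ} (he : IsPyramidFace Ω T e n A η H)
    {u : Space d → ℝ} {g : Fin d → Space d → ℝ} (hug : HasWeakGrad Ω u g)
    (hu : IntegrableOn u Ω) (hg : ∀ i, IntegrableOn (g i) Ω) (hum : Measurable u)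
    (hgm : ∀ i, Measurable (g i)) {x : Space d} (hx : x ∈ e) {r : ℝ}
    (hr : ∀ s ∈ Set.Icc (1 / 2 : ℝ) 1, halfBall n (A + s • (x - A)) r ⊆ convexJoin ℝ {A} e) :
    ‖⨍ y in halfBall n x r, u y‖ₑ ^ 2
      ≤ (volume (halfBall n x r))⁻¹ *
        (2 * rayIntegral A ((interior T).indicator fun z => ‖u z‖ₑ ^ 2) r (1 / 2) x
          + ∫⁻ t in Set.Ioc (0 : ℝ) 1, ENNReal.ofReal (t ^ 2 / 2 * H ^ 2) *
            rayIntegral A ((interior T).indicator fun z => ∑ i, ‖g i z‖ₑ ^ 2) r (1 / 2 * t) x) := by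
  set W : Space d → ℝ≥0∞ := (interior T).indicator fun z => ∑ i, ‖g i z‖ₑ ^ 2 with hW
  set V : Space d → ℝ≥0∞ := (interior T).indicator fun z => ‖u z‖ₑ ^ 2 with hV
  have hWm : Measurable W :=
    (Finset.measurable_sum _ fun i _ => (hgm i).enorm.pow_const 2).indicator
      isOpen_interior.measurableSet
  have hVm : Measurable V := (hum.enorm.pow_const 2).indicator isOpen_interior.measurableSet
  have hrT : ∀ s ∈ Set.Icc (1 / 2 : ℝ) 1, halfBall n (A + s • (x - A)) r ⊆ interior T :=
    fun s hs => interior_maximal ((hr s hs).trans he.apex) (isOpen_halfBall _ _ _)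
  have hx1 : A + (1 : ℝ) • (x - A) = x := by rw [one_smul]; abel
  have hxr : halfBall n x r ⊆ interior T := by
    have := hrT 1 ⟨by norm_num, le_rfl⟩
    rwa [hx1] at this
  refine (WeakGalerkin.enorm_average_sq_le hum.aemeasurable).trans ?_
  simp only [MeasurableSet.univ, Measure.restrict_apply, Set.univ_inter]
  refine mul_le_mul' le_rfl ?_
  have hshift : ∀ l : ℝ, ∀ y ∈ halfBall n x r, 0 ≤ l → l ≤ 1 / 2 →
      y + (-l) • (x - A) ∈ interior T := by
    intro l y hy hl0 hl
    refine hrT (1 - l) ⟨by linarith, by linarith⟩ ?_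
    have e : y + (-l) • (x - A) - (A + (1 - l) • (x - A)) = y - x := by
      rw [sub_smul, neg_smul, one_smul]
      abel
    refine ⟨?_, ?_⟩
    · rw [Metric.mem_ball, dist_eq_norm, e, ← dist_eq_norm]
      exact hy.1
    · rw [e]
      exact hy.2
  have hcl : halfBall n x r ⊆ Metric.closedBall x r :=
    fun y hy => Metric.ball_subset_closedBall hy.1
  -- For each `t` the half ball is moved by `t/2` of the way towards the apex. A single translate
  -- would again lead to an integral over a hypersurface; averaging over `t` afterwards supplies the
  -- missing dimension.
  have key : ∀ t ∈ Set.Ioc (0 : ℝ) 1, ∫⁻ y in halfBall n x r, ‖u y‖ₑ ^ 2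
      ≤ 2 * (∫⁻ y in Metric.closedBall (A + (1 - 1 / 2 * t) • (x - A)) r, V y)
        + ENNReal.ofReal (t ^ 2 / 2 * H ^ 2) * rayIntegral A W r (1 / 2 * t) x := by
    intro t ht
    set l : ℝ := 1 / 2 * t with hl
    have hl0 : 0 ≤ l := by linarith [ht.1]
    have hl2 : l ≤ 1 / 2 := by linarith [ht.2]
    set h : Space d := (-l) • (x - A) with hh
    have hseg : ∀ z ∈ halfBall n x r, ∀ τ ∈ Set.Icc (0 : ℝ) 1, z + τ • h ∈ interior T := by
      intro z hz τ hτ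
      have := hshift (τ * l) z hz (mul_nonneg hτ.1 hl0) (by nlinarith [hτ.1, hτ.2])
      rwa [hh, smul_smul, mul_neg]
    have hae := hug.enorm_sub_sq_le hΩ hu hg hgm (isOpen_halfBall n x r) h
      fun z hz τ hτ => he.interior_subset (hseg z hz τ hτ)
    have hnh : ‖h‖ₑ ^ 2 ≤ ENNReal.ofReal (t ^ 2 / 4 * H ^ 2) := by
      rw [← ofReal_norm, ← ENNReal.ofReal_pow (norm_nonneg _)]
      refine ENNReal.ofReal_le_ofReal ?_
      rw [hh, norm_smul, norm_neg, Real.norm_eq_abs, abs_of_nonneg hl0, mul_pow, hl]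
      have := he.dist_le x hx
      have h2 : ‖x - A‖ ^ 2 ≤ H ^ 2 := by gcongr
      nlinarith [sq_nonneg t]
    calc ∫⁻ y in halfBall n x r, ‖u y‖ₑ ^ 2
        ≤ ∫⁻ y in halfBall n x r, (2 * V (y + h)
            + ENNReal.ofReal (t ^ 2 / 2 * H ^ 2) *
              ∫⁻ τ in Set.Ioc (0 : ℝ) 1, W (y + τ • h)) := by
          refine setLIntegral_mono_ae ?_ ?_
          · refine AEMeasurable.add ((hVm.comp (by fun_prop)).const_mul _).aemeasurable ?_
            refine Measurable.aemeasurable (Measurable.const_mul ?_ _)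
            have : Measurable fun p : Space d × ℝ => W (p.1 + p.2 • h) := hWm.comp (by fun_prop)
            exact this.lintegral_prod_right' (ν := volume.restrict (Set.Ioc (0 : ℝ) 1))
          · filter_upwards [hae] with y hy hyb
            have h1 := hy hyb
            have hyT := hxr hyb
            have hyh : y + h ∈ interior T := by
              have := hseg y hyb 1 ⟨zero_le_one, le_rfl⟩
              rwa [one_smul] at this
            rw [Set.indicator_of_mem (he.interior_subset hyT),
              Set.indicator_of_mem (he.interior_subset hyh)] at h1
            refine (enorm_sq_le_two_mul (u y) (u (y + h))).trans ?_
            refine add_le_add ?_ ?_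
            · rw [hV, Set.indicator_of_mem hyh]
            · have e : ∫⁻ τ in Set.Ioc (0 : ℝ) 1, gradSq Ω g (y + τ • h)
                  = ∫⁻ τ in Set.Ioc (0 : ℝ) 1, W (y + τ • h) := by
                refine setLIntegral_congr_fun measurableSet_Ioc fun τ hτ => ?_
                have hm := hseg y hyb τ ⟨hτ.1.le, hτ.2⟩
                simp only [hW, gradSq, Set.indicator_of_mem hm,
                  Set.indicator_of_mem (he.interior_subset hm)]
              rw [e] at h1
              calc 2 * ‖u (y + h) - u y‖ₑ ^ 2
                  ≤ 2 * (ENNReal.ofReal (t ^ 2 / 4 * H ^ 2) *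
                      ∫⁻ τ in Set.Ioc (0 : ℝ) 1, W (y + τ • h)) :=
                    mul_le_mul' le_rfl (h1.trans (mul_le_mul' hnh le_rfl))
                _ = _ := by
                    have e3 : 2 * ENNReal.ofReal (t ^ 2 / 4 * H ^ 2)
                        = ENNReal.ofReal (t ^ 2 / 2 * H ^ 2) := by
                      rw [← ENNReal.ofReal_ofNat 2, ← ENNReal.ofReal_mul (by norm_num)]
                      congr 1
                      ring
                    rw [← mul_assoc, e3]
      _ ≤ ∫⁻ y in Metric.closedBall x r, (2 * V (y + h)
            + ENNReal.ofReal (t ^ 2 / 2 * H ^ 2) *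
              ∫⁻ τ in Set.Ioc (0 : ℝ) 1, W (y + τ • h)) := lintegral_mono_set hcl
      _ = 2 * (∫⁻ y in Metric.closedBall x r, V (y + h)) + ENNReal.ofReal (t ^ 2 / 2 * H ^ 2) *
            ∫⁻ τ in Set.Ioc (0 : ℝ) 1, ∫⁻ y in Metric.closedBall x r, W (y + τ • h) := by
          have hm1 : Measurable fun y => V (y + h) := hVm.comp (by fun_prop)
          have hm2 : Measurable fun p : Space d × ℝ => W (p.1 + p.2 • h) := hWm.comp (by fun_prop)
          rw [lintegral_add_left (hm1.const_mul _), lintegral_const_mul _ hm1,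
            lintegral_const_mul _
              (hm2.lintegral_prod_right' (ν := volume.restrict (Set.Ioc (0 : ℝ) 1))),
            lintegral_lintegral_swap (f := fun y τ => W (y + τ • h)) hm2.aemeasurable]
      _ = _ := by
          rw [setLIntegral_closedBall_add V, rayIntegral]
          simp only [setLIntegral_closedBall_add W]
          have e1 : x + h = A + (1 - l) • (x - A) := by
            rw [hh, sub_smul, neg_smul, one_smul]
            abel
          have e2 : ∀ τ : ℝ, x + τ • h = A + (1 - l * τ) • (x - A) := by
            intro τ
            rw [hh, smul_smul, sub_smul, one_smul, mul_neg, neg_smul, mul_comm]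
            abel
          rw [e1]
          simp only [e2]
  clear_value W V
  have hm : Measurable fun t : ℝ =>
      ∫⁻ y in Metric.closedBall (A + (1 - 1 / 2 * t) • (x - A)) r, V y := by
    have hz : Measurable fun t : ℝ => A + (1 - 1 / 2 * t) • (x - A) := by fun_prop
    exact measurable_lintegral_closedBall hz hVm r
  have hm' : Measurable fun t : ℝ => rayIntegral A W r (1 / 2 * t) x := by
    have hz : Measurable fun t : ℝ => 1 / 2 * t := by fun_prop
    exact measurable_rayIntegral_comp A hWm r hz measurable_const
  have hm'' : Measurable fun t : ℝ => ENNReal.ofReal (t ^ 2 / 2 * H ^ 2) := by fun_prop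
  calc ∫⁻ y in halfBall n x r, ‖u y‖ₑ ^ 2
      = ∫⁻ _ in Set.Ioc (0 : ℝ) 1, ∫⁻ y in halfBall n x r, ‖u y‖ₑ ^ 2 := by
        rw [setLIntegral_const]
        simp
    _ ≤ ∫⁻ t in Set.Ioc (0 : ℝ) 1,
          (2 * (∫⁻ y in Metric.closedBall (A + (1 - 1 / 2 * t) • (x - A)) r, V y)
          + ENNReal.ofReal (t ^ 2 / 2 * H ^ 2) * rayIntegral A W r (1 / 2 * t) x) :=
        setLIntegral_mono ((hm.const_mul _).add (hm''.mul hm')) key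
    _ = _ := by
        rw [lintegral_add_left (hm.const_mul _), lintegral_const_mul _ hm]
        rfl

theorem tendsto_trace {d : ℕ} {T : Set (Space d)} {u : Space d → ℝ} {x : Space d} {l : ℝ}
    (h : Tendsto (fun r => ⨍ y in T ∩ Metric.ball x r, u y) (𝓝[>] 0) (𝓝 l)) :
    trace T u x = l := h.limUnder_eq

/-- Bounds the averages over small half balls by integrals along rays into the pyramid, integrates
over the face with a bound independent of `r`, and lets `r → 0` by Fatou's lemma. At almost every
point the averages converge to the trace. -/
theorem exists_lintegral_trace_sq_le_of_measurable {d : ℕ} (hd : 1 ≤ d) :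
    ∃ C : ℝ, 0 < C ∧ ∀ (Ω T e : Set (Space d)) (n A : Space d) (η H : ℝ), MeasurableSet Ω →
      IsPyramidFace Ω T e n A η H → ∀ (u : Space d → ℝ) (g : Fin d → Space d → ℝ),
      HasWeakGrad Ω u g → IntegrableOn u Ω → (∀ i, IntegrableOn (g i) Ω) → Measurable u →
      (∀ i, Measurable (g i)) → ∫⁻ z in interior T, ∑ i, ‖g i z‖ₑ ^ 2 ≠ ⊤ →
      ∫⁻ x in e, ‖trace T u x‖ₑ ^ 2 ∂(surfaceMeasure d)
        ≤ ENNReal.ofReal (C / η) * ((∫⁻ z in interior T, ‖u z‖ₑ ^ 2)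
            + ENNReal.ofReal (H ^ 2) * ∫⁻ z in interior T, ∑ i, ‖g i z‖ₑ ^ 2) := by
  obtain ⟨C, hC0, hC⟩ := exists_lintegral_rayIntegral_le hd
  obtain ⟨c, hc0, hc⟩ := exists_volume_halfBall_ge d
  refine ⟨4 * C / c, by positivity, ?_⟩
  intro Ω T e n A η H hΩ he u g hug hu hg hum hgm hfin
  have hη := he.height_pos
  have hSf : IsFiniteMeasure ((surfaceMeasure d).restrict e) :=
    ⟨by simpa using he.surfaceMeasure_lt_top hd⟩
  set ν := (surfaceMeasure d).restrict e with hν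
  set W : Space d → ℝ≥0∞ := (interior T).indicator fun z => ∑ i, ‖g i z‖ₑ ^ 2 with hW
  set V : Space d → ℝ≥0∞ := (interior T).indicator fun z => ‖u z‖ₑ ^ 2 with hV
  have hWm : Measurable W :=
    (Finset.measurable_sum _ fun i _ => (hgm i).enorm.pow_const 2).indicator
      isOpen_interior.measurableSet
  have hVm : Measurable V := (hum.enorm.pow_const 2).indicator isOpen_interior.measurableSet
  have hWi : ∫⁻ z, W z = ∫⁻ z in interior T, ∑ i, ‖g i z‖ₑ ^ 2 :=
    lintegral_indicator isOpen_interior.measurableSet _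
  have hVi : ∫⁻ z, V z = ∫⁻ z in interior T, ‖u z‖ₑ ^ 2 :=
    lintegral_indicator isOpen_interior.measurableSet _
  set Φ : ℝ → Space d → ℝ≥0∞ := fun r x => (ENNReal.ofReal (c * r ^ d))⁻¹ *
    (2 * rayIntegral A V r (1 / 2) x + ∫⁻ t in Set.Ioc (0 : ℝ) 1,
      ENNReal.ofReal (t ^ 2 / 2 * H ^ 2) * rayIntegral A W r (1 / 2 * t) x) with hΦ
  have hlim := ae_exists_tendsto_average hd hΩ he hug hu hg hgm hfin
  have hloc : ∀ᵐ x ∂ν, ∃ r > 0,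
      (∀ y ∈ Metric.ball x r, inner ℝ n (y - x) < 0 → y ∈ T) ∧
      (∀ y ∈ Metric.ball x r, 0 < inner ℝ n (y - x) → y ∉ T) ∧
      ∀ y ∈ Metric.ball x r, inner ℝ n (y - x) = 0 → y ∈ e :=
    (ae_restrict_iff' he.isCompact.measurableSet).2 he.ae_local
  have hbd : ∀ᵐ x ∂ν, ‖trace T u x‖ₑ ^ 2
      ≤ liminf (fun j : ℕ => Φ ((1 / 4 : ℝ) ^ j) x) atTop := by
    filter_upwards [hlim, hloc, ae_restrict_mem he.isCompact.measurableSet] with x hx1 hx2 hxe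
    obtain ⟨l, hl⟩ := hx1
    obtain ⟨r₁, hr₁, ha, hb, hc'⟩ := hx2
    -- How small the radius must be depends on `x`; only the eventual bound is used, and the limit
    -- inferior does not see the rest.
    obtain ⟨r₂, hr₂, hcone⟩ := exists_halfBall_subset_convexJoin (A := A) he.unit hr₁
      (hη.trans_le (he.height x hxe)) hc'
    rw [tendsto_trace hl]
    have hseq : Tendsto (fun j : ℕ => (1 / 4 : ℝ) ^ j) atTop (𝓝[>] 0) :=
      tendsto_nhdsWithin_iff.2 ⟨tendsto_pow_atTop_nhds_zero_of_lt_one (by norm_num) (by norm_num),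
        Eventually.of_forall fun j => by simp⟩
    have h1 := ((ENNReal.continuous_pow 2).tendsto _).comp (hl.comp hseq).enorm
    rw [← h1.liminf_eq]
    refine liminf_le_liminf ?_
    have hsm : ∀ᶠ s in 𝓝[>] (0 : ℝ), s < min r₁ r₂ :=
      mem_nhdsWithin_of_mem_nhds (Iio_mem_nhds (lt_min hr₁ hr₂))
    filter_upwards [hseq.eventually hsm] with j hj
    have hj1 := hj.le.trans (min_le_left _ _)
    have hj2 := hj.le.trans (min_le_right _ _)
    simp only [Function.comp_apply]
    rw [setAverage_congr (inter_ball_ae_eq_halfBall he.unit ha hb hj1)]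
    refine (he.enorm_average_sq_le hΩ hug hu hg hum hgm hxe fun s hs => ?_).trans ?_
    · exact fun y hy => hcone s hs ⟨Metric.ball_subset_ball hj2 hy.1, hy.2⟩
    · exact mul_le_mul' (ENNReal.inv_le_inv.2 (hc n x _ he.unit (by positivity))) le_rfl
  have hmj : ∀ r : ℝ, Measurable fun q : Space d × ℝ => rayIntegral A W r (1 / 2 * q.2) q.1 :=
    fun r => measurable_rayIntegral_comp A hWm r (measurable_snd.const_mul _) measurable_fst
  have hmV : ∀ r : ℝ, Measurable fun x : Space d => rayIntegral A V r (1 / 2) x :=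
    fun r => measurable_rayIntegral_comp A hVm r measurable_const measurable_id
  have hmc : Measurable fun t : ℝ => ENNReal.ofReal (t ^ 2 / 2 * H ^ 2) := by fun_prop
  have hmcW : ∀ r : ℝ, Measurable fun q : Space d × ℝ =>
      ENNReal.ofReal (q.2 ^ 2 / 2 * H ^ 2) * rayIntegral A W r (1 / 2 * q.2) q.1 :=
    fun r => (hmc.comp measurable_snd).mul (hmj r)
  have hmint : ∀ r : ℝ, Measurable fun x : Space d => ∫⁻ t in Set.Ioc (0 : ℝ) 1,
      ENNReal.ofReal (t ^ 2 / 2 * H ^ 2) * rayIntegral A W r (1 / 2 * t) x :=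
    fun r => (hmcW r).lintegral_prod_right' (ν := volume.restrict (Set.Ioc (0 : ℝ) 1))
  have hΦm : ∀ r, Measurable (Φ r) := fun r => (((hmV r).const_mul _).add (hmint r)).const_mul _
  have hΦi : ∀ r : ℝ, 0 < r → ∫⁻ x, Φ r x ∂ν ≤ ENNReal.ofReal (4 * C / c / η) *
      ((∫⁻ z, V z) + ENNReal.ofReal (H ^ 2) * ∫⁻ z, W z) := by
    intro r hr
    obtain ⟨m, rfl⟩ : ∃ m, d = m + 1 := ⟨d - 1, by omega⟩
    have hK : 0 ≤ 2 * C * r ^ (m + 1) / η := by positivity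
    have b1 : ∫⁻ x, rayIntegral A V r (1 / 2) x ∂ν
        ≤ ENNReal.ofReal (2 * C * r ^ (m + 1) / η) * ∫⁻ z, V z := by
      refine (hC Ω T e n A η H he V hVm r (1 / 2) hr.le (by norm_num) le_rfl).trans
        (le_of_eq ?_)
      congr 2
      rw [Nat.add_sub_cancel, pow_succ]
      field_simp
    have b2 : ∫⁻ x, (∫⁻ t in Set.Ioc (0 : ℝ) 1,
          ENNReal.ofReal (t ^ 2 / 2 * H ^ 2) * rayIntegral A W r (1 / 2 * t) x) ∂ν
        ≤ ENNReal.ofReal (2 * C * r ^ (m + 1) / η) * (ENNReal.ofReal (H ^ 2) * ∫⁻ z, W z) := by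
      rw [lintegral_lintegral_swap (f := fun x t =>
        ENNReal.ofReal (t ^ 2 / 2 * H ^ 2) * rayIntegral A W r (1 / 2 * t) x) (hmcW r).aemeasurable]
      calc ∫⁻ t in Set.Ioc (0 : ℝ) 1, (∫⁻ x, ENNReal.ofReal (t ^ 2 / 2 * H ^ 2) *
              rayIntegral A W r (1 / 2 * t) x ∂ν)
          ≤ ∫⁻ _ in Set.Ioc (0 : ℝ) 1, ENNReal.ofReal (2 * C * r ^ (m + 1) / η) *
              (ENNReal.ofReal (H ^ 2) * ∫⁻ z, W z) := by
            refine setLIntegral_mono measurable_const fun t ht => ?_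
            have ht0 := ht.1
            have ht1 := ht.2
            have hmt : Measurable fun x : Space (m + 1) => rayIntegral A W r (1 / 2 * t) x :=
              measurable_rayIntegral_comp A hWm r measurable_const measurable_id
            rw [lintegral_const_mul _ hmt]
            refine (mul_le_mul' le_rfl (hC Ω T e n A η H he W hWm r (1 / 2 * t) hr.le (by linarith)
              (by linarith))).trans ?_
            rw [← mul_assoc, ← mul_assoc, ← ENNReal.ofReal_mul (by positivity),
              ← ENNReal.ofReal_mul hK]
            refine mul_le_mul' (ENNReal.ofReal_le_ofReal ?_) le_rfl
            rw [Nat.add_sub_cancel]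
            -- A ray of relative length `t/2` costs a factor `1/t`, which is absorbed by the `t²`
            -- from the squared displacement.
            calc t ^ 2 / 2 * H ^ 2 * (C * r / (1 / 2 * t * η) * r ^ m)
                = t * (C * r ^ (m + 1) / η * H ^ 2) := by
                  rw [pow_succ r m]
                  field_simp
              _ ≤ 2 * (C * r ^ (m + 1) / η * H ^ 2) := by
                  have : 0 ≤ C * r ^ (m + 1) / η * H ^ 2 := by positivity
                  nlinarith
              _ = _ := by ring
        _ = _ := by
            rw [setLIntegral_const]
            simp
    have b3 : ∫⁻ x, Φ r x ∂ν = (ENNReal.ofReal (c * r ^ (m + 1)))⁻¹ *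
        (2 * (∫⁻ x, rayIntegral A V r (1 / 2) x ∂ν) + ∫⁻ x, (∫⁻ t in Set.Ioc (0 : ℝ) 1,
          ENNReal.ofReal (t ^ 2 / 2 * H ^ 2) * rayIntegral A W r (1 / 2 * t) x) ∂ν) := by
      rw [hΦ]
      simp only
      have hs : Measurable fun x : Space (m + 1) => 2 * rayIntegral A V r (1 / 2) x
          + ∫⁻ t in Set.Ioc (0 : ℝ) 1,
            ENNReal.ofReal (t ^ 2 / 2 * H ^ 2) * rayIntegral A W r (1 / 2 * t) x :=
        ((hmV r).const_mul _).add (hmint r)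
      rw [lintegral_const_mul _ hs,
        lintegral_add_left ((hmV r).const_mul _), lintegral_const_mul _ (hmV r)]
    rw [b3, ← ENNReal.ofReal_inv_of_pos (by positivity)]
    set P := ∫⁻ z, V z
    set Q := ENNReal.ofReal (H ^ 2) * ∫⁻ z, W z
    calc _ ≤ ENNReal.ofReal (c * r ^ (m + 1))⁻¹ *
          (2 * (ENNReal.ofReal (2 * C * r ^ (m + 1) / η) * P)
            + 2 * (ENNReal.ofReal (2 * C * r ^ (m + 1) / η) * Q)) := by
          refine mul_le_mul' le_rfl (add_le_add (mul_le_mul' le_rfl b1) (b2.trans ?_))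
          exact le_mul_of_one_le_left' (by norm_num)
      _ = ENNReal.ofReal (c * r ^ (m + 1))⁻¹ * (ENNReal.ofReal 2 *
            ENNReal.ofReal (2 * C * r ^ (m + 1) / η)) * (P + Q) := by
          rw [ENNReal.ofReal_ofNat]
          ring
      _ = _ := by
          rw [← ENNReal.ofReal_mul (by norm_num), ← ENNReal.ofReal_mul (by positivity)]
          congr 2
          field_simp
          ring
  calc ∫⁻ x, ‖trace T u x‖ₑ ^ 2 ∂ν
      ≤ ∫⁻ x, liminf (fun j : ℕ => Φ ((1 / 4 : ℝ) ^ j) x) atTop ∂ν := lintegral_mono_ae hbd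
    _ ≤ liminf (fun j : ℕ => ∫⁻ x, Φ ((1 / 4 : ℝ) ^ j) x ∂ν) atTop :=
        lintegral_liminf_le' fun j => (hΦm _).aemeasurable
    _ ≤ liminf (fun _ : ℕ => ENNReal.ofReal (4 * C / c / η) *
          ((∫⁻ z, V z) + ENNReal.ofReal (H ^ 2) * ∫⁻ z, W z)) atTop :=
        liminf_le_liminf (Eventually.of_forall fun j => hΦi _ (by positivity))
    _ = _ := by rw [liminf_const, hVi, hWi]

/-! ### Measurability of the trace and independence of the representative. -/

theorem measurable_setIntegral_inter_ball {d : ℕ} {T : Set (Space d)} (hT : MeasurableSet T)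
    {u : Space d → ℝ} (hu : Measurable u) (r : ℝ) :
    Measurable fun x => ∫ y in T ∩ Metric.ball x r, u y := by
  have hS : MeasurableSet {q : Space d × Space d | q.2 ∈ T ∧ dist q.2 q.1 < r} :=
    (measurable_snd hT).inter (measurableSet_lt (measurable_snd.dist measurable_fst)
      measurable_const)
  have hm : Measurable ({q : Space d × Space d | q.2 ∈ T ∧ dist q.2 q.1 < r}.indicator
      fun q => u q.2) := (hu.comp measurable_snd).indicator hS
  have := (hm.stronglyMeasurable.integral_prod_right' (ν := volume)).measurable
  convert this using 2 with x
  rw [← integral_indicator (hT.inter Metric.isOpen_ball.measurableSet)]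
  refine integral_congr_ae (Eventually.of_forall fun y => ?_)
  change (T ∩ Metric.ball x r).indicator u y
    = {q : Space d × Space d | q.2 ∈ T ∧ dist q.2 q.1 < r}.indicator (fun q => u q.2) (x, y)
  by_cases h : y ∈ T ∧ dist y x < r
  · rw [Set.indicator_of_mem (show y ∈ T ∩ Metric.ball x r from h), Set.indicator_of_mem
      (show (x, y) ∈ {q : Space d × Space d | q.2 ∈ T ∧ dist q.2 q.1 < r} from h)]
  · rw [Set.indicator_of_notMem (show y ∉ T ∩ Metric.ball x r from h), Set.indicator_of_notMem
      (show (x, y) ∉ {q : Space d × Space d | q.2 ∈ T ∧ dist q.2 q.1 < r} from h)]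

theorem aemeasurable_trace {d : ℕ} {T : Set (Space d)} (hT : MeasurableSet T)
    {u : Space d → ℝ} (hu : Measurable u) {ν : Measure (Space d)}
    (h : ∀ᵐ x ∂ν, ∃ l, Tendsto (fun r => ⨍ y in T ∩ Metric.ball x r, u y) (𝓝[>] 0) (𝓝 l)) :
    AEMeasurable (trace T u) ν := by
  have hseq : Tendsto (fun j : ℕ => (1 / 4 : ℝ) ^ j) atTop (𝓝[>] 0) :=
    tendsto_nhdsWithin_iff.2 ⟨tendsto_pow_atTop_nhds_zero_of_lt_one (by norm_num) (by norm_num),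
      Eventually.of_forall fun j => by simp⟩
  refine aemeasurable_of_tendsto_metrizable_ae (u := atTop)
    (f := fun (j : ℕ) x => ⨍ y in T ∩ Metric.ball x ((1 / 4 : ℝ) ^ j), u y) (fun j => ?_) ?_
  · simp only [setAverage_eq, smul_eq_mul]
    refine Measurable.aemeasurable (Measurable.mul (Measurable.inv ?_)
      (measurable_setIntegral_inter_ball hT hu _))
    have := measurable_setIntegral_inter_ball hT (u := fun _ => (1 : ℝ)) measurable_const
      ((1 / 4 : ℝ) ^ j)
    simpa using this
  · filter_upwards [h] with x hx
    obtain ⟨l, hl⟩ := hx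
    rw [tendsto_trace hl]
    exact hl.comp hseq

theorem average_inter_ball_congr {d : ℕ} {T : Set (Space d)} {u u' : Space d → ℝ}
    (h : u =ᵐ[volume.restrict T] u') (x : Space d) (r : ℝ) :
    ⨍ y in T ∩ Metric.ball x r, u y = ⨍ y in T ∩ Metric.ball x r, u' y := by
  simp only [setAverage_eq]
  congr 1
  exact integral_congr_ae (ae_restrict_of_ae_restrict_of_subset Set.inter_subset_left h)

theorem trace_congr {d : ℕ} {T : Set (Space d)} {u u' : Space d → ℝ}
    (h : u =ᵐ[volume.restrict T] u') : trace T u = trace T u' := by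
  funext x
  unfold trace
  simp only [average_inter_ball_congr h]

/-! ### Polynomials as functions -/

namespace Poly

variable {d : ℕ}

theorem val_add (p q : Poly d) (x : Space d) : (p + q).val x = p.val x + q.val x := by
  simp [Poly.val]

theorem val_sub (p q : Poly d) (x : Space d) : Poly.val (p - q) x = p.val x - q.val x := by
  simp [Poly.val]

theorem val_smul (a : ℝ) (p : Poly d) (x : Space d) : Poly.val (a • p) x = a * p.val x := by
  simp [Poly.val]

theorem val_zero (x : Space d) : Poly.val (0 : Poly d) x = 0 := by
  simp [Poly.val]

theorem val_sum {ι : Type*} (s : Finset ι) (f : ι → Poly d) (x : Space d) :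
    Poly.val (∑ i ∈ s, f i) x = ∑ i ∈ s, (f i).val x := by
  simp [Poly.val, map_sum]

theorem contDiff_val (p : Poly d) : ContDiff ℝ ∞ p.val := by
  induction p using MvPolynomial.induction_on with
  | C a =>
    have : Poly.val (MvPolynomial.C a : Poly d) = fun _ => a := by ext x; simp [Poly.val]
    rw [this]
    exact contDiff_const
  | add p q hp hq =>
    have : Poly.val (p + q) = fun x => Poly.val p x + Poly.val q x := by ext x; simp [Poly.val]
    rw [this]
    exact hp.add hq
  | mul_X p i hp =>
    have : Poly.val (p * MvPolynomial.X i) = fun x => Poly.val p x * x i := by ext x; simp [Poly.val]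
    rw [this]
    exact hp.mul (EuclideanSpace.proj (𝕜 := ℝ) i).contDiff

theorem continuous_val (p : Poly d) : Continuous p.val := (contDiff_val p).continuous

theorem differentiable_val (p : Poly d) : Differentiable ℝ p.val :=
  (contDiff_val p).differentiable (by simp)

theorem partialDeriv_val (p : Poly d) (i : Fin d) :
    partialDeriv i p.val = Poly.val (MvPolynomial.pderiv i p) := by
  induction p using MvPolynomial.induction_on with
  | C a =>
    have : Poly.val (MvPolynomial.C a : Poly d) = fun _ => a := by ext x; simp [Poly.val]
    ext x
    rw [this]
    simp [partialDeriv, Poly.val]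
  | add p q hp hq =>
    have : Poly.val (p + q) = Poly.val p + Poly.val q := by ext x; simp [Poly.val]
    ext x
    rw [map_add, val_add, ← hp, ← hq, this]
    simp [partialDeriv, fderiv_add (differentiable_val p x) (differentiable_val q x)]
  | mul_X p j hp =>
    have e : Poly.val (p * MvPolynomial.X j)
        = Poly.val p * fun x => EuclideanSpace.proj (𝕜 := ℝ) j x := by
      ext x
      simp [Poly.val]
    ext x
    have hj : DifferentiableAt ℝ (fun x : Space d => EuclideanSpace.proj (𝕜 := ℝ) j x) x :=
      (EuclideanSpace.proj (𝕜 := ℝ) j).differentiableAt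
    have hf : fderiv ℝ (fun x : Space d => EuclideanSpace.proj (𝕜 := ℝ) j x) x
        = EuclideanSpace.proj j := (EuclideanSpace.proj (𝕜 := ℝ) j).fderiv
    have hpx := congrFun hp x
    unfold partialDeriv at hpx
    unfold partialDeriv
    rw [e, fderiv_mul (differentiable_val p x) hj, hf]
    simp only [add_apply, smul_apply, hpx, smul_eq_mul]
    rw [Derivation.leibniz, MvPolynomial.pderiv_X]
    by_cases hij : i = j
    · subst hij
      simp [Poly.val, mul_comm]
    · have hji : j ≠ i := Ne.symm hij
      simp [Poly.val, hji, mul_comm]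

/-- Since the test function vanishes outside `Ω`, the integration by parts takes place on the whole
space, and `Ω` may be any set. -/
theorem hasWeakGrad_val (p : Poly d) {Ω : Set (Space d)} :
    HasWeakGrad Ω p.val fun i => Poly.val (MvPolynomial.pderiv i p) := by
  intro i φ hφ hc hs
  have hdc : Continuous (partialDeriv i φ) :=
    (hφ.continuous_fderiv (by simp)).clm_apply continuous_const
  have hds : HasCompactSupport (partialDeriv i φ) := hc.fderiv_apply (𝕜 := ℝ) _
  have z1 : ∀ x, x ∉ Ω → p.val x * partialDeriv i φ x = 0 := by
    intro x hx
    have : x ∉ tsupport (partialDeriv i φ) := fun h =>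
      hx (hs (tsupport_fderiv_apply_subset ℝ _ h))
    rw [image_eq_zero_of_notMem_tsupport this, mul_zero]
  have z2 : ∀ x, x ∉ Ω → Poly.val (MvPolynomial.pderiv i p) x * φ x = 0 := by
    intro x hx
    rw [image_eq_zero_of_notMem_tsupport fun h => hx (hs h), mul_zero]
  rw [setIntegral_eq_integral_of_forall_compl_eq_zero z1,
    setIntegral_eq_integral_of_forall_compl_eq_zero z2]
  have e := partialDeriv_val p i
  rw [← e]
  refine integral_mul_fderiv_eq_neg_fderiv_mul_of_integrable ?_ ?_ ?_
    (fun x _ => differentiable_val p x) (fun x _ => (hφ.differentiable (by simp)) x)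
  · have h1 : Continuous fun x => partialDeriv i p.val x * φ x := by
      rw [e]
      exact (continuous_val _).mul hφ.continuous
    exact h1.integrable_of_hasCompactSupport hc.mul_left
  · exact ((continuous_val p).mul hdc).integrable_of_hasCompactSupport hds.mul_left
  · exact ((continuous_val p).mul hφ.continuous).integrable_of_hasCompactSupport hc.mul_left

theorem memLp_val (p : Poly d) {ν : Measure (Space d)} [IsFiniteMeasure ν] {s : Set (Space d)}
    (hs : Bornology.IsBounded s) (hν : ∀ᵐ x ∂ν, x ∈ s) : MemLp p.val 2 ν := by
  obtain ⟨R, hR⟩ := hs.subset_closedBall 0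
  obtain ⟨C, hC⟩ := (isCompact_closedBall (0 : Space d) R).exists_bound_of_continuousOn
    (continuous_val p).continuousOn
  refine MemLp.of_bound (continuous_val p).aestronglyMeasurable C ?_
  filter_upwards [hν] with x hx
  exact hC x (hR hx)

end Poly

theorem memLp_polyVal_restrict {d : ℕ} (p : Poly d) {s : Set (Space d)} (hsm : MeasurableSet s)
    (hs : Bornology.IsBounded s) : MemLp p.val 2 (volume.restrict s) := by
  have : IsFiniteMeasure (volume.restrict s) := ⟨by simpa using hs.measure_lt_top⟩
  exact p.memLp_val hs (ae_restrict_mem hsm)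

theorem HasWeakGrad.sub {d : ℕ} {Ω : Set (Space d)} {u v : Space d → ℝ} {g h : Fin d → Space d → ℝ}
    (hug : HasWeakGrad Ω u g) (hvh : HasWeakGrad Ω v h)
    (hu : IntegrableOn u Ω) (hv : IntegrableOn v Ω) (hg : ∀ i, IntegrableOn (g i) Ω)
    (hh : ∀ i, IntegrableOn (h i) Ω) :
    HasWeakGrad Ω (fun x => u x - v x) fun i x => g i x - h i x := by
  intro i φ hφ hc hs
  have hdc : Continuous (partialDeriv i φ) :=
    (hφ.continuous_fderiv (by simp)).clm_apply continuous_const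
  obtain ⟨C, hC⟩ := hc.exists_bound_of_continuous hφ.continuous
  obtain ⟨D, hD⟩ := (hc.fderiv_apply (𝕜 := ℝ) (EuclideanSpace.single i (1 : ℝ))).exists_bound_of_continuous
    hdc
  have b1 : ∀ {f : Space d → ℝ}, IntegrableOn f Ω →
      IntegrableOn (fun x => f x * partialDeriv i φ x) Ω := fun hf =>
    Integrable.mul_bdd (c := D) hf hdc.aestronglyMeasurable (Eventually.of_forall hD)
  have b2 : ∀ {f : Space d → ℝ}, IntegrableOn f Ω → IntegrableOn (fun x => f x * φ x) Ω := fun hf =>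
    Integrable.mul_bdd (c := C) hf hφ.continuous.aestronglyMeasurable (Eventually.of_forall hC)
  simp only [sub_mul]
  rw [integral_sub (b1 hu) (b1 hv), integral_sub (b2 (hg i)) (b2 (hh i)), hug i φ hφ hc hs,
    hvh i φ hφ hc hs]
  ring

/-! ### The trace estimate -/

theorem ofReal_integral_sq_eq {α : Type*} [MeasurableSpace α] {ν : Measure α} {f : α → ℝ}
    (hf : MemLp f 2 ν) : ENNReal.ofReal (∫ x, f x ^ 2 ∂ν) = ∫⁻ x, ‖f x‖ₑ ^ 2 ∂ν := by
  rw [ofReal_integral_eq_lintegral_ofReal hf.integrable_sq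
    (Eventually.of_forall fun x => sq_nonneg _)]
  simp only [enorm_sq_eq_ofReal]

theorem memLp_two_of_lintegral_ne_top {α : Type*} [MeasurableSpace α] {ν : Measure α} {f : α → ℝ}
    (hf : AEMeasurable f ν) (h : ∫⁻ x, ‖f x‖ₑ ^ 2 ∂ν ≠ ⊤) : MemLp f 2 ν := by
  refine ⟨hf.aestronglyMeasurable, ?_⟩
  rw [eLpNorm_lt_top_iff_lintegral_rpow_enorm_lt_top (by norm_num) (by norm_num)]
  simpa using lt_top_iff_ne_top.2 h

theorem tendsto_average_inter_ball {d : ℕ} {T : Set (Space d)} {n x : Space d} (hn : ‖n‖ = 1)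
    {r₀ : ℝ} (hr₀ : 0 < r₀) (h1 : ∀ y ∈ Metric.ball x r₀, inner ℝ n (y - x) < 0 → y ∈ T)
    (h2 : ∀ y ∈ Metric.ball x r₀, 0 < inner ℝ n (y - x) → y ∉ T) {f : Space d → ℝ}
    (hf : Continuous f) :
    Tendsto (fun r => ⨍ y in T ∩ Metric.ball x r, f y) (𝓝[>] 0) (𝓝 (f x)) := by
  obtain ⟨c, hc0, hc⟩ := exists_volume_halfBall_ge d
  rw [Metric.tendsto_nhds]
  intro ε hε
  obtain ⟨δ, hδ, hfδ⟩ := Metric.continuous_iff.1 hf x (ε / 2) (by positivity)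
  have hsm : ∀ᶠ s in 𝓝[>] (0 : ℝ), s < min r₀ δ :=
    mem_nhdsWithin_of_mem_nhds (Iio_mem_nhds (lt_min hr₀ hδ))
  filter_upwards [hsm, self_mem_nhdsWithin] with r hr hr0
  have hr0 : 0 < r := hr0
  rw [setAverage_congr (inter_ball_ae_eq_halfBall hn h1 h2 (hr.le.trans (min_le_left _ _)))]
  have hpos : volume (halfBall n x r) ≠ 0 :=
    ((ENNReal.ofReal_pos.2 (by positivity)).trans_le (hc n x r hn hr0)).ne'
  have hint : IntegrableOn f (halfBall n x r) :=
    (hf.continuousOn.integrableOn_compact (isCompact_closedBall x r)).mono_set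
      fun y hy => Metric.ball_subset_closedBall hy.1
  have hmem := (convex_closedBall (f x) (ε / 2)).set_average_mem Metric.isClosed_closedBall hpos
    (volume_halfBall_lt_top n x r).ne
    ((ae_restrict_iff' (isOpen_halfBall n x r).measurableSet).2 (Eventually.of_forall
      fun y hy => Metric.mem_closedBall.2 (hfδ y ((Metric.mem_ball.1 hy.1).trans
        (hr.trans_le (min_le_right _ _)))).le)) hint
  exact (Metric.mem_closedBall.1 hmem).trans_lt (by linarith)

/-- Removes the measurability assumptions by passing to Borel representatives, and replaces the
interior of `T` by `T`, whose frontier is null. The existence of the limits is kept in the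
conclusion because additivity of the trace depends on it. -/
theorem exists_trace_estimate {d : ℕ} (hd : 1 ≤ d) :
    ∃ C : ℝ, 0 < C ∧ ∀ (Ω T e : Set (Space d)) (n A : Space d) (η H : ℝ), MeasurableSet Ω →
      Bornology.IsBounded Ω → volume (frontier T) = 0 →
      IsPyramidFace Ω T e n A η H → ∀ (u : Space d → ℝ) (g : Fin d → Space d → ℝ),
      HasWeakGrad Ω u g → MemLp u 2 (volume.restrict Ω) →
      (∀ i, MemLp (g i) 2 (volume.restrict Ω)) →
      (∀ᵐ x ∂((surfaceMeasure d).restrict e),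
        ∃ l, Tendsto (fun r => ⨍ y in T ∩ Metric.ball x r, u y) (𝓝[>] 0) (𝓝 l)) ∧
      MemLp (trace T u) 2 ((surfaceMeasure d).restrict e) ∧
      ∫ x in e, trace T u x ^ 2 ∂(surfaceMeasure d)
        ≤ C / η * ((∫ z in T, u z ^ 2) + H ^ 2 * ∫ z in T, ∑ i, g i z ^ 2) := by
  obtain ⟨C, hC0, hC⟩ := exists_lintegral_trace_sq_le_of_measurable hd
  refine ⟨C, hC0, ?_⟩
  intro Ω T e n A η H hΩ hΩb hT0 he u g hug hu hg
  have hΩf : IsFiniteMeasure (volume.restrict Ω) := ⟨by simpa using hΩb.measure_lt_top⟩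
  have hui : IntegrableOn u Ω := hu.integrable one_le_two
  have hgi : ∀ i, IntegrableOn (g i) Ω := fun i => (hg i).integrable one_le_two
  set u' := hui.aemeasurable.mk u with hu'
  set g' : Fin d → Space d → ℝ := fun i => (hgi i).aemeasurable.mk (g i) with hg'
  have hum : Measurable u' := hui.aemeasurable.measurable_mk
  have hgm : ∀ i, Measurable (g' i) := fun i => (hgi i).aemeasurable.measurable_mk
  have eu : u =ᵐ[volume.restrict Ω] u' := hui.aemeasurable.ae_eq_mk
  have eg : ∀ i, g i =ᵐ[volume.restrict Ω] g' i := fun i => (hgi i).aemeasurable.ae_eq_mk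
  have hrestr : volume.restrict (interior T) = volume.restrict T := by
    refine Measure.restrict_congr_set ?_
    refine (interior_subset.eventuallyLE).antisymm ?_
    have := measure_eq_zero_iff_ae_notMem.1 hT0
    filter_upwards [this] with x hx hxT
    by_contra hxi
    exact hx ⟨subset_closure hxT, hxi⟩
  have euT : u =ᵐ[volume.restrict T] u' := by
    rw [← hrestr]
    exact ae_restrict_of_ae_restrict_of_subset he.interior_subset eu
  have egT : ∀ i, g i =ᵐ[volume.restrict T] g' i := by
    intro i
    rw [← hrestr]
    exact ae_restrict_of_ae_restrict_of_subset he.interior_subset (eg i)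
  have huT : MemLp u 2 (volume.restrict T) := by
    rw [← hrestr]
    exact hu.mono_measure (Measure.restrict_mono he.interior_subset le_rfl)
  have hgT : ∀ i, MemLp (g i) 2 (volume.restrict T) := by
    intro i
    rw [← hrestr]
    exact (hg i).mono_measure (Measure.restrict_mono he.interior_subset le_rfl)
  have hu2 : ∫⁻ z in T, ‖u' z‖ₑ ^ 2 = ENNReal.ofReal (∫ z in T, u z ^ 2) := by
    rw [ofReal_integral_sq_eq huT]
    exact lintegral_congr_ae (euT.mono fun x hx => by simp only [hx])
  have hg2 : ∫⁻ z in T, ∑ i, ‖g' i z‖ₑ ^ 2 = ENNReal.ofReal (∫ z in T, ∑ i, g i z ^ 2) := by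
    rw [ofReal_integral_eq_lintegral_ofReal
      (integrable_finsetSum _ fun i _ => (hgT i).integrable_sq)
      (Eventually.of_forall fun x => Finset.sum_nonneg fun i _ => sq_nonneg _)]
    have : ∀ᵐ z ∂(volume.restrict T), ∀ i, g i z = g' i z := ae_all_iff.2 egT
    refine lintegral_congr_ae (this.mono fun z hz => ?_)
    simp only [hz]
    rw [ENNReal.ofReal_sum_of_nonneg fun i _ => sq_nonneg _]
    simp only [enorm_sq_eq_ofReal]
  have hfin : ∫⁻ z in interior T, ∑ i, ‖g' i z‖ₑ ^ 2 ≠ ⊤ := by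
    rw [hrestr, hg2]
    exact ENNReal.ofReal_ne_top
  have hug' := hug.congr_ae eu eg
  have hlim' := ae_exists_tendsto_average hd hΩ he hug' (hui.congr eu)
    (fun i => (hgi i).congr (eg i)) hgm hfin
  have hbd := hC Ω T e n A η H hΩ he u' g' hug' (hui.congr eu) (fun i => (hgi i).congr (eg i))
    hum hgm hfin
  rw [hrestr, hu2, hg2, ← ENNReal.ofReal_mul (sq_nonneg H),
    ← ENNReal.ofReal_add (integral_nonneg fun x => sq_nonneg _)
      (mul_nonneg (sq_nonneg _) (integral_nonneg fun x => Finset.sum_nonneg fun i _ =>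
        sq_nonneg _)), ← ENNReal.ofReal_mul (div_nonneg hC0.le he.height_pos.le)] at hbd
  have hae := aemeasurable_trace he.isCompact_elem.measurableSet hum hlim'
  rw [← trace_congr euT] at hbd hae
  have hmem := memLp_two_of_lintegral_ne_top hae (ne_top_of_le_ne_top ENNReal.ofReal_ne_top hbd)
  refine ⟨?_, hmem, ?_⟩
  · simpa only [average_inter_ball_congr euT] using hlim'
  · rw [← ofReal_integral_sq_eq hmem] at hbd
    refine (ENNReal.ofReal_le_ofReal_iff ?_).1 hbd
    refine mul_nonneg (div_nonneg hC0.le he.height_pos.le) (add_nonneg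
      (integral_nonneg fun x => sq_nonneg _) (mul_nonneg (sq_nonneg _)
        (integral_nonneg fun x => Finset.sum_nonneg fun i _ => sq_nonneg _)))

/-- A limit is additive only where it exists: the averages of `u` converge by assumption, those of
the continuous `f` converge to `f x` because `T` is locally a half ball. This lets the trace
inequality for `u - p` be used for the error of `Q_b`. -/
theorem IsPyramidFace.trace_sub {d : ℕ} {Ω T e : Set (Space d)} {n A : Space d} {η H : ℝ}
    (he : IsPyramidFace Ω T e n A η H) {u : Space d → ℝ} (hu : IntegrableOn u T)
    (hlim : ∀ᵐ x ∂((surfaceMeasure d).restrict e),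
      ∃ l, Tendsto (fun r => ⨍ y in T ∩ Metric.ball x r, u y) (𝓝[>] 0) (𝓝 l))
    {f : Space d → ℝ} (hf : Continuous f) :
    ∀ᵐ x ∂((surfaceMeasure d).restrict e), trace T (fun y => u y - f y) x = trace T u x - f x := by
  have hloc := (ae_restrict_iff' he.isCompact.measurableSet).2 he.ae_local
  filter_upwards [hlim, hloc] with x hx hxl
  obtain ⟨l, hl⟩ := hx
  obtain ⟨r₀, hr₀, h1, h2, -⟩ := hxl
  have h3 := tendsto_average_inter_ball he.unit hr₀ h1 h2 hf
  have h4 := hl.sub h3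
  rw [tendsto_trace hl]
  refine tendsto_trace (h4.congr fun r => ?_)
  have hfT : IntegrableOn f (T ∩ Metric.ball x r) :=
    (hf.continuousOn.integrableOn_compact he.isCompact_elem).mono_set Set.inter_subset_left
  simp only [setAverage_eq, ← smul_sub]
  rw [integral_sub (hu.mono_set Set.inter_subset_left) hfT]

/-! ### Projections onto polynomials -/

/-- The polynomials of total degree at most `k`. -/
abbrev PolyLE (d k : ℕ) : Submodule ℝ (Poly d) := MvPolynomial.restrictTotalDegree (Fin d) ℝ k

/-- Orthogonal projection in `L²` onto the image of the finite-dimensional space of polynomials. On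
a face the map from polynomials in `d` variables to `L²` may fail to be injective, but only
existence of `P` is needed. -/
theorem exists_isL2Proj {d : ℕ} {m : Measure (Space d)} (hpoly : ∀ p : Poly d, MemLp p.val 2 m)
    (k : ℕ) {u : Space d → ℝ} (hu : MemLp u 2 m) : ∃ P, IsL2Proj m k u P := by
  let ι : PolyLE d k →ₗ[ℝ] Lp ℝ 2 m :=
    { toFun := fun p => (hpoly p).toLp
      map_add' := fun p q => by
        rw [← MemLp.toLp_add]
        exact MemLp.toLp_congr _ _ (Eventually.of_forall fun x => Poly.val_add _ _ x)
      map_smul' := fun a p => by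
        rw [RingHom.id_apply, ← MemLp.toLp_const_smul]
        exact MemLp.toLp_congr _ _ (Eventually.of_forall fun x => Poly.val_smul _ _ x) }
  obtain ⟨P, hP⟩ := (LinearMap.range ι).starProjection_apply_mem hu.toLp
  refine ⟨P, (MvPolynomial.mem_restrictTotalDegree _ _ _).1 P.2, fun w hw => ?_⟩
  have h := (LinearMap.range ι).starProjection_inner_eq_zero hu.toLp (ι ⟨w, (MvPolynomial.mem_restrictTotalDegree _ _ _).2 hw⟩)
    ⟨_, rfl⟩
  rw [← hP, inner_sub_left, sub_eq_zero, L2.inner_def, L2.inner_def] at h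
  have e1 : ∀ f (hf : MemLp f 2 m), ∫ x, inner ℝ ((hf.toLp f : Lp ℝ 2 m) x) (((hpoly w).toLp _ : Lp ℝ 2 m) x) ∂m
      = ∫ x, f x * w.val x ∂m := by
    intro f hf
    refine integral_congr_ae ?_
    filter_upwards [hf.coeFn_toLp, (hpoly w).coeFn_toLp] with x h1 h2
    rw [h1, h2]
    simp [mul_comm]
  have h' := (e1 u hu).symm.trans (h.trans (e1 _ (hpoly P)))
  exact h'.symm

theorem exists_l2Proj_eq {d : ℕ} {m : Measure (Space d)} (hpoly : ∀ p : Poly d, MemLp p.val 2 m)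
    (k : ℕ) {u : Space d → ℝ} (hu : MemLp u 2 m) :
    ∃ P, IsL2Proj m k u P ∧ l2Proj m k u = P.val := by
  have h := exists_isL2Proj hpoly k hu
  refine ⟨h.choose, h.choose_spec, ?_⟩
  unfold l2Proj
  rw [dif_pos h]

/-- Pythagoras: `u - P` is orthogonal to `P - w`. -/
theorem IsL2Proj.integral_sub_sq_le {d : ℕ} {m : Measure (Space d)}
    (hpoly : ∀ p : Poly d, MemLp p.val 2 m) {k : ℕ} {u : Space d → ℝ} {P : Poly d} (hP : IsL2Proj m k u P)
    (hu : MemLp u 2 m) {w : Poly d} (hw : w.totalDegree ≤ k) :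
    ∫ x, (u x - P.val x) ^ 2 ∂m ≤ ∫ x, (u x - w.val x) ^ 2 ∂m := by
  have h0 := hP.2 (P - w) ((MvPolynomial.totalDegree_sub _ _).trans (max_le hP.1 hw))
  have i1 : Integrable (fun x => P.val x * Poly.val (P - w) x) m :=
    (hpoly P).integrable_mul (hpoly (P - w))
  have i2 : Integrable (fun x => u x * Poly.val (P - w) x) m :=
    hu.integrable_mul (hpoly (P - w))
  have i3 : Integrable (fun x => (u x - P.val x) ^ 2) m := (hu.sub (hpoly P)).integrable_sq
  have i4 : Integrable (fun x => Poly.val (P - w) x ^ 2) m := (hpoly (P - w)).integrable_sq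
  have e : ∀ x, (u x - w.val x) ^ 2 = (u x - P.val x) ^ 2
      + 2 * (u x * Poly.val (P - w) x - P.val x * Poly.val (P - w) x) + Poly.val (P - w) x ^ 2 := by
    intro x
    rw [Poly.val_sub]
    ring
  simp_rw [e]
  have i5 : Integrable (fun x =>
      2 * (u x * Poly.val (P - w) x - P.val x * Poly.val (P - w) x)) m := (i2.sub i1).const_mul 2
  rw [integral_add (f := fun x => (u x - P.val x) ^ 2
      + 2 * (u x * Poly.val (P - w) x - P.val x * Poly.val (P - w) x)) (i3.add i5) i4,
    integral_add i3 i5, integral_const_mul, integral_sub i2 i1, h0, sub_self, mul_zero, add_zero]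
  exact le_add_of_nonneg_right (integral_nonneg fun x => sq_nonneg _)

/-! ### Inverse estimates for polynomials -/

namespace Poly

variable {d : ℕ}

/-- The polynomial `x ↦ p (c + s x)`. -/
def substAffine (c : Space d) (s : ℝ) (p : Poly d) : Poly d :=
  MvPolynomial.bind₁ (fun i => MvPolynomial.C (c i) + MvPolynomial.C s * MvPolynomial.X i) p

theorem val_substAffine (c : Space d) (s : ℝ) (p : Poly d) (x : Space d) :
    (substAffine c s p).val x = p.val (c + s • x) := by
  unfold substAffine Poly.val
  rw [MvPolynomial.eval, MvPolynomial.eval₂Hom_bind₁]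
  congr 2
  ext i
  simp

theorem totalDegree_substAffine_le (c : Space d) (s : ℝ) (p : Poly d) :
    (substAffine c s p).totalDegree ≤ p.totalDegree := by
  unfold substAffine
  conv_lhs => rw [p.as_sum, map_sum]
  refine MvPolynomial.totalDegree_finsetSum_le fun α hα => ?_
  rw [MvPolynomial.bind₁_monomial]
  refine (MvPolynomial.totalDegree_mul _ _).trans ?_
  rw [MvPolynomial.totalDegree_C, zero_add]
  refine (MvPolynomial.totalDegree_finsetProd _ _).trans ?_
  refine le_trans ?_ (MvPolynomial.le_totalDegree hα)
  refine Finset.sum_le_sum fun i _ => (MvPolynomial.totalDegree_pow _ _).trans ?_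
  refine (Nat.mul_le_mul_left _ ?_).trans (mul_one _).le
  refine (MvPolynomial.totalDegree_add _ _).trans (max_le (by simp) ?_)
  refine (MvPolynomial.totalDegree_mul _ _).trans ?_
  simp

theorem val_pderiv_substAffine (c : Space d) (s : ℝ) (p : Poly d) (i : Fin d) (x : Space d) :
    Poly.val (MvPolynomial.pderiv i (substAffine c s p)) x
      = s * Poly.val (MvPolynomial.pderiv i p) (c + s • x) := by
  rw [← partialDeriv_val, ← partialDeriv_val]
  have e : (substAffine c s p).val = fun x => p.val (c + s • x) :=
    funext fun x => val_substAffine c s p x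
  have h : HasFDerivAt (fun x : Space d => c + s • x) (s • ContinuousLinearMap.id ℝ (Space d)) x :=
    ((hasFDerivAt_id x).const_smul s).const_add c
  have h2 := (differentiable_val p (c + s • x)).hasFDerivAt.comp x h
  unfold partialDeriv
  rw [e]
  erw [h2.fderiv]
  simp

theorem finite_setOf_val_line_eq_zero {p : Poly d} {z : Space d} (hz : p.val z ≠ 0) (x : Space d) :
    {t : ℝ | p.val (z + t • x) = 0}.Finite := by
  set q : Polynomial ℝ := MvPolynomial.aeval
    (fun i => Polynomial.C (z i) + Polynomial.C (x i) * Polynomial.X) p with hq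
  have hv : ∀ t, q.eval t = p.val (z + t • x) := by
    intro t
    rw [hq, MvPolynomial.aeval_def, MvPolynomial.polynomial_eval_eval₂]
    unfold Poly.val
    rw [MvPolynomial.eval, MvPolynomial.coe_eval₂Hom]
    congr 1
    · ext a
      simp
    · ext i
      simp only [Polynomial.eval_add, Polynomial.eval_mul, Polynomial.eval_C, Polynomial.eval_X,
        PiLp.add_apply, PiLp.smul_apply, smul_eq_mul]
      ring
  have hq0 : q ≠ 0 := by
    intro h
    apply hz
    have := hv 0
    rw [h] at this
    simpa using this.symm
  refine (q.roots.toFinset.finite_toSet).subset fun t ht => ?_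
  have ht' : p.val (z + t • x) = 0 := ht
  simp [hq0, hv, ht']

/-- On every line through a point `z` with `p z ≠ 0` there are finitely many zeros. By Fubini's
theorem some `t ≠ 0` has `p(z + t x) ≠ 0` for almost every `x`, and `x ↦ z + t x` preserves null
sets. -/
theorem ae_val_ne_zero {p : Poly d} (hp : p ≠ 0) : ∀ᵐ x : Space d, p.val x ≠ 0 := by
  obtain ⟨z, hz⟩ : ∃ z : Space d, p.val z ≠ 0 := by
    by_contra! h
    refine hp (MvPolynomial.funext fun x => ?_)
    rw [map_zero]
    exact h (WithLp.toLp 2 x)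
  have hm : MeasurableSet {q : Space d × ℝ | p.val (z + q.2 • q.1) ≠ 0} := by
    refine (IsOpen.measurableSet ?_)
    exact isOpen_ne.preimage (p.continuous_val.comp (by fun_prop))
  have h1 : ∀ᵐ x : Space d, ∀ᵐ t : ℝ, p.val (z + t • x) ≠ 0 := by
    refine Eventually.of_forall fun x => ?_
    have := (finite_setOf_val_line_eq_zero hz x).measure_zero volume
    rw [ae_iff]
    simpa using this
  have h2 := (Measure.ae_ae_comm hm).1 h1
  obtain ⟨t, ht, ht0⟩ := (h2.and (Measure.ae_ne volume (0 : ℝ))).exists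
  have hmp : Measure.QuasiMeasurePreserving (fun y : Space d => t⁻¹ • (-z + y)) volume volume :=
    (Measure.quasiMeasurePreserving_smul volume (inv_ne_zero ht0)).comp
      (measurePreserving_add_left volume (-z)).quasiMeasurePreserving
  filter_upwards [hmp.ae ht] with y hy
  have : z + t • t⁻¹ • (-z + y) = y := by rw [smul_inv_smul₀ ht0]; abel
  rwa [this] at hy

/-- The sublevel sets decrease to the zero set, which is null; continuity of the measure from above.
-/
theorem exists_volume_setOf_abs_val_le {p : Poly d} (hp : p ≠ 0) {ρ : ℝ} (hρ : 0 < ρ) :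
    ∃ ε : ℝ, 0 < ε ∧
      volume {x | x ∈ Metric.closedBall (0 : Space d) 1 ∧ |p.val x| ≤ ε} ≤ ENNReal.ofReal ρ := by
  have hc : ∀ r, IsClosed {x | x ∈ Metric.closedBall (0 : Space d) 1 ∧ |p.val x| ≤ r} := fun r =>
    Metric.isClosed_closedBall.inter (isClosed_le p.continuous_val.abs continuous_const)
  have h := tendsto_measure_biInter_gt (μ := (volume : Measure (Space d))) (a := (0 : ℝ))
    (s := fun r => {x | x ∈ Metric.closedBall (0 : Space d) 1 ∧ |p.val x| ≤ r})
    (fun r _ => (hc r).measurableSet.nullMeasurableSet)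
    (fun i j _ hij x hx => ⟨hx.1, hx.2.trans hij⟩)
    ⟨1, one_pos, ((measure_mono fun x hx => hx.1).trans_lt measure_closedBall_lt_top).ne⟩
  have h0 : volume (⋂ r > (0 : ℝ), {x | x ∈ Metric.closedBall (0 : Space d) 1 ∧ |p.val x| ≤ r})
      = 0 := by
    refine measure_mono_null (t := {x | ¬ p.val x ≠ 0}) (fun x hx => ?_) (ae_val_ne_zero hp)
    simp only [Set.mem_iInter] at hx
    have h0 : |p.val x| ≤ 0 := le_of_forall_gt_imp_ge_of_dense fun r hr => (hx r hr).2
    simpa using h0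
  rw [h0] at h
  have hev := h.eventually (gt_mem_nhds (ENNReal.ofReal_pos.2 hρ))
  obtain ⟨ε, hε, hε0⟩ := (hev.and self_mem_nhdsWithin).exists
  exact ⟨ε, hε0, hε.le⟩

/-- Remez inequality on the unit ball, with a bound of the gradient. -/
theorem exists_sq_add_gradSq_le_unit (d R : ℕ) {ρ : ℝ} (hρ : 0 < ρ) :
    ∃ C : ℝ, 0 < C ∧ ∀ T : Set (Space d), MeasurableSet T → T ⊆ Metric.closedBall 0 1 →
      ENNReal.ofReal ρ ≤ volume T → ∀ p : Poly d, p.totalDegree ≤ R →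
      ∀ x ∈ Metric.closedBall (0 : Space d) 1,
        p.val x ^ 2 + ∑ j, Poly.val (MvPolynomial.pderiv j p) x ^ 2
          ≤ C * ∫ y in T, p.val y ^ 2 := by
  set V := MvPolynomial.restrictTotalDegree (Fin d) ℝ R
  set n := Module.finrank ℝ V
  set b := Module.finBasis ℝ V
  set B := Metric.closedBall (0 : Space d) 1
  set P : (Fin n → ℝ) → Poly d := fun a => ((∑ i, a i • b i : V) : Poly d) with hP
  have hPv : ∀ a x, (P a).val x = ∑ i, a i * Poly.val (b i : Poly d) x := by
    intro a x
    simp only [hP, Submodule.coe_sum, Submodule.coe_smul, val_sum, val_smul]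
  have hPd : ∀ a j x, Poly.val (MvPolynomial.pderiv j (P a)) x
      = ∑ i, a i * Poly.val (MvPolynomial.pderiv j (b i : Poly d)) x := by
    intro a j x
    simp only [hP, Submodule.coe_sum, Submodule.coe_smul, map_sum, val_sum]
    exact Finset.sum_congr rfl fun i _ => by rw [Derivation.map_smul, val_smul]
  obtain ⟨M₀, hM₀⟩ := (isCompact_closedBall (0 : Space d) 1).exists_bound_of_continuousOn
    (f := fun x => ∑ i, (|Poly.val (b i : Poly d) x|
      + ∑ j, |Poly.val (MvPolynomial.pderiv j (b i : Poly d)) x|))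
    (by
      refine Continuous.continuousOn (continuous_finsetSum _ fun i _ => ?_)
      exact (continuous_val _).abs.add
        (continuous_finsetSum _ fun j _ => (continuous_val _).abs))
  set M := max M₀ 1
  have hM : ∀ x ∈ B, ∑ i, (|Poly.val (b i : Poly d) x|
      + ∑ j, |Poly.val (MvPolynomial.pderiv j (b i : Poly d)) x|) ≤ M := fun x hx =>
    (le_abs_self _).trans ((hM₀ x hx).trans (le_max_left _ _))
  have hM1 : 0 < M := one_pos.trans_le (le_max_right _ _)
  have hup : ∀ (a : Fin n → ℝ) (f : Fin n → ℝ) (x) (hx : x ∈ B),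
      (∀ i, |f i| ≤ |Poly.val (b i : Poly d) x|
        + ∑ j, |Poly.val (MvPolynomial.pderiv j (b i : Poly d)) x|) →
      |∑ i, a i * f i| ≤ ‖a‖ * M := by
    intro a f x hx hf
    refine (Finset.abs_sum_le_sum_abs _ _).trans ?_
    refine le_trans ?_ (mul_le_mul_of_nonneg_left (hM x hx) (norm_nonneg a))
    rw [Finset.mul_sum]
    refine Finset.sum_le_sum fun i _ => ?_
    rw [abs_mul]
    exact mul_le_mul (norm_le_pi_norm a i) (hf i) (abs_nonneg _) (norm_nonneg _)
  have hup0 : ∀ a, ∀ x ∈ B, |(P a).val x| ≤ ‖a‖ * M := by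
    intro a x hx
    rw [hPv]
    exact hup a _ x hx fun i =>
      le_add_of_nonneg_right (Finset.sum_nonneg fun j _ => abs_nonneg _)
  have hup1 : ∀ a j, ∀ x ∈ B, |Poly.val (MvPolynomial.pderiv j (P a)) x| ≤ ‖a‖ * M := by
    intro a j x hx
    rw [hPd]
    refine hup a _ x hx fun i => le_add_of_nonneg_of_le (abs_nonneg _) ?_
    exact Finset.single_le_sum
      (f := fun j => |Poly.val (MvPolynomial.pderiv j (b i : Poly d)) x|)
      (fun j _ => abs_nonneg _) (Finset.mem_univ j)
  have hne : ∀ a, a ≠ 0 → P a ≠ 0 := by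
    intro a ha h0
    have h1 : ∑ i, a i • b i = 0 := Subtype.ext h0
    exact ha (funext fun i => (Fintype.linearIndependent_iff.1 b.linearIndependent) a h1 i)
  -- One `ε` serves all coefficient vectors of norm one: a change of the coefficients by less than
  -- `ε/(2M)` changes the values on the unit ball by at most `ε/2`, and the sphere is compact.
  obtain ⟨ε, hε, hsmall⟩ : ∃ ε : ℝ, 0 < ε ∧ ∀ a ∈ Metric.sphere (0 : Fin n → ℝ) 1,
      volume {x | x ∈ B ∧ |(P a).val x| ≤ ε} ≤ ENNReal.ofReal (ρ / 2) := by
    refine (isCompact_sphere (0 : Fin n → ℝ) 1).induction_on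
      (p := fun s => ∃ ε : ℝ, 0 < ε ∧ ∀ a ∈ s,
        volume {x | x ∈ B ∧ |(P a).val x| ≤ ε} ≤ ENNReal.ofReal (ρ / 2)) ?_ ?_ ?_ ?_
    · exact ⟨1, one_pos, fun a ha => absurd ha (Set.notMem_empty a)⟩
    · rintro s t hst ⟨ε, hε, h⟩
      exact ⟨ε, hε, fun a ha => h a (hst ha)⟩
    · rintro s t ⟨ε, hε, h⟩ ⟨ε', hε', h'⟩
      refine ⟨min ε ε', lt_min hε hε', ?_⟩
      rintro a (ha | ha)
      · refine le_trans (measure_mono ?_) (h a ha)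
        exact fun x hx => ⟨hx.1, hx.2.trans (min_le_left _ _)⟩
      · refine le_trans (measure_mono ?_) (h' a ha)
        exact fun x hx => ⟨hx.1, hx.2.trans (min_le_right _ _)⟩
    · intro a ha
      have ha0 : a ≠ 0 := by
        rintro rfl
        simp at ha
      obtain ⟨ε, hε, h⟩ := exists_volume_setOf_abs_val_le (hne a ha0) (half_pos hρ)
      refine ⟨Metric.ball a (ε / 2 / M), mem_nhdsWithin_of_mem_nhds
        (Metric.ball_mem_nhds a (by positivity)), ε / 2, by positivity, fun a' ha' => ?_⟩
      refine le_trans (measure_mono ?_) h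
      refine fun x hx => ⟨hx.1, ?_⟩
      have h1 : (P a).val x = (P a').val x - (P (a' - a)).val x := by
        simp only [hPv, ← Finset.sum_sub_distrib, Pi.sub_apply]
        exact Finset.sum_congr rfl fun i _ => by ring
      have h2 := hup0 (a' - a) x hx.1
      have h3 : ‖a' - a‖ * M ≤ ε / 2 := by
        rw [← le_div_iff₀ hM1, ← dist_eq_norm]
        exact (Metric.mem_ball.1 ha').le
      rw [h1]
      refine (abs_sub _ _).trans ?_
      linarith [hx.2]
  refine ⟨(M ^ 2 * (1 + d)) * (2 / (ε ^ 2 * ρ)), by positivity, ?_⟩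
  intro T hT hTB hvol p hp x hx
  set v : V := ⟨p, (MvPolynomial.mem_restrictTotalDegree _ _ _).2 hp⟩ with hv
  set a : Fin n → ℝ := fun i => b.repr v i with ha
  have hpa : p = P a := congrArg Subtype.val (b.sum_repr v).symm
  have hTf : volume T ≠ ⊤ := ((measure_mono hTB).trans_lt measure_closedBall_lt_top).ne
  -- The normalised polynomial is at most `ε` in modulus on a set of measure at most `ρ/2`, so `|p|
  -- > ‖a‖ ε` on a part of `T` of measure at least `ρ/2`, wherever `T` lies in the ball.
  have hlow : ‖a‖ ^ 2 * (ε ^ 2 * ρ / 2) ≤ ∫ y in T, p.val y ^ 2 := by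
    rcases eq_or_ne a 0 with h0 | h0
    · rw [h0, norm_zero]
      simpa using integral_nonneg fun x => sq_nonneg _
    have hna : 0 < ‖a‖ := norm_pos_iff.2 h0
    set S := {x | x ∈ T ∧ ‖a‖ * ε < |p.val x|} with hS
    have hsub : T ⊆ S ∪ {x | x ∈ B ∧ |(P (‖a‖⁻¹ • a)).val x| ≤ ε} := by
      intro y hy
      by_cases hyS : ‖a‖ * ε < |p.val y|
      · exact Or.inl ⟨hy, hyS⟩
      · refine Or.inr ⟨hTB hy, ?_⟩
        have h1 : (P (‖a‖⁻¹ • a)).val y = ‖a‖⁻¹ * (P a).val y := by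
          simp only [hPv, Pi.smul_apply, smul_eq_mul, Finset.mul_sum, mul_assoc]
        rw [h1, abs_mul, abs_of_pos (inv_pos.2 hna), inv_mul_le_iff₀ hna, ← hpa]
        exact not_lt.1 hyS
    have hSm : MeasurableSet S :=
      hT.inter (measurableSet_lt measurable_const p.continuous_val.measurable.abs)
    have hSf : volume S ≠ ⊤ := ne_top_of_le_ne_top hTf (measure_mono fun y hy => hy.1)
    have hSv : ρ / 2 ≤ volume.real S := by
      have h1 := hvol.trans ((measure_mono hsub).trans (measure_union_le _ _))
      have h2 := h1.trans (add_le_add le_rfl (hsmall _ (by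
        simp [norm_smul, hna.ne'])))
      rw [← ENNReal.ofReal_toReal hSf, ← ENNReal.ofReal_add ENNReal.toReal_nonneg (by positivity),
        ENNReal.ofReal_le_ofReal_iff (by positivity)] at h2
      rw [measureReal_def]
      linarith
    have hint : IntegrableOn (fun y => p.val y ^ 2) T :=
      ((p.continuous_val.pow 2).continuousOn.integrableOn_compact
        (isCompact_closedBall (0 : Space d) 1)).mono_set hTB
    calc ‖a‖ ^ 2 * (ε ^ 2 * ρ / 2) = (‖a‖ * ε) ^ 2 * (ρ / 2) := by ring
      _ ≤ (‖a‖ * ε) ^ 2 * volume.real S := by gcongr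
      _ = ∫ y in S, (‖a‖ * ε) ^ 2 := by simp [mul_comm]
      _ ≤ ∫ y in S, p.val y ^ 2 := by
          refine setIntegral_mono_on (integrableOn_const hSf)
            (hint.mono_set fun y hy => hy.1) hSm fun y hy => ?_
          rw [← sq_abs (p.val y)]
          have := hy.2
          gcongr
      _ ≤ ∫ y in T, p.val y ^ 2 :=
          setIntegral_mono_set hint (Eventually.of_forall fun y => sq_nonneg _)
            (Eventually.of_forall fun y hy => hy.1)
  have h1 : p.val x ^ 2 + ∑ j, Poly.val (MvPolynomial.pderiv j p) x ^ 2
      ≤ (‖a‖ * M) ^ 2 * (1 + d) := by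
    have h0 : p.val x ^ 2 ≤ (‖a‖ * M) ^ 2 := by
      rw [← sq_abs (p.val x), hpa]
      exact pow_le_pow_left₀ (abs_nonneg _) (hup0 a x hx) 2
    have h2 : ∑ j, Poly.val (MvPolynomial.pderiv j p) x ^ 2 ≤ ∑ _j : Fin d, (‖a‖ * M) ^ 2 := by
      refine Finset.sum_le_sum fun j _ => ?_
      rw [← sq_abs, hpa]
      exact pow_le_pow_left₀ (abs_nonneg _) (hup1 a j x hx) 2
    rw [Finset.sum_const, Finset.card_univ, Fintype.card_fin, nsmul_eq_mul] at h2
    linarith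
  refine h1.trans ?_
  calc (‖a‖ * M) ^ 2 * (1 + d)
      = (M ^ 2 * (1 + d)) * (2 / (ε ^ 2 * ρ)) * (‖a‖ ^ 2 * (ε ^ 2 * ρ / 2)) := by
        field_simp
    _ ≤ _ := by gcongr

end Poly

namespace Poly

/-- Remez inequality on balls of radius `H`, with a bound of the gradient. -/
theorem exists_sq_add_gradSq_le (d R : ℕ) {ρ : ℝ} (hρ : 0 < ρ) :
    ∃ C : ℝ, 0 < C ∧ ∀ (T : Set (Space d)) (x₀ : Space d) (H : ℝ), 0 < H → MeasurableSet T →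
      T ⊆ Metric.closedBall x₀ H → ENNReal.ofReal (ρ * H ^ d) ≤ volume T →
      ∀ p : Poly d, p.totalDegree ≤ R → ∀ x ∈ Metric.closedBall x₀ H,
        p.val x ^ 2 + H ^ 2 * ∑ j, Poly.val (MvPolynomial.pderiv j p) x ^ 2
          ≤ C / H ^ d * ∫ y in T, p.val y ^ 2 := by
  obtain ⟨C, hC, h⟩ := exists_sq_add_gradSq_le_unit d R hρ
  refine ⟨C, hC, ?_⟩
  intro T x₀ H hH hT hTB hvol p hp x hx
  have hcont : Continuous fun y : Space d => x₀ + H • y := by fun_prop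
  set T' := (fun y : Space d => x₀ + H • y) ⁻¹' T
  have hT' : MeasurableSet T' := hcont.measurable hT
  have hTB' : T' ⊆ Metric.closedBall 0 1 := by
    intro y hy
    have h1 := mem_closedBall_iff_norm.1 (hTB hy)
    rw [add_sub_cancel_left, norm_smul, Real.norm_of_nonneg hH.le] at h1
    rw [mem_closedBall_zero_iff]
    nlinarith
  have hvol' : ENNReal.ofReal ρ ≤ volume T' := by
    have h1 := lintegral_comp_affine (T.indicator 1) x₀ hH.ne'
    have h2 : ∀ y : Space d, T.indicator (1 : Space d → ℝ≥0∞) (x₀ + H • y) = T'.indicator 1 y :=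
      fun y => rfl
    simp_rw [h2] at h1
    rw [lintegral_indicator_one hT, lintegral_indicator_one hT', abs_of_pos (by positivity)] at h1
    rw [h1]
    refine le_trans ?_ (mul_le_mul_right hvol _)
    rw [← ENNReal.ofReal_mul (by positivity)]
    refine ENNReal.ofReal_le_ofReal (le_of_eq ?_)
    field_simp
  have hint : ∫ y in T', (substAffine x₀ H p).val y ^ 2 = (H ^ d)⁻¹ * ∫ y in T, p.val y ^ 2 := by
    rw [← integral_indicator hT, ← integral_indicator hT']
    have h1 := Measure.integral_comp_smul (volume : Measure (Space d))
      (fun y => T.indicator (fun y => p.val y ^ 2) (x₀ + y)) H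
    rw [integral_add_left_eq_self (fun y => T.indicator (fun y => p.val y ^ 2) y),
      finrank_euclideanSpace_fin, abs_of_pos (by positivity), smul_eq_mul] at h1
    rw [← h1]
    refine integral_congr_ae (Eventually.of_forall fun y => ?_)
    simp only [Set.indicator, val_substAffine]
    rfl
  have hx' : H⁻¹ • (x - x₀) ∈ Metric.closedBall (0 : Space d) 1 := by
    rw [mem_closedBall_zero_iff, norm_smul, norm_inv, Real.norm_of_nonneg hH.le,
      inv_mul_le_iff₀ hH, mul_one]
    exact mem_closedBall_iff_norm.1 hx
  have h3 := h T' hT' hTB' hvol' (substAffine x₀ H p)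
    ((totalDegree_substAffine_le _ _ _).trans hp) _ hx'
  simp only [val_substAffine, val_pderiv_substAffine] at h3
  rw [smul_inv_smul₀ hH.ne', add_sub_cancel] at h3
  simp only [val_substAffine] at hint
  rw [hint] at h3
  simp only [mul_pow, ← Finset.mul_sum] at h3
  refine h3.trans (le_of_eq ?_)
  field_simp

/-- The pointwise bound is integrated over `T`, whose volume is at most a multiple of `H^d`; no
regularity of the shape of `T` enters besides its volume and the ball containing it. -/
theorem exists_gradSq_integral_le (d R : ℕ) {ρ : ℝ} (hρ : 0 < ρ) :
    ∃ C : ℝ, 0 < C ∧ ∀ (T : Set (Space d)) (x₀ : Space d) (H : ℝ), 0 < H → MeasurableSet T →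
      T ⊆ Metric.closedBall x₀ H → ENNReal.ofReal (ρ * H ^ d) ≤ volume T →
      ∀ p : Poly d, p.totalDegree ≤ R → ∀ j,
        ∫ x in T, Poly.val (MvPolynomial.pderiv j p) x ^ 2 ≤ C / H ^ 2 * ∫ y in T, p.val y ^ 2 := by
  obtain ⟨C, hC, h⟩ := exists_sq_add_gradSq_le d R hρ
  set b := volume.real (Metric.closedBall (0 : Space d) 1)
  have hb : 0 < b := ENNReal.toReal_pos (Metric.measure_closedBall_pos _ _ one_pos).ne'
    measure_closedBall_lt_top.ne
  refine ⟨C * b, by positivity, ?_⟩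
  intro T x₀ H hH hT hTB hvol p hp j
  set I := ∫ y in T, p.val y ^ 2
  have hI : 0 ≤ I := integral_nonneg fun y => sq_nonneg _
  have h1 : ∀ x ∈ T, Poly.val (MvPolynomial.pderiv j p) x ^ 2 ≤ C / H ^ d * I / H ^ 2 := by
    intro x hx
    rw [le_div_iff₀ (by positivity), mul_comm]
    refine le_trans ?_ (h T x₀ H hH hT hTB hvol p hp x (hTB hx))
    refine le_add_of_nonneg_of_le (sq_nonneg _) ?_
    gcongr
    exact Finset.single_le_sum (f := fun j => Poly.val (MvPolynomial.pderiv j p) x ^ 2)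
      (fun j _ => sq_nonneg _) (Finset.mem_univ j)
  have hTf : volume T ≠ ⊤ := ((measure_mono hTB).trans_lt measure_closedBall_lt_top).ne
  have hTv : volume.real T ≤ H ^ d * b := by
    refine (measureReal_mono hTB measure_closedBall_lt_top.ne).trans (le_of_eq ?_)
    rw [measureReal_def, Measure.addHaar_closedBall' _ _ hH.le, ENNReal.toReal_mul,
      ENNReal.toReal_ofReal (by positivity), finrank_euclideanSpace_fin, ← measureReal_def]
  calc ∫ x in T, Poly.val (MvPolynomial.pderiv j p) x ^ 2
      ≤ ∫ x in T, C / H ^ d * I / H ^ 2 := by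
        refine setIntegral_mono_on ?_ (integrableOn_const hTf) hT h1
        exact ((continuous_val _).pow 2).continuousOn.integrableOn_compact
          (isCompact_closedBall x₀ H) |>.mono_set hTB
    _ = volume.real T * (C / H ^ d * I / H ^ 2) := by simp
    _ ≤ (H ^ d * b) * (C / H ^ d * I / H ^ 2) := by gcongr
    _ = C * b / H ^ 2 * I := by field_simp

/-- The pointwise bound of order `H^(-d)` meets a surface of area at most `b H^(d-1)`, which leaves
`H^(-1)`. -/
theorem exists_face_integral_sq_le {d : ℕ} (hd : 1 ≤ d) (R : ℕ) {ρ : ℝ} (hρ : 0 < ρ) :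
    ∃ C : ℝ, 0 < C ∧ ∀ (T : Set (Space d)) (x₀ : Space d) (H : ℝ), 0 < H → MeasurableSet T →
      T ⊆ Metric.closedBall x₀ H → ENNReal.ofReal (ρ * H ^ d) ≤ volume T →
      ∀ (e : Set (Space d)) (n : Space d) (c : ℝ), MeasurableSet e → e ⊆ T →
      e ⊆ hyperplane n c → ‖n‖ = 1 → ∀ p : Poly d, p.totalDegree ≤ R →
        ∫ x in e, p.val x ^ 2 ∂(surfaceMeasure d) ≤ C / H * ∫ y in T, p.val y ^ 2 := by
  obtain ⟨C, hC, h⟩ := exists_sq_add_gradSq_le d R hρ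
  obtain ⟨b, hb, hbs⟩ := exists_surfaceMeasure_inter_closedBall_le hd
  refine ⟨C * b, by positivity, ?_⟩
  intro T x₀ H hH hT hTB hvol e n c he heT hen hn p hp
  set I := ∫ y in T, p.val y ^ 2
  have hI : 0 ≤ I := integral_nonneg fun y => sq_nonneg _
  have h1 : ∀ x ∈ e, p.val x ^ 2 ≤ C / H ^ d * I := by
    intro x hx
    refine le_trans (le_add_of_nonneg_right ?_) (h T x₀ H hH hT hTB hvol p hp x (hTB (heT hx)))
    exact mul_nonneg (sq_nonneg _) (Finset.sum_nonneg fun j _ => sq_nonneg _)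
  have hev : surfaceMeasure d e ≤ ENNReal.ofReal (b * H ^ (d - 1)) :=
    (measure_mono (Set.subset_inter hen (heT.trans hTB))).trans (hbs n c x₀ H hn hH.le)
  have hef : surfaceMeasure d e ≠ ⊤ := ne_top_of_le_ne_top ENNReal.ofReal_ne_top hev
  have hev' : (surfaceMeasure d).real e ≤ b * H ^ (d - 1) :=
    ENNReal.toReal_le_of_le_ofReal (by positivity) hev
  have : IsFiniteMeasure ((surfaceMeasure d).restrict e) := ⟨by simpa using hef.lt_top⟩
  have hmem : MemLp p.val 2 ((surfaceMeasure d).restrict e) :=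
    p.memLp_val (Metric.isBounded_closedBall.subset (heT.trans hTB)) (ae_restrict_mem he)
  have hHd : H ^ d = H ^ (d - 1) * H := by rw [← pow_succ, Nat.sub_add_cancel hd]
  calc ∫ x in e, p.val x ^ 2 ∂(surfaceMeasure d)
      ≤ ∫ x in e, C / H ^ d * I ∂(surfaceMeasure d) :=
        setIntegral_mono_on hmem.integrable_sq (integrableOn_const hef) he h1
    _ = (surfaceMeasure d).real e * (C / H ^ d * I) := by simp
    _ ≤ (b * H ^ (d - 1)) * (C / H ^ d * I) := by gcongr
    _ = C * b / H * I := by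
        rw [hHd]
        field_simp

end Poly

/-! ### Overlap of enlarged elements -/

/-- If disjoint sets `E i` of volume at least `ρ (h i)^d` lie in balls of radius `h i`, then the sum
of the `h i`, over those `i` for which the enlarged ball `B(a i, C₁ h i)` contains a given point, is
bounded by the largest `h i`. -/
theorem exists_sum_radii_le (d : ℕ) {ρ C₁ : ℝ} (hρ : 0 < ρ) (hC₁ : 0 < C₁) :
    ∃ N : ℝ, 0 < N ∧ ∀ {ι : Type} (S : Finset ι) (E : ι → Set (Space d)) (a : ι → Space d)
      (h : ι → ℝ) (x : Space d) (s : ℝ), (∀ i ∈ S, 0 < h i ∧ h i ≤ s) → 0 ≤ s →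
      (∀ i ∈ S, MeasurableSet (E i)) → (S : Set ι).PairwiseDisjoint E →
      (∀ i ∈ S, E i ⊆ Metric.closedBall (a i) (h i)) →
      (∀ i ∈ S, ρ * h i ^ d ≤ volume.real (E i)) → (∀ i ∈ S, dist x (a i) ≤ C₁ * h i) →
      ∑ i ∈ S, h i ≤ N * s := by
  classical
  set b := volume.real (Metric.closedBall (0 : Space d) 1)
  have hb : 0 < b := ENNReal.toReal_pos (Metric.measure_closedBall_pos _ _ one_pos).ne'
    measure_closedBall_lt_top.ne
  set N := b * (2 * (C₁ + 1)) ^ d / ρ with hN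
  have hN0 : 0 < N := by positivity
  refine ⟨2 * N, by positivity, ?_⟩
  intro ι S
  induction S using Finset.strongInduction with
  | H S ih =>
    intro E a h x s hh hs hE hdis hsub hvol hx
    rcases S.eq_empty_or_nonempty with rfl | hne
    · simpa using by positivity
    obtain ⟨j, hj, hjmax⟩ := S.exists_max_image h hne
    have hj0 := (hh j hj).1
    -- Radii within a factor two of the largest one: the corresponding disjoint sets have volume at
    -- least `ρ (h j / 2)^d` and lie in one ball of radius `(C₁ + 1) h j`, so there are at most `N`
    -- of them. The other radii are at most `h j / 2` and fall under the induction hypothesis.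
    set S₁ := S.filter fun i => h j / 2 < h i
    set S₂ := S.filter fun i => ¬ h j / 2 < h i
    have hcard : (S₁.card : ℝ) ≤ N := by
      have h1 : ∑ i ∈ S₁, volume.real (E i)
          ≤ volume.real (Metric.closedBall x ((C₁ + 1) * h j)) := by
        rw [← measureReal_biUnion_finset (hdis.subset (by
          exact_mod_cast Finset.filter_subset _ _))
          (fun i hi => hE i (Finset.mem_filter.1 hi).1)
          (fun i hi => ((measure_mono (hsub i (Finset.mem_filter.1 hi).1)).trans_lt
            measure_closedBall_lt_top).ne)]
        refine measureReal_mono (Set.iUnion₂_subset fun i hi y hy => ?_)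
          measure_closedBall_lt_top.ne
        have hiS := (Finset.mem_filter.1 hi).1
        have h2 := Metric.mem_closedBall.1 (hsub i hiS hy)
        have h3 := hx i hiS
        have h4 := hjmax i hiS
        rw [Metric.mem_closedBall]
        have h5 := dist_triangle_right y x (a i)
        nlinarith
      have h2 : ∑ i ∈ S₁, ρ * (h j / 2) ^ d ≤ ∑ i ∈ S₁, volume.real (E i) := by
        refine Finset.sum_le_sum fun i hi => ?_
        refine le_trans ?_ (hvol i (Finset.mem_filter.1 hi).1)
        have := (Finset.mem_filter.1 hi).2.le
        gcongr
      have h3 := h2.trans h1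
      rw [Finset.sum_const, nsmul_eq_mul, measureReal_def,
        Measure.addHaar_closedBall' _ _ (by positivity), ENNReal.toReal_mul,
        ENNReal.toReal_ofReal (by positivity), finrank_euclideanSpace_fin, ← measureReal_def,
        ← le_div_iff₀ (by positivity)] at h3
      refine h3.trans (le_of_eq ?_)
      rw [hN, div_pow, mul_pow, mul_pow]
      field_simp
      rfl
    have hlt : S₂ ⊂ S := by
      refine Finset.filter_ssubset.2 ⟨j, hj, ?_⟩
      rw [not_not]
      linarith
    have hm : ∀ {i}, i ∈ S₂ → i ∈ S := fun hi => (Finset.mem_filter.1 hi).1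
    have h2 := ih S₂ hlt E a h x (h j / 2)
      (fun i hi => ⟨(hh i (hm hi)).1, not_lt.1 (Finset.mem_filter.1 hi).2⟩) (by positivity)
      (fun i hi => hE i (hm hi)) (hdis.subset (by exact_mod_cast Finset.filter_subset _ _))
      (fun i hi => hsub i (hm hi)) (fun i hi => hvol i (hm hi)) (fun i hi => hx i (hm hi))
    have h1 : ∑ i ∈ S₁, h i ≤ N * h j := by
      refine (Finset.sum_le_card_nsmul _ _ (h j) fun i hi =>
        hjmax i (Finset.mem_filter.1 hi).1).trans ?_
      rw [nsmul_eq_mul]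
      gcongr
    rw [← Finset.sum_filter_add_sum_filter_not S fun i => h j / 2 < h i]
    have h3 := (hh j hj).2
    -- The geometric series in closed form: the constant `2 N` reproduces itself when the bound on
    -- the radii is halved.
    calc _ ≤ N * h j + 2 * N * (h j / 2) := add_le_add h1 h2
      _ = 2 * N * h j := by ring
      _ ≤ 2 * N * s := by gcongr

/-! ### Star-shaped neighbourhoods in a Lipschitz domain -/

/-- `D ⊆ Ω` is an open set which contains `Ω ∩ B(a, H)`, is contained in `B(a, C H)`, and is
star-shaped with respect to the points of the ball `B(c, H) ⊆ D`. -/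
structure IsStarNbhd {d : ℕ} (Ω D : Set (Space d)) (a c : Space d) (H C : ℝ) : Prop where
  isOpen : IsOpen D
  subset : D ⊆ Ω
  subset_ball : D ⊆ Metric.ball a (C * H)
  inter_subset : Ω ∩ Metric.closedBall a H ⊆ D
  ball_subset : Metric.ball c H ⊆ D
  star : ∀ b ∈ Metric.ball c H, ∀ z ∈ D, ∀ t ∈ Set.Icc (0 : ℝ) 1, b + t • (z - b) ∈ D

theorem IsStarNbhd.mono {d : ℕ} {Ω D : Set (Space d)} {a c : Space d} {H C C' : ℝ}
    (h : IsStarNbhd Ω D a c H C) (hH : 0 ≤ H) (hC : C ≤ C') : IsStarNbhd Ω D a c H C' :=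
  { h with subset_ball := h.subset_ball.trans (Metric.ball_subset_ball (by gcongr)) }

theorem add_smul_sub_eq {E : Type*} [AddCommGroup E] [Module ℝ E] (b z : E) (t : ℝ) :
    b + t • (z - b) = (1 - t) • b + t • z := by
  module

theorem isStarNbhd_ball {d : ℕ} {Ω : Set (Space d)} {a : Space d} {H : ℝ} (hH : 0 < H)
    (h : Metric.ball a (2 * H) ⊆ Ω) : IsStarNbhd Ω (Metric.ball a (2 * H)) a a H 2 where
  isOpen := Metric.isOpen_ball
  subset := h
  subset_ball := le_rfl
  inter_subset := Set.inter_subset_right.trans (Metric.closedBall_subset_ball (by linarith))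
  ball_subset := Metric.ball_subset_ball (by linarith)
  star := by
    intro b hb z hz t ht
    rw [add_smul_sub_eq]
    exact (convex_ball a (2 * H)) (Metric.ball_subset_ball (by linarith) hb) hz
      (sub_nonneg.2 ht.2) ht.1 (by ring)

/-- `D` is the part above the graph of a cylinder around `a` with axis `ν`. The ball sits so high
above `a`, relative to the Lipschitz constant, that segments from it down to points of `D` do not
cross the graph. -/
theorem exists_isStarNbhd_graph {d : ℕ} {Ω : Set (Space d)} {x ν : Space d} {r : ℝ} {L : NNReal}
    {g : Space d → ℝ} (hν : ‖ν‖ = 1) (hg : LipschitzWith L g)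
    (hinv : ∀ (y : Space d) (t : ℝ), g (y + t • ν) = g y)
    (hΩ : ∀ y ∈ Metric.ball x r, y ∈ Ω ↔ g y < inner ℝ ν y) {a : Space d} {H : ℝ} (hH : 0 < H)
    (ha : a ∈ Ω) (hr : Metric.ball a ((5 * L + 6) * H) ⊆ Metric.ball x r) :
    ∃ D c, IsStarNbhd Ω D a c H (5 * L + 6) := by
  have hL : (0 : ℝ) ≤ L := L.2
  have hνν : inner ℝ ν ν = (1 : ℝ) := by rw [real_inner_self_eq_norm_sq, hν, one_pow]
  -- The horizontal part of a vector. As `g` is constant in the direction `ν`, only horizontal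
  -- displacements change it, at rate at most `L`.
  set Q : Space d → Space d := fun z => z - inner ℝ ν z • ν with hQ
  have hQc : Continuous Q := by fun_prop
  have hQn : ∀ z, ‖Q z‖ ≤ ‖z‖ := by
    intro z
    have h1 : ‖Q z‖ ^ 2 = ‖z‖ ^ 2 - (inner ℝ ν z : ℝ) ^ 2 := by
      rw [hQ, norm_sub_sq_real, norm_smul, hν, real_inner_smul_right, real_inner_comm ν z,
        Real.norm_eq_abs, mul_one, sq_abs]
      ring
    refine abs_le_of_sq_le_sq' ?_ (norm_nonneg z) |>.2
    nlinarith [sq_nonneg (inner ℝ ν z : ℝ)]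
  have hQcomb : ∀ (b z : Space d) (t : ℝ), Q ((1 - t) • b + t • z) = (1 - t) • Q b + t • Q z := by
    intro b z t
    simp only [hQ, inner_add_right, real_inner_smul_right]
    module
  have hin : ∀ z : Space d, |(inner ℝ ν z : ℝ)| ≤ ‖z‖ := fun z => by
    simpa [hν] using abs_real_inner_le_norm ν z
  have hgQ : ∀ y z : Space d, g y ≤ g z + L * ‖Q (y - z)‖ := by
    intro y z
    have h1 : g y = g (z + Q (y - z)) := by
      rw [← hinv (z + Q (y - z)) (inner ℝ ν (y - z))]
      congr 1
      simp only [hQ]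
      abel
    have h2 := hg.dist_le_mul (z + Q (y - z)) z
    rw [dist_eq_norm, dist_eq_norm, add_sub_cancel_left, Real.norm_eq_abs] at h2
    rw [h1]
    linarith [le_abs_self (g (z + Q (y - z)) - g z)]
  set D : Set (Space d) := {z | ‖Q (z - a)‖ < 2 * H ∧ -(2 * H) < inner ℝ ν (z - a) ∧
    inner ℝ ν (z - a) < (5 * L + 2) * H ∧ g z < inner ℝ ν z} with hD
  have hDball : D ⊆ Metric.ball a ((5 * L + 6) * H) := by
    intro z hz
    obtain ⟨h1, h2, h3, -⟩ := hz
    rw [mem_ball_iff_norm]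
    have h4 : z - a = Q (z - a) + inner ℝ ν (z - a) • ν := by simp [hQ]
    have h5 : ‖z - a‖ ≤ ‖Q (z - a)‖ + |(inner ℝ ν (z - a) : ℝ)| := by
      conv_lhs => rw [h4]
      refine (norm_add_le _ _).trans (le_of_eq ?_)
      rw [norm_smul, hν, mul_one, Real.norm_eq_abs]
    have h6 : |(inner ℝ ν (z - a) : ℝ)| < (5 * L + 4) * H := by
      rw [abs_lt]
      constructor <;> nlinarith [mul_nonneg hL hH.le]
    linarith
  have hga : g a < inner ℝ ν a :=
    (hΩ a (hr (Metric.mem_ball_self (by positivity)))).1 ha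
  -- All points of the ball are then more than `5 L H` above `a`: `2 L H` for the variation of `g`
  -- over the cylinder and `3 L H` for the slope argument below.
  set c : Space d := a + ((5 * L + 1) * H) • ν with hc
  have hball : ∀ y ∈ Metric.ball c H, ‖Q (y - a)‖ < H ∧ 5 * L * H < inner ℝ ν (y - a) ∧
      inner ℝ ν (y - a) < (5 * L + 2) * H := by
    intro y hy
    rw [mem_ball_iff_norm] at hy
    have e : y - a = (y - c) + ((5 * L + 1) * H) • ν := by
      rw [hc]
      abel
    have e1 : Q (y - a) = Q (y - c) := by
      rw [e]
      simp only [hQ, inner_add_right, real_inner_smul_right, hνν]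
      module
    have e2 : inner ℝ ν (y - a) = (inner ℝ ν (y - c) : ℝ) + (5 * L + 1) * H := by
      rw [e, inner_add_right, real_inner_smul_right, hνν, mul_one]
    have h1 := (abs_lt.1 ((hin (y - c)).trans_lt hy))
    refine ⟨e1 ▸ (hQn _).trans_lt hy, ?_, ?_⟩ <;> rw [e2] <;> linarith [h1.1, h1.2]
  have hballD : Metric.ball c H ⊆ D := by
    intro y hy
    obtain ⟨h1, h2, h3⟩ := hball y hy
    have h0 := mul_nonneg hL hH.le
    refine ⟨by linarith, by linarith, h3, ?_⟩
    have h4 := hgQ y a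
    have h5 : (L : ℝ) * ‖Q (y - a)‖ ≤ L * H := by gcongr
    rw [inner_sub_right] at h2
    linarith
  refine ⟨D, c, ⟨?_, fun z hz => (hΩ z (hr (hDball hz))).2 hz.2.2.2, hDball, ?_, hballD, ?_⟩⟩
  · have e : D = {z | ‖Q (z - a)‖ < 2 * H} ∩ ({z | -(2 * H) < inner ℝ ν (z - a)} ∩
      ({z | inner ℝ ν (z - a) < (5 * L + 2) * H} ∩ {z | g z < inner ℝ ν z})) := rfl
    rw [e]
    have hgc := hg.continuous
    exact (isOpen_lt (by fun_prop) continuous_const).inter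
      ((isOpen_lt continuous_const (by fun_prop)).inter
        ((isOpen_lt (by fun_prop) continuous_const).inter (isOpen_lt hgc (by fun_prop))))
  · rintro z ⟨hz, hza⟩
    have h1 := mem_closedBall_iff_norm.1 hza
    have h2 := abs_le.1 ((hin (z - a)).trans h1)
    have h0 := mul_nonneg hL hH.le
    have h3 : z ∈ Metric.ball a ((5 * L + 6) * H) := by
      rw [mem_ball_iff_norm]
      linarith
    exact ⟨by linarith [hQn (z - a)], by linarith [h2.1], by linarith [h2.2],
      (hΩ z (hr h3)).1 hz⟩
  · intro b hb z hz t ht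
    obtain ⟨b1, b2, b3⟩ := hball b hb
    obtain ⟨z1, z2, z3, z4⟩ := hz
    have h0 := mul_nonneg hL hH.le
    have ht1 : 0 ≤ 1 - t := sub_nonneg.2 ht.2
    have ht0 := ht.1
    set w := b + t • (z - b) with hw
    have hwa : w - a = (1 - t) • (b - a) + t • (z - a) := by
      rw [hw]
      module
    have i1 : inner ℝ ν (w - a) = (1 - t) * (inner ℝ ν (b - a) : ℝ) + t * inner ℝ ν (z - a) := by
      rw [hwa, inner_add_right, real_inner_smul_right, real_inner_smul_right]
    have q1 : ‖Q (w - a)‖ < 2 * H := by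
      rw [hwa, hQcomb]
      have := (convex_ball (0 : Space d) (2 * H)) (x := Q (b - a)) (y := Q (z - a))
        (by rw [mem_ball_zero_iff]; linarith) (by rwa [mem_ball_zero_iff]) ht1 ht0 (by ring)
      rwa [mem_ball_zero_iff] at this
    have hlow : ∀ m : ℝ, m < inner ℝ ν (b - a) → m < inner ℝ ν (z - a) →
        m < inner ℝ ν (w - a) := by
      intro m hb hz
      rw [i1]
      exact (convex_Ioi m) hb hz ht1 ht0 (by ring)
    have hupp : ∀ m : ℝ, inner ℝ ν (b - a) < m → inner ℝ ν (z - a) < m →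
        inner ℝ ν (w - a) < m := by
      intro m hb hz
      rw [i1]
      exact (convex_Iio m) hb hz ht1 ht0 (by ring)
    refine ⟨q1, hlow _ (by linarith) z2, hupp _ b3 z3, ?_⟩
    -- If `z` is at height at least `2 L H` over `a`, so is the whole segment, and there the graph
    -- lies below. Otherwise the segment rises from `z` to `b` by more than `3 L H` over a
    -- horizontal distance of at most `3 H`, at least as steeply as the graph can.
    by_cases hcase : 2 * L * H ≤ inner ℝ ν (z - a)
    · have h1 : 2 * L * H ≤ inner ℝ ν (w - a) := by
        rw [i1]
        have hb' : 2 * L * H ≤ inner ℝ ν (b - a) := by linarith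
        exact (convex_Ici (2 * L * H)) hb' hcase ht1 ht0 (by ring)
      have h2 := hgQ w a
      have h3 : (L : ℝ) * ‖Q (w - a)‖ ≤ L * (2 * H) := by gcongr
      rw [inner_sub_right] at h1
      linarith
    · have e1 : w - z = (1 - t) • (b - z) + t • 0 := by
        rw [hw]
        module
      have hQ0 : Q 0 = 0 := by simp [hQ]
      have hQs : Q (b - z) = Q (b - a) - Q (z - a) := by
        simp only [hQ, inner_sub_right]
        module
      have h1 := hgQ w z
      rw [e1, hQcomb, hQ0, smul_zero, add_zero, norm_smul, Real.norm_of_nonneg ht1, hQs] at h1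
      have h2 : ‖Q (b - a) - Q (z - a)‖ ≤ 3 * H := (norm_sub_le _ _).trans (by linarith)
      have h3 : (inner ℝ ν w : ℝ) = inner ℝ ν z + (1 - t) * (inner ℝ ν (b - a) - inner ℝ ν (z - a)) := by
        have : w = z + (1 - t) • ((b - a) - (z - a)) := by
          rw [hw]
          module
        rw [this, inner_add_right, real_inner_smul_right, inner_sub_right ν (b - a)]
      have h4 : (L : ℝ) * ((1 - t) * ‖Q (b - a) - Q (z - a)‖) ≤ L * ((1 - t) * (3 * H)) := by gcongr
      have h5 : (1 - t) * (3 * L * H) ≤ (1 - t) * (inner ℝ ν (b - a) - inner ℝ ν (z - a)) := by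
        gcongr
        linarith
      rw [h3]
      linarith

/-- Balls serve near interior points, graph charts near boundary points; compactness of the closure
makes `h₀` and `C` uniform. -/
theorem IsLipschitzDomain.exists_isStarNbhd {d : ℕ} {Ω : Set (Space d)}
    (hΩ : IsLipschitzDomain Ω) : ∃ h₀ C : ℝ, 0 < h₀ ∧ 0 < C ∧ ∀ a ∈ Ω, ∀ H, 0 < H → H ≤ h₀ →
      ∃ D c, IsStarNbhd Ω D a c H C := by
  obtain ⟨hΩo, -, hΩb, hΩf⟩ := hΩ
  have hcomp : IsCompact (closure Ω) := hΩb.isCompact_closure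
  have key := hcomp.induction_on
    (p := fun s => ∃ h₀ C : ℝ, 0 < h₀ ∧ 0 < C ∧ ∀ a ∈ Ω ∩ s, ∀ H, 0 < H → H ≤ h₀ →
      ∃ D c, IsStarNbhd Ω D a c H C) ?_ ?_ ?_ ?_
  · obtain ⟨h₀, C, hh, hC, h⟩ := key
    exact ⟨h₀, C, hh, hC, fun a ha => h a ⟨ha, subset_closure ha⟩⟩
  · exact ⟨1, 1, one_pos, one_pos, fun a ha => absurd ha.2 (Set.notMem_empty a)⟩
  · rintro s t hst ⟨h₀, C, hh, hC, h⟩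
    exact ⟨h₀, C, hh, hC, fun a ha => h a ⟨ha.1, hst ha.2⟩⟩
  · rintro s t ⟨h₀, C, hh, hC, h⟩ ⟨h₀', C', hh', hC', h'⟩
    refine ⟨min h₀ h₀', max C C', lt_min hh hh', lt_max_of_lt_left hC, ?_⟩
    rintro a ⟨ha, has | hat⟩ H hH hHle
    · obtain ⟨D, c, hD⟩ := h a ⟨ha, has⟩ H hH (hHle.trans (min_le_left _ _))
      exact ⟨D, c, hD.mono hH.le (le_max_left _ _)⟩
    · obtain ⟨D, c, hD⟩ := h' a ⟨ha, hat⟩ H hH (hHle.trans (min_le_right _ _))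
      exact ⟨D, c, hD.mono hH.le (le_max_right _ _)⟩
  · intro x hx
    by_cases hxΩ : x ∈ Ω
    · obtain ⟨r, hr, hrΩ⟩ := Metric.isOpen_iff.1 hΩo x hxΩ
      refine ⟨Metric.ball x (r / 3), mem_nhdsWithin_of_mem_nhds
        (Metric.ball_mem_nhds x (by positivity)), r / 3, 2, by positivity, two_pos, ?_⟩
      rintro a ⟨-, hax⟩ H hH hHr
      refine ⟨_, a, isStarNbhd_ball hH ((Metric.ball_subset_ball' ?_).trans hrΩ)⟩
      linarith [Metric.mem_ball.1 hax]
    · obtain ⟨ν, r, L, g, hν, hr, hg, hinv, hgr⟩ := hΩf x ⟨hx, by rwa [hΩo.interior_eq]⟩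
      have hL : (0 : ℝ) ≤ L := L.2
      refine ⟨Metric.ball x (r / (5 * L + 7)), mem_nhdsWithin_of_mem_nhds
        (Metric.ball_mem_nhds x (by positivity)), r / (5 * L + 7), 5 * L + 6, by positivity,
        by positivity, ?_⟩
      rintro a ⟨ha, hax⟩ H hH hHr
      refine exists_isStarNbhd_graph hν hg hinv hgr hH ha (Metric.ball_subset_ball' ?_)
      have h1 := (Metric.mem_ball.1 hax).le
      calc (5 * L + 6) * H + dist a x
          ≤ (5 * L + 6) * (r / (5 * L + 7)) + r / (5 * L + 7) := by gcongr
        _ = r := by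
          field_simp
          ring

/-! ### Weak derivatives of Sobolev functions -/

section Commute

variable {d : ℕ} {f : Space d → ℝ}

theorem contDiff_partialDeriv (hf : ContDiff ℝ ∞ f) (i : Fin d) :
    ContDiff ℝ ∞ (partialDeriv i f) :=
  (hf.fderiv_right (m := ∞) (by simp)).clm_apply contDiff_const

theorem contDiff_partialDeriv_iterate (hf : ContDiff ℝ ∞ f) (i : Fin d) (n : ℕ) :
    ContDiff ℝ ∞ ((partialDeriv i)^[n] f) := by
  induction n with
  | zero => exact hf
  | succ n ih =>
    rw [Function.iterate_succ_apply']
    exact contDiff_partialDeriv ih i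

theorem partialDeriv_comm (hf : ContDiff ℝ ∞ f) (i j : Fin d) :
    partialDeriv i (partialDeriv j f) = partialDeriv j (partialDeriv i f) := by
  have h1 : Differentiable ℝ (fderiv ℝ f) :=
    (hf.fderiv_right (m := ∞) (by simp)).differentiable (by simp)
  have h2 : ∀ (l m : Fin d) x, partialDeriv l (partialDeriv m f) x
      = fderiv ℝ (fderiv ℝ f) x (EuclideanSpace.single l 1) (EuclideanSpace.single m 1) := by
    intro l m x
    unfold partialDeriv
    rw [fderiv_clm_apply (h1 x) (differentiableAt_const _)]
    simp
  ext x
  rw [h2, h2]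
  exact second_derivative_symmetric
    (fun y => ((hf.differentiable (by simp)) y).hasFDerivAt) (h1 x).hasFDerivAt _ _

theorem partialDeriv_iterate_comm (hf : ContDiff ℝ ∞ f) (i j : Fin d) (n : ℕ) :
    (partialDeriv j)^[n] (partialDeriv i f) = partialDeriv i ((partialDeriv j)^[n] f) := by
  induction n with
  | zero => rfl
  | succ n ih =>
    rw [Function.iterate_succ_apply', ih, Function.iterate_succ_apply',
      partialDeriv_comm (contDiff_partialDeriv_iterate hf j n)]

theorem contDiff_foldr_partialDeriv (hf : ContDiff ℝ ∞ f) (α : Fin d → ℕ) (l : List (Fin d)) :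
    ContDiff ℝ ∞ (l.foldr (fun i g => (partialDeriv i)^[α i] g) f) := by
  induction l with
  | nil => exact hf
  | cons j l ih => exact contDiff_partialDeriv_iterate ih j (α j)

theorem foldr_partialDeriv_comm (hf : ContDiff ℝ ∞ f) (α : Fin d → ℕ) (i : Fin d)
    (l : List (Fin d)) :
    l.foldr (fun i g => (partialDeriv i)^[α i] g) (partialDeriv i f)
      = partialDeriv i (l.foldr (fun i g => (partialDeriv i)^[α i] g) f) := by
  induction l with
  | nil => rfl
  | cons j l ih =>
    rw [List.foldr_cons, ih, List.foldr_cons,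
      partialDeriv_iterate_comm (contDiff_foldr_partialDeriv hf α l)]

/-- The order of differentiation in `multiDeriv` is fixed by a list, so the innermost `∂_i` has to
be commuted outwards to its place in the list. -/
theorem multiDeriv_partialDeriv (hf : ContDiff ℝ ∞ f) (α : Fin d → ℕ) (i : Fin d) :
    multiDeriv α (partialDeriv i f) = multiDeriv (α + Pi.single i 1) f := by
  have h1 : ∀ l : List (Fin d), i ∉ l →
      l.foldr (fun j g => (partialDeriv j)^[(α + Pi.single i 1 : Fin d → ℕ) j] g) f
        = l.foldr (fun j g => (partialDeriv j)^[α j] g) f := by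
    intro l hl
    induction l with
    | nil => rfl
    | cons j l ih =>
      rw [List.mem_cons, not_or] at hl
      rw [List.foldr_cons, List.foldr_cons, ih hl.2]
      simp [Ne.symm hl.1]
  have h2 : ∀ l : List (Fin d), l.Nodup → i ∈ l →
      l.foldr (fun j g => (partialDeriv j)^[α j] g) (partialDeriv i f)
        = l.foldr (fun j g => (partialDeriv j)^[(α + Pi.single i 1 : Fin d → ℕ) j] g) f := by
    intro l hl hi
    induction l with
    | nil => simp at hi
    | cons j l ih =>
      rw [List.nodup_cons] at hl
      rw [List.foldr_cons, List.foldr_cons]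
      by_cases hij : i = j
      · subst hij
        rw [h1 l hl.1, foldr_partialDeriv_comm hf]
        simp [Function.iterate_succ_apply]
      · rw [ih hl.2 ((List.mem_cons.1 hi).resolve_left hij)]
        simp [Ne.symm hij]
  exact h2 _ (List.nodup_finRange d) (List.mem_finRange i)

end Commute

theorem mem_multiIndices {d m : ℕ} {α : Fin d → ℕ} : α ∈ multiIndices d m ↔ ∑ i, α i ≤ m := by
  unfold multiIndices
  rw [Finset.mem_filter, Fintype.mem_piFinset]
  refine ⟨fun h => h.2, fun h => ⟨fun i => ?_, h⟩⟩
  exact Finset.mem_range_succ_iff.2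
    ((Finset.single_le_sum (fun j _ => Nat.zero_le (α j)) (Finset.mem_univ i)).trans h)

namespace MemSobolev

variable {d m : ℕ} {Ω : Set (Space d)} {u : Space d → ℝ}

theorem weakDeriv_spec (hu : MemSobolev m Ω u) {α : Fin d → ℕ} (hα : ∑ i, α i ≤ m) :
    MemLp (weakDeriv Ω α u) 2 (volume.restrict Ω) ∧ IsWeakDeriv Ω α u (weakDeriv Ω α u) := by
  have h := hu.2 α (mem_multiIndices.2 hα)
  unfold weakDeriv
  rw [dif_pos h]
  exact h.choose_spec

theorem memLp_weakDeriv (hu : MemSobolev m Ω u) (α : Fin d → ℕ) (hα : ∑ i, α i ≤ m) :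
    MemLp (weakDeriv Ω α u) 2 (volume.restrict Ω) := (hu.weakDeriv_spec hα).1

/-- The definition of `∂^α u`, tested with `∂_i φ`, is compared with that of the derivative of order
`α + e_i`, tested with `φ`; the signs differ by one factor `-1`. -/
theorem hasWeakGrad_weakDeriv (hu : MemSobolev (m + 1) Ω u) (α : Fin d → ℕ)
    (hα : ∑ i, α i ≤ m) :
    HasWeakGrad Ω (weakDeriv Ω α u) fun i => weakDeriv Ω (α + Pi.single i 1) u := by
  intro i φ hφ hc hs
  have hsum : ∑ j, (α + Pi.single i 1 : Fin d → ℕ) j = ∑ j, α j + 1 := by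
    simp [Finset.sum_add_distrib]
  have h1 := (hu.weakDeriv_spec (hα.trans m.le_succ)).2 (partialDeriv i φ)
    (contDiff_partialDeriv hφ i) (hc.fderiv_apply (𝕜 := ℝ) _)
    ((tsupport_fderiv_apply_subset ℝ _).trans hs)
  have h2 := (hu.weakDeriv_spec (α := α + Pi.single i 1) (by omega)).2 φ hφ hc hs
  rw [multiDeriv_partialDeriv hφ, h2, hsum, pow_succ] at h1
  have h3 : ((-1 : ℝ) ^ ∑ j, α j) ≠ 0 := pow_ne_zero _ (by norm_num)
  apply mul_left_cancel₀ h3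
  rw [← h1]
  ring

/-- `weakDeriv` is obtained by choice also for `α = 0`; the fundamental lemma of the calculus of
variations identifies it with `u`. -/
theorem weakDeriv_zero_ae_eq (hΩ : IsOpen Ω) (hΩb : Bornology.IsBounded Ω)
    (hu : MemSobolev m Ω u) : weakDeriv Ω 0 u =ᵐ[volume.restrict Ω] u := by
  have hf : IsFiniteMeasure (volume.restrict Ω) := ⟨by simpa using hΩb.measure_lt_top⟩
  obtain ⟨h1, h2⟩ := hu.weakDeriv_spec (α := 0) (by simp)
  have i1 : IntegrableOn (weakDeriv Ω 0 u) Ω := h1.integrable one_le_two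
  have i2 : IntegrableOn u Ω := hu.1.integrable one_le_two
  have key := hΩ.ae_eq_zero_of_integral_contDiff_smul_eq_zero
    (f := fun x => weakDeriv Ω 0 u x - u x) (μ := volume) (i1.sub i2).locallyIntegrableOn ?_
  · rw [EventuallyEq, ae_restrict_iff' hΩ.measurableSet]
    filter_upwards [key] with x hx hxΩ
    exact sub_eq_zero.1 (hx hxΩ)
  · intro φ hφ hc hs
    have h3 := h2 φ hφ hc hs
    have h4 : multiDeriv 0 φ = φ := by
      unfold multiDeriv
      generalize List.finRange d = l
      induction l with
      | nil => rfl
      | cons j l ih => simp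
    obtain ⟨C, hC⟩ := hc.exists_bound_of_continuous hφ.continuous
    have hb : ∀ {f : Space d → ℝ}, IntegrableOn f Ω → IntegrableOn (fun x => f x * φ x) Ω :=
      fun hf => hf.mul_bdd (c := C) hφ.continuous.aestronglyMeasurable (Eventually.of_forall hC)
    rw [h4] at h3
    rw [← setIntegral_eq_integral_of_forall_compl_eq_zero (s := Ω) fun x hx => by
      rw [image_eq_zero_of_notMem_tsupport fun h => hx (hs h), zero_smul]]
    simp only [smul_eq_mul, mul_comm (φ _), sub_mul]
    rw [integral_sub (hb i1) (hb i2), h3]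
    simp

end MemSobolev

/-! ### The Bramble–Hilbert lemma -/

namespace Poly

variable {d : ℕ}

/-- The derivative `∂^α` of polynomials. -/
def iterDeriv (α : Fin d →₀ ℕ) : Poly d →ₗ[ℝ] Poly d :=
  (MvPolynomial.basisMonomials (Fin d) ℝ).constr ℝ fun β =>
    MvPolynomial.monomial (β - α) ((∏ i, (β i).descFactorial (α i) : ℕ) : ℝ)

theorem iterDeriv_monomial (α β : Fin d →₀ ℕ) (a : ℝ) :
    iterDeriv α (MvPolynomial.monomial β a)
      = MvPolynomial.monomial (β - α) (a * ((∏ i, (β i).descFactorial (α i) : ℕ) : ℝ)) := by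
  have h := (MvPolynomial.basisMonomials (Fin d) ℝ).constr_basis ℝ (fun β =>
    MvPolynomial.monomial (β - α) ((∏ i, (β i).descFactorial (α i) : ℕ) : ℝ)) β
  rw [MvPolynomial.coe_basisMonomials] at h
  have e : MvPolynomial.monomial β a = a • MvPolynomial.monomial β (1 : ℝ) := by
    rw [MvPolynomial.smul_monomial, smul_eq_mul, mul_one]
  rw [e, map_smul, iterDeriv, h, MvPolynomial.smul_monomial, smul_eq_mul]

theorem iterDeriv_zero (p : Poly d) : iterDeriv 0 p = p := by
  induction p using MvPolynomial.induction_on' with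
  | monomial β a => simp [iterDeriv_monomial]
  | add p q hp hq => rw [map_add, hp, hq]

theorem pderiv_iterDeriv (α : Fin d →₀ ℕ) (i : Fin d) (p : Poly d) :
    MvPolynomial.pderiv i (iterDeriv α p) = iterDeriv (α + Finsupp.single i 1) p := by
  induction p using MvPolynomial.induction_on' with
  | monomial β a =>
    rw [iterDeriv_monomial, iterDeriv_monomial, MvPolynomial.pderiv_monomial, tsub_tsub, mul_assoc]
    congr 2
    rw [← Nat.cast_mul]
    congr 1
    rw [← Finset.mul_prod_erase _ _ (Finset.mem_univ i),
      ← Finset.mul_prod_erase _ _ (Finset.mem_univ i)]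
    have h1 : (α + Finsupp.single i 1 : Fin d →₀ ℕ) i = α i + 1 := by simp
    rw [h1, Nat.descFactorial_succ, Finsupp.tsub_apply]
    have h2 : ∏ j ∈ Finset.univ.erase i, (β j).descFactorial ((α + Finsupp.single i 1 : Fin d →₀ ℕ) j)
        = ∏ j ∈ Finset.univ.erase i, (β j).descFactorial (α j) := by
      refine Finset.prod_congr rfl fun j hj => ?_
      simp [(Finset.ne_of_mem_erase hj).symm]
    rw [h2]
    ring
  | add p q hp hq => rw [map_add, map_add, hp, hq, map_add]

/-- The descending factorial vanishes as soon as some `β i < α i`, so the truncated subtraction of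
exponents in `iterDeriv` does no harm. -/
theorem iterDeriv_monomial_eq_zero {α β : Fin d →₀ ℕ} (h : ¬ α ≤ β) (a : ℝ) :
    iterDeriv α (MvPolynomial.monomial β a) = 0 := by
  obtain ⟨i, hi⟩ : ∃ i, β i < α i := by
    by_contra! h'
    exact h h'
  rw [iterDeriv_monomial, Finset.prod_eq_zero (Finset.mem_univ i)
    (Nat.descFactorial_eq_zero_iff_lt.2 hi)]
  simp

theorem iterDeriv_eq_zero {p : Poly d} {α : Fin d →₀ ℕ} (h : p.totalDegree < α.degree) :
    iterDeriv α p = 0 := by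
  rw [p.as_sum, map_sum]
  refine Finset.sum_eq_zero fun β hβ => iterDeriv_monomial_eq_zero (fun hle => ?_) _
  have h1 : β.degree ≤ p.totalDegree := MvPolynomial.le_totalDegree hβ
  have h2 := Finsupp.degree_mono hle
  omega

/-- A monomial that survives has an exponent above `α`, and its degree is at most that of `α`; so it
is the monomial `α` itself. -/
theorem iterDeriv_eq_C {p : Poly d} {α : Fin d →₀ ℕ} (h : p.totalDegree ≤ α.degree) :
    iterDeriv α p = MvPolynomial.C (p.coeff α * ((∏ i, (α i).factorial : ℕ) : ℝ)) := by
  conv_lhs => rw [p.as_sum, map_sum]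
  have h0 : ∀ β ∈ p.support, β ≠ α →
      iterDeriv α (MvPolynomial.monomial β (p.coeff β)) = 0 := by
    intro β hβ hne
    refine iterDeriv_monomial_eq_zero (fun hle => hne ?_) _
    have h1 : β.degree ≤ p.totalDegree := MvPolynomial.le_totalDegree hβ
    obtain ⟨γ, rfl⟩ := exists_add_of_le hle
    rw [map_add] at h1
    have : γ = 0 := (Finsupp.degree_eq_zero_iff γ).1 (by omega)
    rw [this, add_zero]
  have h1 : α ∉ p.support → iterDeriv α (MvPolynomial.monomial α (p.coeff α)) = 0 := by
    intro hα
    rw [MvPolynomial.notMem_support_iff.1 hα]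
    simp
  rw [Finset.sum_eq_single α h0 h1, iterDeriv_monomial, tsub_self]
  simp [Nat.descFactorial_self]

/-- There is a polynomial of degree at most `k` whose derivatives up to order `k` have prescribed
integrals. -/
theorem exists_integral_iterDeriv_eq (k : ℕ) {ν : Measure (Space d)} (hν : ν ≠ 0)
    [IsFiniteMeasure ν] (hint : ∀ p : Poly d, Integrable p.val ν) (m : (Fin d →₀ ℕ) → ℝ) :
    ∃ p : Poly d, p.totalDegree ≤ k ∧ ∀ α : Fin d →₀ ℕ, α.degree ≤ k →
      ∫ x, (iterDeriv α p).val x ∂ν = m α := by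
  have hfin : Finite {n : Fin d →₀ ℕ | n.degree ≤ k} := Finsupp.finite_of_degree_le k
  let I := {n : Fin d →₀ ℕ | n.degree ≤ k}
  have : Fintype I := Fintype.ofFinite I
  let P : (I → ℝ) → Poly d := fun a => ∑ β : I, MvPolynomial.monomial β.1 (a β)
  have hPadd : ∀ a b, P (a + b) = P a + P b := by
    intro a b
    simp only [P, Pi.add_apply, map_add, Finset.sum_add_distrib]
  have hPsmul : ∀ (r : ℝ) a, P (r • a) = r • P a := by
    intro r a
    simp only [P, Pi.smul_apply, Finset.smul_sum, MvPolynomial.smul_monomial]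
  have hPdeg : ∀ a, (P a).totalDegree ≤ k := fun a =>
    MvPolynomial.totalDegree_finsetSum_le fun β _ =>
      (MvPolynomial.totalDegree_monomial_le _ _).trans β.2
  have hPcoeff : ∀ a (β : I), (P a).coeff β = a β := by
    intro a β
    classical
    simp only [P, MvPolynomial.coeff_sum, MvPolynomial.coeff_monomial]
    rw [Finset.sum_eq_single β]
    · simp
    · intro γ _ hne
      rw [if_neg fun h => hne (Subtype.ext h)]
    · simp
  let Φ : (I → ℝ) →ₗ[ℝ] (I → ℝ) :=
    { toFun := fun a α => ∫ x, (iterDeriv α.1 (P a)).val x ∂ν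
      map_add' := by
        intro a b
        funext α
        simp only [hPadd, map_add, val_add, Pi.add_apply]
        exact integral_add (hint _) (hint _)
      map_smul' := by
        intro r a
        funext α
        simp only [hPsmul, map_smul, val_smul, Pi.smul_apply, RingHom.id_apply, smul_eq_mul]
        exact integral_const_mul _ _ }
  -- The system has as many equations as unknowns. If all moments vanish but `P a ≠ 0`, take `α` of
  -- top degree in its support: `∂^α (P a)` is a nonzero constant, whose integral is not zero
  -- because `ν ≠ 0`.
  have hinj : Function.Injective Φ := by
    rw [injective_iff_map_eq_zero]
    intro a ha
    by_contra hne
    have hP0 : P a ≠ 0 := by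
      intro h0
      refine hne (funext fun β => ?_)
      rw [← hPcoeff a β, h0]
      simp
    obtain ⟨α, hα, hmax⟩ := (P a).support.exists_max_image (fun β => β.degree)
      (MvPolynomial.support_nonempty.2 hP0)
    have hdeg : (P a).totalDegree ≤ α.degree := Finset.sup_le hmax
    have hαk : α.degree ≤ k := (MvPolynomial.le_totalDegree hα).trans (hPdeg a)
    have h1 : ∫ x, (iterDeriv α (P a)).val x ∂ν = 0 := congrFun ha ⟨α, hαk⟩
    rw [iterDeriv_eq_C hdeg] at h1
    have h2 : ∀ x : Space d, Poly.val
        (MvPolynomial.C ((P a).coeff α * ((∏ i, (α i).factorial : ℕ) : ℝ))) x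
          = (P a).coeff α * ((∏ i, (α i).factorial : ℕ) : ℝ) := fun x => by simp [Poly.val]
    simp_rw [h2] at h1
    rw [integral_const, smul_eq_mul, mul_eq_zero, measureReal_eq_zero_iff,
      Measure.measure_univ_eq_zero] at h1
    refine absurd (h1.resolve_left hν) (mul_ne_zero (MvPolynomial.mem_support_iff.1 hα)
      (Nat.cast_ne_zero.2 ?_))
    exact Finset.prod_ne_zero_iff.2 fun i _ => Nat.factorial_ne_zero _
  obtain ⟨a, ha⟩ := (LinearMap.injective_iff_surjective.1 hinj) fun α => m α
  exact ⟨P a, hPdeg a, fun α hα => congrFun ha ⟨α, hα⟩⟩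

end Poly

/-- Poincaré inequality for functions with mean value zero on the ball `B(c, H)`. -/
theorem exists_poincare (d : ℕ) {C : ℝ} (hC : 0 < C) :
    ∃ C' : ℝ, 0 < C' ∧ ∀ (Ω D : Set (Space d)) (a c : Space d) (H : ℝ), 0 < H →
      IsOpen Ω → Bornology.IsBounded Ω → IsStarNbhd Ω D a c H C →
      ∀ (u : Space d → ℝ) (g : Fin d → Space d → ℝ), HasWeakGrad Ω u g →
      MemLp u 2 (volume.restrict Ω) → (∀ i, MemLp (g i) 2 (volume.restrict Ω)) →
      ∫ x in Metric.ball c H, u x = 0 →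
      ∫ x in D, u x ^ 2 ≤ C' * H ^ 2 * ∑ i, ∫ x in D, g i x ^ 2 := by
  refine ⟨(2 * C) ^ 2 * 2 ^ d * C ^ d, by positivity, ?_⟩
  intro Ω D a c H hH hΩo hΩb hD u g hug hu hg hmean
  have hΩf : IsFiniteMeasure (volume.restrict Ω) := ⟨by simpa using hΩb.measure_lt_top⟩
  have hle : volume.restrict D ≤ volume.restrict Ω := Measure.restrict_mono hD.subset le_rfl
  have hDf : IsFiniteMeasure (volume.restrict D) := isFiniteMeasure_of_le _ hle
  have huD : MemLp u 2 (volume.restrict D) := hu.mono_measure hle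
  have hgD : ∀ i, MemLp (g i) 2 (volume.restrict D) := fun i => (hg i).mono_measure hle
  have hleB : volume.restrict (Metric.ball c H) ≤ volume.restrict D :=
    Measure.restrict_mono hD.ball_subset le_rfl
  have huB : MemLp u 2 (volume.restrict (Metric.ball c H)) := huD.mono_measure hleB
  have hBf : IsFiniteMeasure (volume.restrict (Metric.ball c H)) := isFiniteMeasure_of_le _ hleB
  have hiD : Integrable u (volume.restrict D) := huD.integrable one_le_two
  have hiB : Integrable u (volume.restrict (Metric.ball c H)) := huB.integrable one_le_two
  have hDV : volume D ≠ ⊤ := by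
    have := measure_lt_top (volume.restrict D) Set.univ
    simpa using this.ne
  set A := ∫ x in D, u x ^ 2
  set s := ∫ x in D, u x
  set V := volume.real D
  set W := volume.real (Metric.ball c H)
  have h1 := hug.lintegral_sub_sq_le hΩo.measurableSet (hu.integrable one_le_two)
    (fun i => (hg i).integrable one_le_two) hD.isOpen Metric.isOpen_ball hD.subset
    hD.ball_subset hD.star (R := 2 * C * H) fun x hx y hy => by
      rw [← dist_eq_norm]
      have hx' := Metric.mem_ball.1 (hD.subset_ball hx)
      have hy' := Metric.mem_ball.1 (hD.subset_ball hy)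
      linarith [dist_triangle_right x y a]
  have hexp : ∀ y, ∫ x in D, (u x - u y) ^ 2 = A - 2 * s * u y + V * u y ^ 2 := by
    intro y
    have e : ∀ x, (u x - u y) ^ 2 = (u x ^ 2 - 2 * u y * u x) + u y ^ 2 := fun x => by ring
    simp_rw [e]
    have i1 : Integrable (fun x => u x ^ 2) (volume.restrict D) := huD.integrable_sq
    have i2 : Integrable (fun x => 2 * u y * u x) (volume.restrict D) := hiD.const_mul _
    have i3 : Integrable (fun x => u x ^ 2 - 2 * u y * u x) (volume.restrict D) := i1.sub i2
    rw [integral_add i3 (integrable_const _), integral_sub i1 i2, integral_const_mul,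
      integral_const, smul_eq_mul, measureReal_restrict_apply MeasurableSet.univ, Set.univ_inter]
    ring
  have hinner : ∀ y, ∫⁻ x in D, ‖u x - u y‖ₑ ^ 2
      = ENNReal.ofReal (A - 2 * s * u y + V * u y ^ 2) := by
    intro y
    have h2 := ofReal_integral_sq_eq (huD.sub (memLp_const (u y)))
    simp only [Pi.sub_apply] at h2
    rw [← h2, hexp]
  have hnonneg : ∀ y, 0 ≤ A - 2 * s * u y + V * u y ^ 2 := fun y =>
    hexp y ▸ integral_nonneg fun x => sq_nonneg _
  have j2 : Integrable (fun y => 2 * s * u y) (volume.restrict (Metric.ball c H)) :=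
    hiB.const_mul _
  have j3 : Integrable (fun y => V * u y ^ 2) (volume.restrict (Metric.ball c H)) :=
    huB.integrable_sq.const_mul _
  have j1 : Integrable (fun y => A - 2 * s * u y) (volume.restrict (Metric.ball c H)) :=
    (integrable_const _).sub j2
  have j4 : Integrable (fun y => A - 2 * s * u y + V * u y ^ 2)
      (volume.restrict (Metric.ball c H)) := j1.add j3
  -- The mean value zero on the ball removes the cross term. What remains is `∫_D u²` times the
  -- volume of the ball plus a nonnegative term, which is dropped.
  have hF : ∫ y in Metric.ball c H, (A - 2 * s * u y + V * u y ^ 2)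
      = W * A + V * ∫ y in Metric.ball c H, u y ^ 2 := by
    rw [integral_add j1 j3, integral_sub (integrable_const _) j2, integral_const_mul,
      integral_const_mul, hmean, integral_const, smul_eq_mul,
      measureReal_restrict_apply MeasurableSet.univ, Set.univ_inter]
    ring
  have hG : ∫⁻ z in D, ∑ i, ‖g i z‖ₑ ^ 2 = ENNReal.ofReal (∑ i, ∫ x in D, g i x ^ 2) := by
    rw [lintegral_finsetSum' _ fun i _ => (hgD i).aestronglyMeasurable.aemeasurable.enorm.pow_const 2,
      ENNReal.ofReal_sum_of_nonneg fun i _ => integral_nonneg fun x => sq_nonneg _]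
    exact Finset.sum_congr rfl fun i _ => (ofReal_integral_sq_eq (hgD i)).symm
  have hS : 0 ≤ ∑ i, ∫ x in D, g i x ^ 2 :=
    Finset.sum_nonneg fun i _ => integral_nonneg fun x => sq_nonneg _
  simp_rw [hinner] at h1
  rw [hG, ← ofReal_integral_eq_lintegral_ofReal j4 (Eventually.of_forall hnonneg), hF,
    ← ENNReal.ofReal_toReal hDV, ← ENNReal.ofReal_mul (by positivity), ← measureReal_def,
    ← ENNReal.ofReal_mul (by positivity), ENNReal.ofReal_le_ofReal_iff (by positivity)] at h1
  have hW : W = H ^ d * volume.real (Metric.ball (0 : Space d) 1) := by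
    simp only [W]
    rw [measureReal_def, Measure.addHaar_ball_of_pos _ _ hH, ENNReal.toReal_mul,
      ENNReal.toReal_ofReal (by positivity), finrank_euclideanSpace_fin, ← measureReal_def]
  have hV : V ≤ C ^ d * W := by
    refine (measureReal_mono hD.subset_ball measure_ball_lt_top.ne).trans (le_of_eq ?_)
    rw [hW, measureReal_def, Measure.addHaar_ball_of_pos _ _ (by positivity), ENNReal.toReal_mul,
      ENNReal.toReal_ofReal (by positivity), finrank_euclideanSpace_fin, ← measureReal_def]
    ring
  have hW0 : 0 < W :=
    ENNReal.toReal_pos (Metric.measure_ball_pos _ _ hH).ne' measure_ball_lt_top.ne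
  have h3 : 0 ≤ V * ∫ y in Metric.ball c H, u y ^ 2 :=
    mul_nonneg measureReal_nonneg (integral_nonneg fun x => sq_nonneg _)
  refine le_of_mul_le_mul_left ?_ hW0
  calc W * A ≤ (2 * C * H) ^ 2 * 2 ^ d * V * ∑ i, ∫ x in D, g i x ^ 2 := by linarith
    _ ≤ (2 * C * H) ^ 2 * 2 ^ d * (C ^ d * W) * ∑ i, ∫ x in D, g i x ^ 2 := by gcongr
    _ = _ := by ring

/-- Bramble–Hilbert lemma: polynomial approximation of a function whose weak derivatives are
`g α`. -/
theorem exists_bramble_hilbert (d k : ℕ) {C : ℝ} (hC : 0 < C) :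
    ∃ C' : ℝ, 0 < C' ∧ ∀ (Ω D : Set (Space d)) (a c : Space d) (H : ℝ), 0 < H →
      IsOpen Ω → Bornology.IsBounded Ω → IsStarNbhd Ω D a c H C →
      ∀ g : (Fin d →₀ ℕ) → Space d → ℝ,
      (∀ α : Fin d →₀ ℕ, α.degree ≤ k →
        HasWeakGrad Ω (g α) fun i => g (α + Finsupp.single i 1)) →
      (∀ α : Fin d →₀ ℕ, α.degree ≤ k + 1 → MemLp (g α) 2 (volume.restrict Ω)) →
      ∃ p : Poly d, p.totalDegree ≤ k ∧ ∀ (j : ℕ) (α : Fin d →₀ ℕ) (S : ℝ), α.degree + j = k + 1 → 0 ≤ S →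
        (∀ β : Fin d →₀ ℕ, β.degree = k + 1 → ∫ x in D, g β x ^ 2 ≤ S) →
        ∫ x in D, (g α x - (Poly.iterDeriv α p).val x) ^ 2 ≤ (C' * H ^ 2) ^ j * S := by
  obtain ⟨C', hC', hpoin⟩ := exists_poincare d hC
  -- Each step sums `d` partial derivatives; `d + 1` in place of `d` keeps the constant positive for
  -- `d = 0`.
  refine ⟨C' * (d + 1), by positivity, ?_⟩
  intro Ω D a c H hH hΩo hΩb hD g hg hgm
  have hΩf : IsFiniteMeasure (volume.restrict Ω) := ⟨by simpa using hΩb.measure_lt_top⟩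
  have hleB : volume.restrict (Metric.ball c H) ≤ volume.restrict Ω :=
    Measure.restrict_mono (hD.ball_subset.trans hD.subset) le_rfl
  have hBf : IsFiniteMeasure (volume.restrict (Metric.ball c H)) := isFiniteMeasure_of_le _ hleB
  have hpm : ∀ p : Poly d, MemLp p.val 2 (volume.restrict Ω) := fun p =>
    memLp_polyVal_restrict p hΩo.measurableSet hΩb
  have hpB : ∀ p : Poly d, Integrable p.val (volume.restrict (Metric.ball c H)) := fun p =>
    ((hpm p).mono_measure hleB).integrable one_le_two
  have hB0 : volume.restrict (Metric.ball c H) ≠ 0 := by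
    rw [Ne, Measure.restrict_eq_zero]
    exact (Metric.measure_ball_pos _ _ hH).ne'
  -- With matching means of all derivatives up to order `k`, the Poincaré inequality applies to each
  -- derivative of the difference in turn.
  obtain ⟨p, hp, hpint⟩ := Poly.exists_integral_iterDeriv_eq k hB0 hpB
    fun α => ∫ x in Metric.ball c H, g α x
  refine ⟨p, hp, ?_⟩
  -- `j` counts the remaining applications of the Poincaré inequality: at order `k + 1` the
  -- derivative of `p` vanishes, and each lower order gains a factor `H²`.
  intro j
  induction j with
  | zero =>
    intro α S hα hS0 hS
    rw [Poly.iterDeriv_eq_zero (by omega)]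
    simpa [Poly.val_zero] using hS α (by omega)
  | succ j ih =>
    intro α S hα hS0 hS
    have hdeg : ∀ i, (α + Finsupp.single i 1).degree + j = k + 1 := by
      intro i
      rw [map_add, Finsupp.degree_single]
      omega
    have h1 := hpoin Ω D a c H hH hΩo hΩb hD (fun x => g α x - (Poly.iterDeriv α p).val x)
      (fun i x => g (α + Finsupp.single i 1) x
        - (Poly.iterDeriv (α + Finsupp.single i 1) p).val x) ?_ ?_ ?_ ?_
    · refine h1.trans ?_
      have h2 : ∑ i, ∫ x in D, (g (α + Finsupp.single i 1) x
          - (Poly.iterDeriv (α + Finsupp.single i 1) p).val x) ^ 2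
            ≤ ∑ _i : Fin d, (C' * (d + 1) * H ^ 2) ^ j * S :=
        Finset.sum_le_sum fun i _ => ih _ S (hdeg i) hS0 hS
      rw [Finset.sum_const, Finset.card_univ, Fintype.card_fin, nsmul_eq_mul] at h2
      calc C' * H ^ 2 * _ ≤ C' * H ^ 2 * (d * ((C' * (d + 1) * H ^ 2) ^ j * S)) := by gcongr
        _ ≤ C' * H ^ 2 * ((d + 1) * ((C' * (d + 1) * H ^ 2) ^ j * S)) := by
            gcongr
            linarith
        _ = _ := by ring
    · have h3 := (hg α (by omega)).sub ((Poly.iterDeriv α p).hasWeakGrad_val)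
        ((hgm α (by omega)).integrable one_le_two) ((hpm _).integrable one_le_two)
        (fun i => (hgm _ (by have := hdeg i; omega)).integrable one_le_two)
        (fun i => (hpm _).integrable one_le_two)
      simp only [Poly.pderiv_iterDeriv] at h3
      exact h3
    · exact (hgm α (by omega)).sub (hpm _)
    · exact fun i => (hgm _ (by have := hdeg i; omega)).sub (hpm _)
    · rw [integral_sub (((hgm α (by omega)).mono_measure hleB).integrable one_le_two) (hpB _),
        hpint α (by omega), sub_self]

/-! ### The projection error on an element -/

theorem sq_integral_mul_le {α : Type*} [MeasurableSpace α] {ν : Measure α} {f g : α → ℝ}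
    (hf : MemLp f 2 ν) (hg : MemLp g 2 ν) :
    (∫ x, f x * g x ∂ν) ^ 2 ≤ (∫ x, f x ^ 2 ∂ν) * ∫ x, g x ^ 2 ∂ν := by
  have h : ∀ t : ℝ, 0 ≤ (∫ x, g x ^ 2 ∂ν) * (t * t) + (2 * ∫ x, f x * g x ∂ν) * t
      + ∫ x, f x ^ 2 ∂ν := by
    intro t
    have i1 : Integrable (fun x => g x ^ 2 * (t * t)) ν := hg.integrable_sq.mul_const _
    have i2 : Integrable (fun x => f x * g x * (2 * t)) ν := (hf.integrable_mul hg).mul_const _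
    have i3 : Integrable (fun x => g x ^ 2 * (t * t) + f x * g x * (2 * t)) ν := i1.add i2
    have e : ∫ x, (f x + t * g x) ^ 2 ∂ν = (∫ x, g x ^ 2 ∂ν) * (t * t)
        + (2 * ∫ x, f x * g x ∂ν) * t + ∫ x, f x ^ 2 ∂ν := by
      have e1 : ∀ x, (f x + t * g x) ^ 2
          = g x ^ 2 * (t * t) + f x * g x * (2 * t) + f x ^ 2 := fun x => by ring
      simp_rw [e1]
      rw [integral_add i3 hf.integrable_sq, integral_add i1 i2, integral_mul_const,
        integral_mul_const]
      ring
    rw [← e]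
    exact integral_nonneg fun x => sq_nonneg _
  have := discrim_le_zero h
  rw [discrim] at this
  linarith

namespace PolytopalMesh

variable {d : ℕ} {Ω : Set (Space d)} (M : PolytopalMesh Ω)

/-- The functional `w ↦ -(q_0, ∂_j w)_T + ⟨q_b, w n_j⟩_∂T` that defines the discrete weak partial
derivative `∂_j` of `q`. -/
def weakForm (T : Set (Space d)) (q : WeakFn d) (j : Fin d) (w : Poly d) : ℝ :=
  -(∫ x in T, q.1 x * Poly.val (MvPolynomial.pderiv j w) x)
    + ∑ e ∈ M.facesOf T, ∫ x in e, q.2 e x * (w.val x * M.normal T e j) ∂(surfaceMeasure d)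

variable {M}

theorem isCompact_elem {T : Set (Space d)} (hT : T ∈ M.elems) : IsCompact T :=
  (M.elem_polytope T hT).1.isCompact

theorem isCompact_face {T e : Set (Space d)} (he : e ∈ M.facesOf T) : IsCompact e :=
  (M.face_polytope e (M.mem_facesOf.1 he).1).1.isCompact

theorem diam_pos (hd : 1 ≤ d) {T : Set (Space d)} (hT : T ∈ M.elems) : 0 < Metric.diam T := by
  have : Nonempty (Fin d) := ⟨⟨0, hd⟩⟩
  have : Nontrivial (Space d) := inferInstance
  obtain ⟨x, hx⟩ := (M.elem_polytope T hT).2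
  have h1 := infinite_of_mem_nhds x (mem_interior_iff_mem_nhds.1 hx)
  exact Metric.diam_pos h1.nontrivial (isCompact_elem hT).isBounded

theorem face_subset {T e : Set (Space d)} (hT : T ∈ M.elems) (he : e ∈ M.facesOf T) : e ⊆ T :=
  (M.mem_facesOf.1 he).2.trans (isCompact_elem hT).isClosed.frontier_subset

theorem ShapeRegular.exists_isPyramidFace (hd : 1 ≤ d) (hΩ : IsLipschitzDomain Ω)
    {c : RegularityConstants} (hM : M.ShapeRegular c) {T e : Set (Space d)} (hT : T ∈ M.elems)
    (he : e ∈ M.facesOf T) :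
    ∃ A, IsPyramidFace Ω T e (M.normal T e) A (c.σ * Metric.diam T) (Metric.diam T) := by
  obtain ⟨A, hA, hx⟩ := hM.pyramid T hT e he
  refine ⟨A, (M.isOutwardNormal hT he).1, isCompact_face he, isCompact_elem hT,
    M.interior_subset hΩ hT, mul_pos c.σ_pos (diam_pos hd hT), fun x hxe => (hx x hxe).1,
    M.exists_subset_hyperplane hT he, hA, fun x hxe => ?_, M.ae_face_local hd hT he⟩
  have hAT : A ∈ T := hA (mem_convexJoin.2 ⟨A, rfl, x, hxe, left_mem_segment ℝ A x⟩)
  rw [← dist_eq_norm]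
  exact Metric.dist_le_diam_of_mem (isCompact_elem hT).isBounded (face_subset hT he hxe) hAT

/-- The error of approximation of `u`, with weak gradient `g`, by the polynomial `p` on `T`. -/
def approxError (T : Set (Space d)) (u : Space d → ℝ) (g : Fin d → Space d → ℝ) (p : Poly d) : ℝ :=
  (∫ x in T, (u x - p.val x) ^ 2)
    + Metric.diam T ^ 2 * ∫ x in T, ∑ i, (g i x - Poly.val (MvPolynomial.pderiv i p) x) ^ 2

theorem memLp_val_elem {T : Set (Space d)} (hT : T ∈ M.elems) (p : Poly d) :
    MemLp p.val 2 (volume.restrict T) :=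
  memLp_polyVal_restrict p (isCompact_elem hT).measurableSet (isCompact_elem hT).isBounded

theorem memLp_val_face (hd : 1 ≤ d) {T e : Set (Space d)} (hT : T ∈ M.elems)
    (he : e ∈ M.facesOf T) (p : Poly d) : MemLp p.val 2 ((surfaceMeasure d).restrict e) := by
  obtain ⟨c, hc⟩ := M.exists_subset_hyperplane hT he
  have hlt := surfaceMeasure_lt_top_of_subset_hyperplane hd (M.isOutwardNormal hT he).1
    (isCompact_face he).isBounded hc
  have : IsFiniteMeasure ((surfaceMeasure d).restrict e) := ⟨by simpa using hlt⟩
  exact p.memLp_val (isCompact_face he).isBounded (ae_restrict_mem (isCompact_face he).measurableSet)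

theorem elem_ae_eq_interior {T : Set (Space d)} (hT : T ∈ M.elems) :
    T =ᵐ[volume] interior T := by
  have h1 : interior T ≤ᵐ[volume] T := Eventually.of_forall fun x hx => _root_.interior_subset hx
  refine EventuallyLE.antisymm ?_ h1
  have h0 := measure_eq_zero_iff_ae_notMem.1 (M.volume_frontier hT)
  filter_upwards [h0] with x hx hxT
  by_contra hxi
  exact hx ⟨_root_.subset_closure hxT, hxi⟩

theorem restrict_elem_le (hΩ : IsLipschitzDomain Ω) {T : Set (Space d)} (hT : T ∈ M.elems) :
    volume.restrict T ≤ volume.restrict Ω := by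
  rw [Measure.restrict_congr_set (elem_ae_eq_interior hT)]
  exact Measure.restrict_mono (M.interior_subset hΩ hT) le_rfl

/-- `Q_0` and `Q_b` are best approximations on `T` and on `e`, so one polynomial `p` serves as
competitor for both; on the face the trace inequality is applied to `u - p`, with pyramid height `σ
h_T` and distances at most `h_T`. -/
theorem exists_projError_le (hd : 1 ≤ d) (hΩ : IsLipschitzDomain Ω) (k : ℕ)
    (c : RegularityConstants) :
    ∃ C : ℝ, 0 < C ∧ ∀ M : PolytopalMesh Ω, M.ShapeRegular c → ∀ T ∈ M.elems,
      ∀ (u : Space d → ℝ) (g : Fin d → Space d → ℝ), HasWeakGrad Ω u g →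
      MemLp u 2 (volume.restrict Ω) → (∀ i, MemLp (g i) 2 (volume.restrict Ω)) →
      MemLp (toWeakFn T u - projWeakFn k T u).1 2 (volume.restrict T) ∧
      (∀ e ∈ M.facesOf T,
        MemLp ((toWeakFn T u - projWeakFn k T u).2 e) 2 ((surfaceMeasure d).restrict e)) ∧
      ∀ p : Poly d, p.totalDegree ≤ k →
        ∫ x in T, (toWeakFn T u - projWeakFn k T u).1 x ^ 2 ≤ approxError T u g p ∧
        ∀ e ∈ M.facesOf T,
          ∫ x in e, (toWeakFn T u - projWeakFn k T u).2 e x ^ 2 ∂(surfaceMeasure d)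
            ≤ C / Metric.diam T * approxError T u g p := by
  obtain ⟨C, hC, htr⟩ := exists_trace_estimate hd
  have hσ := c.σ_pos
  refine ⟨C / c.σ, by positivity, ?_⟩
  intro M hM T hT u g hug hu hg
  have hΩm : MeasurableSet Ω := hΩ.1.measurableSet
  have hΩb : Bornology.IsBounded Ω := hΩ.2.2.1
  have hΩf : IsFiniteMeasure (volume.restrict Ω) := ⟨by simpa using hΩb.measure_lt_top⟩
  have huT : MemLp u 2 (volume.restrict T) := hu.mono_measure (restrict_elem_le hΩ hT)
  have hTf : IsFiniteMeasure (volume.restrict T) :=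
    isFiniteMeasure_of_le _ (restrict_elem_le hΩ hT)
  have htrace := fun e he => (hM.exists_isPyramidFace hd hΩ hT he).elim fun A hA =>
    htr Ω T e (M.normal T e) A _ _ hΩm hΩb (M.volume_frontier hT) hA u g hug hu hg
  obtain ⟨P, hP, hPe⟩ := exists_l2Proj_eq (memLp_val_elem hT) k huT
  have hq1 : (toWeakFn T u - projWeakFn k T u).1 = fun x => u x - P.val x := by
    funext x
    simp [toWeakFn, projWeakFn, hPe]
  have hface : ∀ e ∈ M.facesOf T, ∃ Q, IsL2Proj ((surfaceMeasure d).restrict e) k (trace T u) Q ∧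
      (toWeakFn T u - projWeakFn k T u).2 e = fun x => trace T u x - Q.val x := by
    intro e he
    obtain ⟨Q, hQ, hQe⟩ := exists_l2Proj_eq (memLp_val_face hd hT he) k (htrace e he).2.1
    refine ⟨Q, hQ, ?_⟩
    funext x
    simp [toWeakFn, projWeakFn, hQe]
  refine ⟨?_, ?_, ?_⟩
  · rw [hq1]
    exact huT.sub (memLp_val_elem hT P)
  · intro e he
    obtain ⟨Q, hQ, hQe⟩ := hface e he
    rw [hQe]
    exact (htrace e he).2.1.sub (memLp_val_face hd hT he Q)
  · intro p hp
    have hnn : 0 ≤ Metric.diam T ^ 2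
        * ∫ x in T, ∑ i, (g i x - Poly.val (MvPolynomial.pderiv i p) x) ^ 2 :=
      mul_nonneg (sq_nonneg _)
        (integral_nonneg fun x => Finset.sum_nonneg fun i _ => sq_nonneg _)
    refine ⟨?_, fun e he => ?_⟩
    · rw [hq1]
      exact (hP.integral_sub_sq_le (memLp_val_elem hT) huT hp).trans (le_add_of_nonneg_right hnn)
    · obtain ⟨Q, hQ, hQe⟩ := hface e he
      rw [hQe]
      refine (hQ.integral_sub_sq_le (memLp_val_face hd hT he) (htrace e he).2.1 hp).trans ?_
      obtain ⟨A, hA⟩ := hM.exists_isPyramidFace hd hΩ hT he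
      have hpm : ∀ p : Poly d, MemLp p.val 2 (volume.restrict Ω) := fun p =>
        memLp_polyVal_restrict p hΩm hΩb
      have h1 := htr Ω T e (M.normal T e) A _ _ hΩm hΩb (M.volume_frontier hT) hA
        (fun x => u x - p.val x) (fun i x => g i x - Poly.val (MvPolynomial.pderiv i p) x)
        (hug.sub p.hasWeakGrad_val (hu.integrable one_le_two) ((hpm p).integrable one_le_two)
          (fun i => (hg i).integrable one_le_two) (fun i => (hpm _).integrable one_le_two))
        (hu.sub (hpm p)) (fun i => (hg i).sub (hpm _))
      have h2 := hA.trace_sub (huT.integrable one_le_two) (htrace e he).1 p.continuous_val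
      have h3 : ∫ x in e, (trace T u x - p.val x) ^ 2 ∂(surfaceMeasure d)
          = ∫ x in e, trace T (fun y => u y - p.val y) x ^ 2 ∂(surfaceMeasure d) := by
        refine integral_congr_ae ?_
        filter_upwards [h2] with x hx
        rw [hx]
      rw [h3]
      refine h1.2.2.trans (le_of_eq ?_)
      rw [approxError, div_div]

/-- Powers of `h_T` for the squares: the volume term loses `h_T^(-2)` in the inverse estimate of the
gradient; a face term loses `h_T^(-1)` in the trace inequality and `h_T^(-1)` in the inverse
estimate on the face. The sum over the faces costs the square of their maximal number. -/
theorem exists_weakForm_sq_le (hd : 1 ≤ d) (hΩ : IsLipschitzDomain Ω) (k R : ℕ)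
    (c : RegularityConstants) :
    ∃ C : ℝ, 0 < C ∧ ∀ M : PolytopalMesh Ω, M.ShapeRegular c → ∀ T ∈ M.elems,
      ∀ (u : Space d → ℝ) (g : Fin d → Space d → ℝ), HasWeakGrad Ω u g →
      MemLp u 2 (volume.restrict Ω) → (∀ i, MemLp (g i) 2 (volume.restrict Ω)) →
      ∀ p : Poly d, p.totalDegree ≤ k → ∀ (j : Fin d) (w : Poly d), w.totalDegree ≤ R →
        M.weakForm T (toWeakFn T u - projWeakFn k T u) j w ^ 2
          ≤ C / Metric.diam T ^ 2 * approxError T u g p * ∫ x in T, w.val x ^ 2 := by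
  obtain ⟨C₁, hC₁, hproj⟩ := exists_projError_le hd hΩ k c
  obtain ⟨C₂, hC₂, hgrad⟩ := Poly.exists_gradSq_integral_le d R c.ρv_pos
  obtain ⟨C₃, hC₃, hface⟩ := Poly.exists_face_integral_sq_le hd R c.ρv_pos
  refine ⟨2 * C₂ + 2 * c.maxFaces ^ 2 * (C₁ * C₃), by positivity, ?_⟩
  intro M hM T hT u g hug hu hg p hp j w hw
  obtain ⟨hq1, hq2, hle⟩ := hproj M hM T hT u g hug hu hg
  obtain ⟨hle1, hle2⟩ := hle p hp
  set q := toWeakFn T u - projWeakFn k T u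
  set E := approxError T u g p
  set H := Metric.diam T
  set I := ∫ x in T, w.val x ^ 2
  have hH : 0 < H := diam_pos hd hT
  have hI : 0 ≤ I := integral_nonneg fun x => sq_nonneg _
  have hE : 0 ≤ E := (integral_nonneg fun x => sq_nonneg _).trans hle1
  obtain ⟨x₀, hx₀⟩ := (M.elem_polytope T hT).2
  have hTc := isCompact_elem hT
  have hTB : T ⊆ Metric.closedBall x₀ H := fun y hy =>
    Metric.mem_closedBall.2 (Metric.dist_le_diam_of_mem hTc.isBounded hy (_root_.interior_subset hx₀))
  have hvol : ENNReal.ofReal (c.ρv * H ^ d) ≤ volume T := by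
    rw [← ENNReal.ofReal_toReal hTc.measure_lt_top.ne]
    exact ENNReal.ofReal_le_ofReal (hM.volume_elem T hT)
  have ha : (∫ x in T, q.1 x * Poly.val (MvPolynomial.pderiv j w) x) ^ 2 ≤ E * (C₂ / H ^ 2 * I) := by
    refine (sq_integral_mul_le hq1 (memLp_val_elem hT _)).trans ?_
    exact mul_le_mul hle1 (hgrad T x₀ H hH hTc.measurableSet hTB hvol w hw j)
      (integral_nonneg fun x => sq_nonneg _) hE
  have hb : ∀ e ∈ M.facesOf T,
      (∫ x in e, q.2 e x * (w.val x * M.normal T e j) ∂(surfaceMeasure d)) ^ 2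
        ≤ C₁ / H * E * (C₃ / H * I) := by
    intro e he
    obtain ⟨c', hc'⟩ := M.exists_subset_hyperplane hT he
    have hn := (M.isOutwardNormal hT he).1
    have hnj : M.normal T e j ^ 2 ≤ 1 := by
      have h1 := PiLp.norm_apply_le (M.normal T e) j
      rw [hn, Real.norm_eq_abs] at h1
      rw [← sq_abs]
      exact pow_le_one₀ (abs_nonneg _) h1
    have hwm := memLp_val_face hd hT he w
    refine (sq_integral_mul_le (hq2 e he) (hwm.mul_const _)).trans ?_
    refine mul_le_mul (hle2 e he) ?_ (integral_nonneg fun x => sq_nonneg _) (by positivity)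
    simp_rw [mul_pow]
    rw [integral_mul_const]
    refine (mul_le_of_le_one_right (integral_nonneg fun x => sq_nonneg _) hnj).trans ?_
    exact hface T x₀ H hH hTc.measurableSet hTB hvol e _ c' (isCompact_face he).measurableSet
      (face_subset hT he) hc' hn w hw
  set a := ∫ x in T, q.1 x * Poly.val (MvPolynomial.pderiv j w) x
  set b : Set (Space d) → ℝ := fun e =>
    ∫ x in e, q.2 e x * (w.val x * M.normal T e j) ∂(surfaceMeasure d)
  have hsum : (∑ e ∈ M.facesOf T, b e) ^ 2 ≤ c.maxFaces ^ 2 * (C₁ / H * E * (C₃ / H * I)) := by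
    refine sq_sum_le_card_mul_sum_sq.trans ?_
    have h1 := Finset.sum_le_card_nsmul (M.facesOf T) (fun e => b e ^ 2) _ hb
    have h2 : ((M.facesOf T).card : ℝ) ≤ c.maxFaces := by exact_mod_cast hM.card_faces T hT
    rw [nsmul_eq_mul] at h1
    calc ((M.facesOf T).card : ℝ) * ∑ e ∈ M.facesOf T, b e ^ 2
        ≤ (M.facesOf T).card * ((M.facesOf T).card * (C₁ / H * E * (C₃ / H * I))) := by gcongr
      _ ≤ c.maxFaces * (c.maxFaces * (C₁ / H * E * (C₃ / H * I))) := by gcongr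
      _ = _ := by ring
  calc M.weakForm T q j w ^ 2 = (-a + ∑ e ∈ M.facesOf T, b e) ^ 2 := rfl
    _ ≤ 2 * a ^ 2 + 2 * (∑ e ∈ M.facesOf T, b e) ^ 2 := by
        nlinarith [sq_nonneg (a + ∑ e ∈ M.facesOf T, b e)]
    _ ≤ 2 * (E * (C₂ / H ^ 2 * I)) + 2 * (c.maxFaces ^ 2 * (C₁ / H * E * (C₃ / H * I))) := by
        gcongr
    _ = _ := by
        field_simp

end PolytopalMesh

/-! ### Approximation of Sobolev functions on the elements -/

/-- The sum of the squares of the weak derivatives of `u` of order at most `m`. -/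
def derivSq {d : ℕ} (m : ℕ) (Ω : Set (Space d)) (u : Space d → ℝ) (x : Space d) : ℝ :=
  ∑ α ∈ multiIndices d m, weakDeriv Ω α u x ^ 2

theorem derivSq_nonneg {d : ℕ} (m : ℕ) (Ω : Set (Space d)) (u : Space d → ℝ) (x : Space d) :
    0 ≤ derivSq m Ω u x := Finset.sum_nonneg fun _ _ => sq_nonneg _

theorem MemSobolev.integrableOn_derivSq {d m : ℕ} {Ω : Set (Space d)} {u : Space d → ℝ}
    (hu : MemSobolev m Ω u) : IntegrableOn (derivSq m Ω u) Ω :=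
  integrable_finsetSum _ fun α hα =>
    (hu.memLp_weakDeriv α (mem_multiIndices.1 hα)).integrable_sq

theorem MemSobolev.integral_derivSq {d m : ℕ} {Ω : Set (Space d)} {u : Space d → ℝ}
    (hu : MemSobolev m Ω u) : ∫ x in Ω, derivSq m Ω u x = sobolevNormSq m Ω u :=
  integral_finsetSum _ fun α hα =>
    (hu.memLp_weakDeriv α (mem_multiIndices.1 hα)).integrable_sq

theorem MemSobolev.integral_weakDeriv_sq_le {d m : ℕ} {Ω D : Set (Space d)} {u : Space d → ℝ}
    (hu : MemSobolev m Ω u) (hD : D ⊆ Ω) {α : Fin d → ℕ} (hα : ∑ i, α i ≤ m) :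
    ∫ x in D, weakDeriv Ω α u x ^ 2 ≤ ∫ x in D, derivSq m Ω u x := by
  refine integral_mono (((hu.memLp_weakDeriv α hα).mono_measure
    (Measure.restrict_mono hD le_rfl)).integrable_sq) (hu.integrableOn_derivSq.mono_set hD)
    fun x => ?_
  exact Finset.single_le_sum (f := fun α => weakDeriv Ω α u x ^ 2) (fun _ _ => sq_nonneg _)
    (mem_multiIndices.2 hα)

theorem MemSobolev.hasWeakGrad {d m : ℕ} {Ω : Set (Space d)} {u : Space d → ℝ} (hΩ : IsOpen Ω)
    (hΩb : Bornology.IsBounded Ω) (hu : MemSobolev (m + 1) Ω u) :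
    HasWeakGrad Ω u fun i => weakDeriv Ω (Pi.single i 1) u := by
  have h1 := hu.hasWeakGrad_weakDeriv 0 (by simp)
  simp only [zero_add] at h1
  exact h1.congr_ae (hu.weakDeriv_zero_ae_eq hΩ hΩb) fun i => EventuallyEq.rfl

namespace PolytopalMesh

variable {d : ℕ} {Ω : Set (Space d)}

/-- Only the Bramble–Hilbert estimates of orders zero and one are needed; the factor `h_T²` in
`approxError` brings both to the power `2k + 2`. -/
theorem exists_approxError_le_of_isStarNbhd (k : ℕ) {C : ℝ} (hC : 0 < C)
    (hΩ : IsLipschitzDomain Ω) :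
    ∃ C' : ℝ, 0 < C' ∧ ∀ (M : PolytopalMesh Ω), ∀ T ∈ M.elems, ∀ (D : Set (Space d))
      (a c : Space d), 0 < Metric.diam T → IsStarNbhd Ω D a c (Metric.diam T) C → interior T ⊆ D →
      ∀ u : Space d → ℝ, MemSobolev (k + 1) Ω u → ∃ p : Poly d, p.totalDegree ≤ k ∧
        approxError T u (fun i => weakDeriv Ω (Pi.single i 1) u) p
          ≤ C' * Metric.diam T ^ (2 * k + 2) * ∫ x in D, derivSq (k + 1) Ω u x := by
  obtain ⟨C', hC', hbh⟩ := exists_bramble_hilbert d k hC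
  refine ⟨C' ^ (k + 1) + d * C' ^ k, by positivity, ?_⟩
  intro M T hT D a c hH hD hTD u hu
  set H := Metric.diam T
  have hΩo := hΩ.1
  have hΩb : Bornology.IsBounded Ω := hΩ.2.2.1
  have hle : volume.restrict D ≤ volume.restrict Ω := Measure.restrict_mono hD.subset le_rfl
  have hpm : ∀ p : Poly d, MemLp p.val 2 (volume.restrict D) := fun p =>
    (memLp_polyVal_restrict p hΩo.measurableSet hΩb).mono_measure hle
  have hdeg : ∀ α : Fin d →₀ ℕ, ∑ i, α i = α.degree := fun α => (Finsupp.degree_eq_sum α).symm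
  have hgm : ∀ α : Fin d →₀ ℕ, α.degree ≤ k + 1 →
      MemLp (weakDeriv Ω (⇑α) u) 2 (volume.restrict Ω) := fun α hα =>
    hu.memLp_weakDeriv _ (by rwa [hdeg])
  obtain ⟨p, hp, hpe⟩ := hbh Ω D a c H hH hΩo hΩb hD (fun α => weakDeriv Ω (⇑α) u)
    (fun α hα => by
      have := hu.hasWeakGrad_weakDeriv (⇑α) (by rwa [hdeg])
      simpa only [Finsupp.coe_add, Finsupp.single_eq_pi_single] using this) hgm
  refine ⟨p, hp, ?_⟩
  set S := ∫ x in D, derivSq (k + 1) Ω u x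
  have hS0 : 0 ≤ S := integral_nonneg fun x => derivSq_nonneg _ _ _ x
  have hS : ∀ β : Fin d →₀ ℕ, β.degree = k + 1 → ∫ x in D, weakDeriv Ω (⇑β) u x ^ 2 ≤ S :=
    fun β hβ => hu.integral_weakDeriv_sq_le hD.subset (by rw [hdeg, hβ])
  have hTD' : T ≤ᵐ[volume] D :=
    (elem_ae_eq_interior hT).le.trans (Eventually.of_forall fun x hx => hTD hx)
  have h0 := hpe (k + 1) 0 S (by simp) hS0 hS
  rw [Poly.iterDeriv_zero] at h0
  have h1 : ∀ i, ∫ x in D, (weakDeriv Ω (Pi.single i 1) u x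
      - Poly.val (MvPolynomial.pderiv i p) x) ^ 2 ≤ (C' * H ^ 2) ^ k * S := by
    intro i
    have h := hpe k (Finsupp.single i 1) S (by simp [add_comm]) hS0 hS
    have e := Poly.pderiv_iterDeriv 0 i p
    rw [zero_add, Poly.iterDeriv_zero] at e
    rw [← e] at h
    simpa only [Finsupp.single_eq_pi_single] using h
  have hu0 : weakDeriv Ω 0 u =ᵐ[volume.restrict D] u :=
    (Measure.absolutelyContinuous_of_le hle).ae_eq (hu.weakDeriv_zero_ae_eq hΩo hΩb)
  have hm0 : MemLp u 2 (volume.restrict D) := hu.1.mono_measure hle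
  have hm1 : ∀ i : Fin d, MemLp (weakDeriv Ω (Pi.single i 1) u) 2 (volume.restrict D) := fun i =>
    (hu.memLp_weakDeriv _ (by simp)).mono_measure hle
  have hA : ∫ x in T, (u x - p.val x) ^ 2 ≤ (C' * H ^ 2) ^ (k + 1) * S := by
    refine (setIntegral_mono_set (hm0.sub (hpm p)).integrable_sq
      (Eventually.of_forall fun x => sq_nonneg _) hTD').trans (le_trans (le_of_eq ?_) h0)
    refine integral_congr_ae ?_
    filter_upwards [hu0] with x hx
    simp [hx]
  have hB : ∫ x in T, ∑ i, (weakDeriv Ω (Pi.single i 1) u x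
      - Poly.val (MvPolynomial.pderiv i p) x) ^ 2 ≤ d * ((C' * H ^ 2) ^ k * S) := by
    have hi : ∀ i ∈ (Finset.univ : Finset (Fin d)), Integrable (fun x =>
        (weakDeriv Ω (Pi.single i 1) u x - Poly.val (MvPolynomial.pderiv i p) x) ^ 2)
        (volume.restrict D) := fun i _ => ((hm1 i).sub (hpm _)).integrable_sq
    refine (setIntegral_mono_set (integrable_finsetSum _ hi)
      (Eventually.of_forall fun x => Finset.sum_nonneg fun i _ => sq_nonneg _) hTD').trans ?_
    rw [integral_finsetSum _ hi]
    refine (Finset.sum_le_sum fun i _ => h1 i).trans (le_of_eq ?_)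
    simp
  calc approxError T u (fun i => weakDeriv Ω (Pi.single i 1) u) p
      ≤ (C' * H ^ 2) ^ (k + 1) * S + H ^ 2 * (d * ((C' * H ^ 2) ^ k * S)) := by
        unfold approxError
        gcongr
    _ = _ := by ring

/-- For elements too large for a star-shaped neighbourhood, where the zero polynomial is used. -/
theorem approxError_zero_le (hΩ : IsLipschitzDomain Ω) (k : ℕ) (M : PolytopalMesh Ω)
    {T : Set (Space d)} (hT : T ∈ M.elems) {u : Space d → ℝ} (hu : MemSobolev (k + 1) Ω u) :
    approxError T u (fun i => weakDeriv Ω (Pi.single i 1) u) 0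
      ≤ (1 + d * Metric.diam T ^ 2) * ∫ x in interior T, derivSq (k + 1) Ω u x := by
  have hTΩ := M.interior_subset hΩ hT
  have hle : volume.restrict (interior T) ≤ volume.restrict Ω := Measure.restrict_mono hTΩ le_rfl
  have hu0 : weakDeriv Ω 0 u =ᵐ[volume.restrict (interior T)] u :=
    (Measure.absolutelyContinuous_of_le hle).ae_eq (hu.weakDeriv_zero_ae_eq hΩ.1 hΩ.2.2.1)
  unfold approxError
  simp only [map_zero, Poly.val_zero, sub_zero]
  rw [Measure.restrict_congr_set (elem_ae_eq_interior hT)]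
  have h0 := hu.integral_weakDeriv_sq_le hTΩ (α := 0) (by simp)
  have e0 : ∫ x in interior T, weakDeriv Ω 0 u x ^ 2 = ∫ x in interior T, u x ^ 2 := by
    refine integral_congr_ae ?_
    filter_upwards [hu0] with x hx
    rw [hx]
  rw [integral_finsetSum _ fun i _ =>
    ((hu.memLp_weakDeriv (Pi.single i 1) (by simp)).mono_measure hle).integrable_sq]
  have h1 := Finset.sum_le_sum fun (i : Fin d) (_ : i ∈ Finset.univ) =>
    hu.integral_weakDeriv_sq_le hTΩ (α := Pi.single i 1) (by simp)
  rw [Finset.sum_const, Finset.card_univ, Fintype.card_fin, nsmul_eq_mul] at h1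
  rw [e0] at h0
  calc _ ≤ (∫ x in interior T, derivSq (k + 1) Ω u x)
        + Metric.diam T ^ 2 * (d * ∫ x in interior T, derivSq (k + 1) Ω u x) := by gcongr
    _ = _ := by ring

/-- For `h_T ≤ h₀` the star-shaped neighbourhood is used. For `h_T > h₀` powers of `h_T / h₀ ≥ 1`
may be inserted freely, so `p = 0` and `D` the interior of `T` give a bound of the same form. -/
theorem exists_approxError_le (hd : 1 ≤ d) (hΩ : IsLipschitzDomain Ω) (k : ℕ) :
    ∃ C₁ C : ℝ, 0 < C₁ ∧ 0 < C ∧ ∀ (M : PolytopalMesh Ω), ∀ T ∈ M.elems,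
      ∃ (a : Space d) (D : Set (Space d)), T ⊆ Metric.closedBall a (Metric.diam T) ∧
        MeasurableSet D ∧ D ⊆ Ω ∧ D ⊆ Metric.closedBall a (C₁ * Metric.diam T) ∧
        ∀ u : Space d → ℝ, MemSobolev (k + 1) Ω u → ∃ p : Poly d, p.totalDegree ≤ k ∧
          approxError T u (fun i => weakDeriv Ω (Pi.single i 1) u) p / Metric.diam T ^ 2
            ≤ C * Metric.diam T ^ (2 * k) * ∫ x in D, derivSq (k + 1) Ω u x := by
  obtain ⟨h₀, C₁, hh₀, hC₁, hstar⟩ := hΩ.exists_isStarNbhd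
  obtain ⟨C₂, hC₂, happ⟩ := exists_approxError_le_of_isStarNbhd k hC₁ hΩ
  refine ⟨C₁ + 1, C₂ + (1 / h₀ ^ 2 + d) / h₀ ^ (2 * k), by positivity, by positivity, ?_⟩
  intro M T hT
  have hH := diam_pos hd hT
  obtain ⟨a, ha⟩ := (M.elem_polytope T hT).2
  have hTB : T ⊆ Metric.closedBall a (Metric.diam T) := fun y hy =>
    Metric.mem_closedBall.2 (Metric.dist_le_diam_of_mem (isCompact_elem hT).isBounded hy
      (_root_.interior_subset ha))
  have hTΩ := M.interior_subset hΩ hT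
  set H := Metric.diam T
  have hpos : 0 ≤ (1 / h₀ ^ 2 + d) / h₀ ^ (2 * k) := by positivity
  by_cases hle : H ≤ h₀
  · obtain ⟨D, c, hD⟩ := hstar a (hTΩ ha) H hH hle
    refine ⟨a, D, hTB, hD.isOpen.measurableSet, hD.subset, ?_, fun u hu => ?_⟩
    · refine hD.subset_ball.trans (Metric.ball_subset_closedBall.trans ?_)
      exact Metric.closedBall_subset_closedBall (by nlinarith)
    · obtain ⟨p, hp, hpe⟩ := happ M T hT D a c hH hD
        (fun x hx => hD.inter_subset ⟨hTΩ hx, hTB (_root_.interior_subset hx)⟩) u hu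
      refine ⟨p, hp, ?_⟩
      have hS : 0 ≤ ∫ x in D, derivSq (k + 1) Ω u x :=
        integral_nonneg fun x => derivSq_nonneg _ _ _ x
      rw [div_le_iff₀ (by positivity)]
      refine hpe.trans ?_
      calc C₂ * H ^ (2 * k + 2) * ∫ x in D, derivSq (k + 1) Ω u x
          = C₂ * H ^ (2 * k) * (∫ x in D, derivSq (k + 1) Ω u x) * H ^ 2 := by ring
        _ ≤ _ := by
          gcongr
          exact le_add_of_nonneg_right hpos
  · have hle := (not_le.1 hle).le
    refine ⟨a, interior T, hTB, isOpen_interior.measurableSet, hTΩ, ?_, fun u hu =>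
      ⟨0, by simp, ?_⟩⟩
    · refine (_root_.interior_subset.trans hTB).trans ?_
      exact Metric.closedBall_subset_closedBall (by nlinarith)
    · have hS : 0 ≤ ∫ x in interior T, derivSq (k + 1) Ω u x :=
        integral_nonneg fun x => derivSq_nonneg _ _ _ x
      rw [div_le_iff₀ (by positivity)]
      refine (approxError_zero_le hΩ k M hT hu).trans ?_
      have h1 : (1 : ℝ) + d * H ^ 2 ≤ (1 / h₀ ^ 2 + d) * H ^ 2 := by
        have : 1 ≤ 1 / h₀ ^ 2 * H ^ 2 := by
          rw [one_div, inv_mul_eq_div, one_le_div (by positivity)]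
          gcongr
        linarith
      have h2 : 1 ≤ H ^ (2 * k) / h₀ ^ (2 * k) := by
        rw [one_le_div (by positivity)]
        gcongr
      calc (1 + d * H ^ 2) * ∫ x in interior T, derivSq (k + 1) Ω u x
          ≤ (1 / h₀ ^ 2 + d) * H ^ 2 * ∫ x in interior T, derivSq (k + 1) Ω u x := by gcongr
        _ ≤ (1 / h₀ ^ 2 + d) * H ^ 2 * (∫ x in interior T, derivSq (k + 1) Ω u x)
            * (H ^ (2 * k) / h₀ ^ (2 * k)) := le_mul_of_one_le_right (by positivity) h2
        _ = (1 / h₀ ^ 2 + d) / h₀ ^ (2 * k) * H ^ (2 * k)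
            * (∫ x in interior T, derivSq (k + 1) Ω u x) * H ^ 2 := by ring
        _ ≤ _ := by
          gcongr
          exact le_add_of_nonneg_left hC₂.le

/-! ### Summation over the elements. -/

theorem diam_le_meshSize (M : PolytopalMesh Ω) {T : Set (Space d)} (hT : T ∈ M.elems) :
    Metric.diam T ≤ M.meshSize :=
  le_ciSup (f := fun T : M.elems => Metric.diam (T : Set (Space d)))
    (Set.finite_range _).bddAbove ⟨T, hT⟩

theorem meshSize_nonneg (M : PolytopalMesh Ω) : 0 ≤ M.meshSize :=
  Real.iSup_nonneg fun _ => Metric.diam_nonneg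

/-- The weighted sum of indicators `∑ h_T^(2k) 1_{D_T}` is bounded pointwise by `N h^(2k)`, by
applying `exists_sum_radii_le` to the disjoint interiors of the elements; the number of overlapping
`D_T` itself is not estimated. -/
theorem exists_sum_integral_le (hd : 1 ≤ d) {k : ℕ} (hk : 1 ≤ k) (c : RegularityConstants)
    {C₁ : ℝ} (hC₁ : 0 < C₁) :
    ∃ N : ℝ, 0 < N ∧ ∀ M : PolytopalMesh Ω, M.ShapeRegular c →
      ∀ (a : Set (Space d) → Space d) (D : Set (Space d) → Set (Space d)),
      (∀ T ∈ M.elems, T ⊆ Metric.closedBall (a T) (Metric.diam T)) →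
      (∀ T ∈ M.elems, MeasurableSet (D T)) → (∀ T ∈ M.elems, D T ⊆ Ω) →
      (∀ T ∈ M.elems, D T ⊆ Metric.closedBall (a T) (C₁ * Metric.diam T)) →
      ∀ f : Space d → ℝ, MeasurableSet Ω → IntegrableOn f Ω → (∀ x, 0 ≤ f x) →
        ∑ T ∈ M.elems, Metric.diam T ^ (2 * k) * ∫ x in D T, f x
          ≤ N * M.meshSize ^ (2 * k) * ∫ x in Ω, f x := by
  classical
  obtain ⟨N, hN, hsum⟩ := exists_sum_radii_le d c.ρv_pos hC₁
  refine ⟨N, hN, ?_⟩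
  intro M hM a D hT hDm hDΩ hDB f hΩ hf hf0
  set h := M.meshSize
  have hh := M.meshSize_nonneg
  have hpt : ∀ x, ∑ T ∈ M.elems, Metric.diam T ^ (2 * k) * (D T).indicator 1 x
      ≤ N * h ^ (2 * k) := by
    intro x
    have h1 := hsum (M.elems.filter fun T => x ∈ D T) (fun T => interior T) a Metric.diam x h
      (fun T hTx => ⟨diam_pos hd (Finset.mem_filter.1 hTx).1,
        M.diam_le_meshSize (Finset.mem_filter.1 hTx).1⟩) hh
      (fun T _ => isOpen_interior.measurableSet)
      (fun T hTx T' hTx' hne => M.elem_disjoint T (Finset.mem_filter.1 hTx).1 T'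
        (Finset.mem_filter.1 hTx').1 hne)
      (fun T hTx => _root_.interior_subset.trans (hT T (Finset.mem_filter.1 hTx).1))
      (fun T hTx => by
        rw [measureReal_def, ← measure_congr (elem_ae_eq_interior (Finset.mem_filter.1 hTx).1)]
        exact hM.volume_elem T (Finset.mem_filter.1 hTx).1)
      (fun T hTx => Metric.mem_closedBall.1
        (hDB T (Finset.mem_filter.1 hTx).1 (Finset.mem_filter.1 hTx).2))
    have h2 : ∀ T ∈ M.elems, Metric.diam T ^ (2 * k) * (D T).indicator (1 : Space d → ℝ) x
        ≤ h ^ (2 * k - 1) * if x ∈ D T then Metric.diam T else 0 := by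
      intro T hTe
      by_cases hx : x ∈ D T
      · rw [Set.indicator_of_mem hx, if_pos hx, Pi.one_apply, mul_one]
        -- As `k ≥ 1`, one factor `h_T` can be kept for the overlap bound while the others are
        -- replaced by `h`.
        have e : 2 * k = 2 * k - 1 + 1 := by omega
        conv_lhs => rw [e, pow_succ]
        have := M.diam_le_meshSize hTe
        gcongr
      · rw [Set.indicator_of_notMem hx, if_neg hx, mul_zero, mul_zero]
    refine (Finset.sum_le_sum h2).trans ?_
    rw [← Finset.mul_sum, ← Finset.sum_filter]
    calc h ^ (2 * k - 1) * ∑ T ∈ M.elems with x ∈ D T, Metric.diam T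
        ≤ h ^ (2 * k - 1) * (N * h) := by gcongr
      _ = N * (h ^ (2 * k - 1) * h) := by ring
      _ = N * h ^ (2 * k) := by
        rw [← pow_succ]
        congr 2
        omega
  have hint : ∀ T ∈ M.elems, IntegrableOn
      (fun x => Metric.diam T ^ (2 * k) * (D T).indicator f x) Ω := fun T hTe =>
    (hf.indicator (hDm T hTe)).const_mul _
  calc ∑ T ∈ M.elems, Metric.diam T ^ (2 * k) * ∫ x in D T, f x
      = ∑ T ∈ M.elems, ∫ x in Ω, Metric.diam T ^ (2 * k) * (D T).indicator f x := by
        refine Finset.sum_congr rfl fun T hTe => ?_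
        rw [integral_const_mul, setIntegral_indicator (hDm T hTe),
          Set.inter_eq_right.2 (hDΩ T hTe)]
    _ = ∫ x in Ω, ∑ T ∈ M.elems, Metric.diam T ^ (2 * k) * (D T).indicator f x :=
        (integral_finsetSum _ hint).symm
    _ ≤ ∫ x in Ω, N * h ^ (2 * k) * f x := by
        refine integral_mono (integrable_finsetSum _ hint) (hf.const_mul _) fun x => ?_
        have e : ∀ T, Metric.diam T ^ (2 * k) * (D T).indicator f x
            = Metric.diam T ^ (2 * k) * (D T).indicator 1 x * f x := by
          intro T
          by_cases hx : x ∈ D T <;> simp [hx]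
        simp only [e]
        rw [← Finset.sum_mul]
        exact mul_le_mul_of_nonneg_right (hpt x) (hf0 x)
    _ = _ := integral_const_mul _ _

/-- The functionals that define the discrete weak derivatives of `u - Q_h u` are bounded on the
elements by constants of order `h^k` in the square mean. -/
theorem exists_weakForm_bound (hd : 1 ≤ d) (hΩ : IsLipschitzDomain Ω) {k : ℕ} (hk : 1 ≤ k) (R : ℕ)
    (c : RegularityConstants) :
    ∃ C : ℝ, 0 < C ∧ ∀ M : PolytopalMesh Ω, M.ShapeRegular c →
      ∀ u : Space d → ℝ, MemSobolev (k + 1) Ω u → ∃ ε : Set (Space d) → ℝ,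
        (∀ T ∈ M.elems, 0 ≤ ε T ∧ ∀ (j : Fin d) (w : Poly d), w.totalDegree ≤ R →
          M.weakForm T (toWeakFn T u - projWeakFn k T u) j w ^ 2
            ≤ ε T * ∫ x in T, w.val x ^ 2) ∧
        ∑ T ∈ M.elems, ε T ≤ C * M.meshSize ^ (2 * k) * sobolevNormSq (k + 1) Ω u := by
  obtain ⟨C₁, C₂, hC₁, hC₂, happ⟩ := exists_approxError_le hd hΩ k
  obtain ⟨C₃, hC₃, hform⟩ := exists_weakForm_sq_le hd hΩ k R c
  obtain ⟨N, hN, hsum⟩ := exists_sum_integral_le (Ω := Ω) hd hk c hC₁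
  refine ⟨C₃ * C₂ * N, by positivity, ?_⟩
  intro M hM u hu
  choose! a D hTB hDm hDΩ hDB hp using happ M
  refine ⟨fun T => C₃ * (C₂ * (Metric.diam T ^ (2 * k) * ∫ x in D T, derivSq (k + 1) Ω u x)),
    fun T hT => ⟨?_, fun j w hw => ?_⟩, ?_⟩
  · have : 0 ≤ ∫ x in D T, derivSq (k + 1) Ω u x := integral_nonneg fun x => derivSq_nonneg _ _ _ x
    have := Metric.diam_nonneg (s := T)
    positivity
  · obtain ⟨p, hpd, hpe⟩ := hp T hT u hu
    refine (hform M hM T hT u _ (hu.hasWeakGrad hΩ.1 hΩ.2.2.1) hu.1 (fun i => hu.memLp_weakDeriv _ (by simp)) p hpd j w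
      hw).trans ?_
    refine mul_le_mul_of_nonneg_right ?_ (integral_nonneg fun x => sq_nonneg _)
    rw [div_mul_eq_mul_div, mul_div_assoc]
    exact mul_le_mul_of_nonneg_left (hpe.trans_eq (mul_assoc _ _ _)) hC₃.le
  · have h1 := hsum M hM a D hTB hDm hDΩ hDB _ hΩ.1.measurableSet hu.integrableOn_derivSq
      (derivSq_nonneg _ _ _)
    rw [hu.integral_derivSq] at h1
    simp only [← mul_assoc C₃, ← Finset.mul_sum]
    calc _ ≤ C₃ * C₂ * (N * M.meshSize ^ (2 * k) * sobolevNormSq (k + 1) Ω u) := by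
          gcongr
      _ = _ := by ring

end PolytopalMesh

/-! ### Bounds of the discrete weak derivatives -/

theorem sum_apply_single {ι M N : Type*} [Fintype ι] [DecidableEq ι] [Zero M] [AddCommMonoid N]
    (F : ι → M → N) (hF : ∀ i, F i 0 = 0) (j : ι) (w : M) :
    ∑ i, F i ((Pi.single j w : ι → M) i) = F j w := by
  rw [Finset.sum_eq_single j]
  · rw [Pi.single_eq_same]
  · intro i _ hij
    rw [Pi.single_eq_of_ne hij, hF]
  · intro h
    exact absurd (Finset.mem_univ j) h

theorem le_of_sq_le_mul {a ε : ℝ} (ha : 0 ≤ a) (hε : 0 ≤ ε) (h : a ^ 2 ≤ ε * a) : a ≤ ε := by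
  rcases ha.eq_or_lt with h0 | h0
  · rwa [← h0]
  · nlinarith

theorem sqrt_mul_pow_mul_sqrt {A h : ℝ} (hA : 0 ≤ A) (hh : 0 ≤ h) (k : ℕ) (S : ℝ) :
    √A * h ^ k * √S = √(A * h ^ (2 * k) * S) := by
  rw [Real.sqrt_mul (mul_nonneg hA (pow_nonneg hh _)), Real.sqrt_mul hA, mul_comm 2 k, pow_mul,
    Real.sqrt_sq (pow_nonneg hh _)]

namespace PolytopalMesh

variable {d : ℕ} {Ω : Set (Space d)} {M : PolytopalMesh Ω}

theorem totalDegree_single_le {r : ℕ} {w : Poly d} (hw : w.totalDegree ≤ r) (j l : Fin d) :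
    ((Pi.single j w : Fin d → Poly d) l).totalDegree ≤ r := by
  by_cases h : l = j
  · subst h
    rwa [Pi.single_eq_same]
  · rw [Pi.single_eq_of_ne h]
    simp

/-- A test field with a single nonzero entry isolates one component of the gradient. -/
theorem IsWeakGrad.integral_eq {r : ℕ} {T : Set (Space d)} {q : WeakFn d} {G : Fin d → Poly d}
    (hG : M.IsWeakGrad r T q G) (j : Fin d) {w : Poly d} (hw : w.totalDegree ≤ r) :
    ∫ x in T, (G j).val x * w.val x = M.weakForm T q j w := by
  have h := hG.2 (Pi.single j w) (totalDegree_single_le hw j)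
  have e1 : ∀ x, ∑ l, (G l).val x * Poly.val ((Pi.single j w : Fin d → Poly d) l) x
      = (G j).val x * w.val x := fun x =>
    sum_apply_single (fun l p => (G l).val x * Poly.val p x) (by simp [Poly.val_zero]) j w
  have e2 : ∀ x, ∑ l, Poly.val (MvPolynomial.pderiv l ((Pi.single j w : Fin d → Poly d) l)) x
      = Poly.val (MvPolynomial.pderiv j w) x := fun x =>
    sum_apply_single (fun l p => Poly.val (MvPolynomial.pderiv l p) x)
      (by simp [Poly.val_zero]) j w
  have e3 : ∀ e x, ∑ l, Poly.val ((Pi.single j w : Fin d → Poly d) l) x * M.normal T e l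
      = w.val x * M.normal T e j := fun e x =>
    sum_apply_single (fun l p => Poly.val p x * M.normal T e l) (by simp [Poly.val_zero]) j w
  simp only [e1, e2, e3] at h
  exact h

theorem IsWeakGradVec.integral_eq {r : ℕ} {T : Set (Space d)} {v : Fin d → WeakFn d}
    {G : Fin d → Fin d → Poly d} (hG : M.IsWeakGradVec r T v G) (i j : Fin d) {w : Poly d}
    (hw : w.totalDegree ≤ r) :
    ∫ x in T, (G i j).val x * w.val x = M.weakForm T (v i) j w := by
  have h := hG.2 (Pi.single i (Pi.single j w)) (fun l m => by
    by_cases hl : l = i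
    · subst hl
      rw [Pi.single_eq_same]
      exact totalDegree_single_le hw j m
    · rw [Pi.single_eq_of_ne hl]
      simp)
  have e1 : ∀ x, ∑ l, ∑ m, (G l m).val x
      * Poly.val ((Pi.single i (Pi.single j w) : Fin d → Fin d → Poly d) l m) x
      = (G i j).val x * w.val x := fun x => by
    rw [sum_apply_single (fun l (p : Fin d → Poly d) => ∑ m, (G l m).val x * Poly.val (p m) x)
      (by simp [Poly.val_zero]) i (Pi.single j w)]
    exact sum_apply_single (fun m p => (G i m).val x * Poly.val p x) (by simp [Poly.val_zero]) j w
  have e2 : ∀ x, ∑ l, (v l).1 x * ∑ m, Poly.val (MvPolynomial.pderiv m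
      ((Pi.single i (Pi.single j w) : Fin d → Fin d → Poly d) l m)) x
      = (v i).1 x * Poly.val (MvPolynomial.pderiv j w) x := fun x => by
    rw [sum_apply_single (fun l (p : Fin d → Poly d) =>
      (v l).1 x * ∑ m, Poly.val (MvPolynomial.pderiv m (p m)) x)
      (by simp [Poly.val_zero]) i (Pi.single j w)]
    rw [sum_apply_single (fun m p => Poly.val (MvPolynomial.pderiv m p) x)
      (by simp [Poly.val_zero]) j w]
  have e3 : ∀ e x, ∑ l, (v l).2 e x * ∑ m,
      Poly.val ((Pi.single i (Pi.single j w) : Fin d → Fin d → Poly d) l m) x * M.normal T e m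
      = (v i).2 e x * (w.val x * M.normal T e j) := fun e x => by
    rw [sum_apply_single (fun l (p : Fin d → Poly d) =>
      (v l).2 e x * ∑ m, Poly.val (p m) x * M.normal T e m)
      (by simp [Poly.val_zero]) i (Pi.single j w)]
    rw [sum_apply_single (fun m p => Poly.val p x * M.normal T e m)
      (by simp [Poly.val_zero]) j w]
  simp only [e1, e2, e3] at h
  exact h

/-- Here the integral of a sum over the components of `v` has to be split, which requires square
integrability of each component and of its boundary values. -/
theorem IsWeakDiv.integral_eq (hd : 1 ≤ d) {r : ℕ} {T : Set (Space d)} (hT : T ∈ M.elems)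
    {v : Fin d → WeakFn d} {D : Poly d} (hD : M.IsWeakDiv r T v D)
    (h1 : ∀ i, MemLp (v i).1 2 (volume.restrict T))
    (h2 : ∀ i, ∀ e ∈ M.facesOf T, MemLp ((v i).2 e) 2 ((surfaceMeasure d).restrict e)) {w : Poly d}
    (hw : w.totalDegree ≤ r) :
    ∫ x in T, D.val x * w.val x = ∑ i, M.weakForm T (v i) i w := by
  rw [hD.2 w hw]
  unfold weakForm
  have i1 : ∀ i ∈ (Finset.univ : Finset (Fin d)), Integrable
      (fun x => (v i).1 x * Poly.val (MvPolynomial.pderiv i w) x) (volume.restrict T) :=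
    fun i _ => (h1 i).integrable_mul (memLp_val_elem hT _)
  rw [Finset.sum_add_distrib, Finset.sum_neg_distrib, Finset.sum_comm, integral_finsetSum _ i1]
  congr 1
  refine Finset.sum_congr rfl fun e he => ?_
  have i2 : ∀ i ∈ (Finset.univ : Finset (Fin d)), Integrable
      (fun x => (v i).2 e x * (w.val x * M.normal T e i)) ((surfaceMeasure d).restrict e) :=
    fun i _ => (h2 i e he).integrable_mul ((memLp_val_face hd hT he w).mul_const _)
  rw [← integral_finsetSum _ i2]
  refine integral_congr_ae (Eventually.of_forall fun x => ?_)
  simp only [Finset.sum_mul]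
  exact Finset.sum_congr rfl fun i _ => by ring

/-- Testing with the component `G j` itself gives `a² ≤ ε a` for its squared norm `a`. -/
theorem integral_weakGrad_sq_le {r R : ℕ} (hr : r ≤ R) {T : Set (Space d)} {q : WeakFn d} {ε : ℝ}
    (hε : 0 ≤ ε) (h : ∀ (j : Fin d) (w : Poly d), w.totalDegree ≤ R →
      M.weakForm T q j w ^ 2 ≤ ε * ∫ x in T, w.val x ^ 2) (j : Fin d) :
    ∫ x in T, (M.weakGrad r T q j).val x ^ 2 ≤ ε := by
  unfold weakGrad
  split_ifs with hG
  · have hs := hG.choose_spec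
    have h1 := hs.integral_eq j (hs.1 j)
    have h2 := h j _ ((hs.1 j).trans hr)
    simp only [← sq] at h1
    rw [← h1] at h2
    exact le_of_sq_le_mul (integral_nonneg fun x => sq_nonneg _) hε h2
  -- The default value of `weakGrad` is zero.
  · simpa [Poly.val_zero] using hε

theorem integral_weakGradVec_sq_le {r R : ℕ} (hr : r ≤ R) {T : Set (Space d)}
    {v : Fin d → WeakFn d} {ε : ℝ} (hε : 0 ≤ ε) {i : Fin d}
    (h : ∀ (j : Fin d) (w : Poly d), w.totalDegree ≤ R →
      M.weakForm T (v i) j w ^ 2 ≤ ε * ∫ x in T, w.val x ^ 2) (j : Fin d) :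
    ∫ x in T, (M.weakGradVec r T v i j).val x ^ 2 ≤ ε := by
  unfold weakGradVec
  split_ifs with hG
  · have hs := hG.choose_spec
    have h1 := hs.integral_eq i j (hs.1 i j)
    have h2 := h j _ ((hs.1 i j).trans hr)
    simp only [← sq] at h1
    rw [← h1] at h2
    exact le_of_sq_le_mul (integral_nonneg fun x => sq_nonneg _) hε h2
  · simpa [Poly.val_zero] using hε

theorem integral_weakDiv_sq_le (hd : 1 ≤ d) {r R : ℕ} (hr : r ≤ R) {T : Set (Space d)}
    (hT : T ∈ M.elems) {v : Fin d → WeakFn d} (h1 : ∀ i, MemLp (v i).1 2 (volume.restrict T))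
    (h2 : ∀ i, ∀ e ∈ M.facesOf T, MemLp ((v i).2 e) 2 ((surfaceMeasure d).restrict e))
    {ε : Fin d → ℝ} (hε : ∀ i, 0 ≤ ε i) (h : ∀ (i j : Fin d) (w : Poly d), w.totalDegree ≤ R →
      M.weakForm T (v i) j w ^ 2 ≤ ε i * ∫ x in T, w.val x ^ 2) :
    ∫ x in T, (M.weakDiv r T v).val x ^ 2 ≤ d * ∑ i, ε i := by
  have hε' : 0 ≤ d * ∑ i, ε i := mul_nonneg d.cast_nonneg (Finset.sum_nonneg fun i _ => hε i)
  unfold weakDiv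
  split_ifs with hD
  · have hs := hD.choose_spec
    have h3 := hs.integral_eq hd hT h1 h2 hs.1
    simp only [← sq] at h3
    refine le_of_sq_le_mul (integral_nonneg fun x => sq_nonneg _) hε' ?_
    conv_lhs => rw [h3]
    refine sq_sum_le_card_mul_sum_sq.trans ?_
    rw [Finset.card_univ, Fintype.card_fin, mul_assoc, Finset.sum_mul]
    exact mul_le_mul_of_nonneg_left
      (Finset.sum_le_sum fun i _ => h i i _ (hs.1.trans hr)) d.cast_nonneg
  · simpa [Poly.val_zero] using hε'

/-- One degree for all elements makes the constants of the inverse estimates independent of the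
mesh. -/
theorem ShapeRegular.weakDegree_le {c : RegularityConstants} (hM : M.ShapeRegular c) (k : ℕ)
    {T : Set (Space d)} (hT : T ∈ M.elems) : M.weakDegree k T ≤ k - 1 + 2 * c.maxFaces := by
  have := hM.card_faces T hT
  unfold weakDegree
  split_ifs <;> omega

theorem integral_weakStrain_sq_le {r : ℕ} {T : Set (Space d)} (hT : T ∈ M.elems)
    {v : Fin d → WeakFn d} {ε : Fin d → ℝ}
    (h : ∀ i j, ∫ x in T, (M.weakGradVec r T v i j).val x ^ 2 ≤ ε i) :
    ∫ x in T, ∑ i, ∑ j, M.weakStrain r T v i j x ^ 2 ≤ d * ∑ i, ε i := by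
  set G := M.weakGradVec r T v
  have hint : ∀ i j, Integrable (fun x => (G i j).val x ^ 2) (volume.restrict T) := fun i j =>
    (memLp_val_elem hT _).integrable_sq
  have hint' : ∀ i, Integrable (fun x => ∑ j, (G i j).val x ^ 2) (volume.restrict T) := fun i =>
    integrable_finsetSum _ fun j _ => hint i j
  calc ∫ x in T, ∑ i, ∑ j, M.weakStrain r T v i j x ^ 2
      ≤ ∫ x in T, ∑ i, ∑ j, (G i j).val x ^ 2 := by
        refine integral_mono_of_nonneg (Eventually.of_forall fun x => Finset.sum_nonneg fun i _ =>
          Finset.sum_nonneg fun j _ => sq_nonneg _) (integrable_finsetSum _ fun i _ => hint' i)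
          (Eventually.of_forall fun x => ?_)
        have e : ∑ i, ∑ j, (G i j).val x ^ 2
            = ∑ i, ∑ j, ((G i j).val x ^ 2 + (G j i).val x ^ 2) / 2 := by
          simp only [← Finset.sum_div, Finset.sum_add_distrib]
          rw [Finset.sum_comm (f := fun i j => (G j i).val x ^ 2)]
          ring
        simp only [e]
        refine Finset.sum_le_sum fun i _ => Finset.sum_le_sum fun j _ => ?_
        simp only [weakStrain]
        nlinarith [sq_nonneg ((G i j).val x - (G j i).val x)]
    _ = ∑ i, ∑ j, ∫ x in T, (G i j).val x ^ 2 := by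
        rw [integral_finsetSum _ fun i _ => hint' i]
        exact Finset.sum_congr rfl fun i _ => integral_finsetSum _ fun j _ => hint i j
    _ ≤ ∑ i, ∑ _j : Fin d, ε i :=
        Finset.sum_le_sum fun i _ => Finset.sum_le_sum fun j _ => h i j
    _ = d * ∑ i, ε i := by simp [Finset.mul_sum]

theorem integral_quadForm_le (hΩ : IsLipschitzDomain Ω) {T : Set (Space d)} (hT : T ∈ M.elems)
    {K : Space d → Matrix (Fin d) (Fin d) ℝ} {B : ℝ} (hB : 0 ≤ B)
    (hKb : ∀ x ∈ Ω, ∀ i j, |K x i j| ≤ B) {G : Fin d → Poly d} {ε : ℝ} (hε : 0 ≤ ε)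
    (h : ∀ j, ∫ x in T, (G j).val x ^ 2 ≤ ε) :
    ∫ x in T, ∑ i, ∑ j, K x i j * (G j).val x * (G i).val x ≤ B * d ^ 2 * ε := by
  by_cases hi : Integrable (fun x => ∑ i, ∑ j, K x i j * (G j).val x * (G i).val x)
    (volume.restrict T)
  swap
  -- If the integrand is not integrable, its integral is zero by convention.
  · rw [integral_undef hi]
    positivity
  have hint : ∀ j, Integrable (fun x => (G j).val x ^ 2) (volume.restrict T) := fun j =>
    (memLp_val_elem hT _).integrable_sq
  have hTΩ : ∀ᵐ x ∂(volume.restrict T), x ∈ Ω := by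
    rw [Measure.restrict_congr_set (elem_ae_eq_interior hT)]
    filter_upwards [ae_restrict_mem isOpen_interior.measurableSet] with x hx
    exact M.interior_subset hΩ hT hx
  calc ∫ x in T, ∑ i, ∑ j, K x i j * (G j).val x * (G i).val x
      ≤ ∫ x in T, B * d * ∑ i, (G i).val x ^ 2 := by
        refine integral_mono_ae hi ((integrable_finsetSum _ fun i _ => hint i).const_mul _) ?_
        filter_upwards [hTΩ] with x hx
        have e : B * d * ∑ i, (G i).val x ^ 2
            = ∑ i, ∑ j, B * (((G j).val x ^ 2 + (G i).val x ^ 2) / 2) := by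
          simp only [← Finset.mul_sum, ← Finset.sum_div, Finset.sum_add_distrib, Finset.sum_const,
            Finset.card_univ, Fintype.card_fin, nsmul_eq_mul]
          ring
        rw [e]
        refine Finset.sum_le_sum fun i _ => Finset.sum_le_sum fun j _ => ?_
        rw [mul_assoc]
        refine (le_abs_self _).trans ?_
        rw [abs_mul]
        refine mul_le_mul (hKb x hx i j) ?_ (abs_nonneg _) hB
        rw [abs_le]
        constructor <;>
          nlinarith [sq_nonneg ((G j).val x - (G i).val x), sq_nonneg ((G j).val x + (G i).val x)]
    _ = B * d * ∑ i, ∫ x in T, (G i).val x ^ 2 := by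
        rw [integral_const_mul, integral_finsetSum _ fun i _ => hint i]
    _ ≤ B * d * ∑ _i : Fin d, ε := by
        have := Finset.sum_le_sum fun i (_ : i ∈ Finset.univ) => h i
        gcongr
    _ = B * d ^ 2 * ε := by
        simp
        ring

/-- Estimate of the projection error in the energy norm of scalar functions. -/
theorem exists_energyNormW_le (hd : 1 ≤ d) (hΩ : IsLipschitzDomain Ω) {k : ℕ} (hk : 1 ≤ k)
    (c : RegularityConstants) {K : Space d → Matrix (Fin d) (Fin d) ℝ}
    (hKb : ∃ B : ℝ, ∀ x ∈ Ω, ∀ i j, |K x i j| ≤ B) :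
    ∃ C : ℝ, 0 < C ∧ ∀ M : PolytopalMesh Ω, M.ShapeRegular c → ∀ p : Space d → ℝ,
      MemSobolev (k + 1) Ω p →
        M.energyNormW k K (fun T => toWeakFn T p - projWeakFn k T p)
          ≤ C * M.meshSize ^ k * sobolevNorm (k + 1) Ω p := by
  obtain ⟨B, hB⟩ := hKb
  obtain ⟨C, hC, h⟩ := exists_weakForm_bound hd hΩ hk (k - 1 + 2 * c.maxFaces) c
  -- `max B 0 + 1` is a bound of the entries of `K` that is visibly positive.
  set A := (max B 0 + 1) * d ^ 2 * C
  have hd0 : (0 : ℝ) < d := by exact_mod_cast hd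
  have hA : 0 < A := by positivity
  refine ⟨√A, Real.sqrt_pos.2 hA, ?_⟩
  intro M hM p hp
  obtain ⟨ε, hε, hsum⟩ := h M hM p hp
  have hmesh := M.meshSize_nonneg
  have e : √A * M.meshSize ^ k * sobolevNorm (k + 1) Ω p
      = √(A * M.meshSize ^ (2 * k) * sobolevNormSq (k + 1) Ω p) :=
    sqrt_mul_pow_mul_sqrt hA.le hmesh k _
  rw [e]
  refine Real.sqrt_le_sqrt ?_
  calc _ ≤ ∑ T ∈ M.elems, (max B 0 + 1) * d ^ 2 * ε T := by
        refine Finset.sum_le_sum fun T hT => ?_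
        exact integral_quadForm_le hΩ hT (by positivity)
          (fun x hx i j => (hB x hx i j).trans ((le_max_left B 0).trans (le_add_of_nonneg_right
            zero_le_one))) (hε T hT).1
          (integral_weakGrad_sq_le (hM.weakDegree_le k hT) (hε T hT).1 (hε T hT).2)
    _ = (max B 0 + 1) * d ^ 2 * ∑ T ∈ M.elems, ε T := by rw [Finset.mul_sum]
    _ ≤ (max B 0 + 1) * d ^ 2 * (C * M.meshSize ^ (2 * k) * sobolevNormSq (k + 1) Ω p) := by gcongr
    _ = _ := by ring

/-- Estimate of the projection error in the energy norm of vector valued functions. -/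
theorem exists_energyNormV_le (hd : 1 ≤ d) (hΩ : IsLipschitzDomain Ω) {k : ℕ} (hk : 1 ≤ k)
    (c : RegularityConstants) {μ lam : ℝ} (hμ : 0 < μ) (hlam : 0 ≤ lam) :
    ∃ C : ℝ, 0 < C ∧ ∀ M : PolytopalMesh Ω, M.ShapeRegular c → ∀ u : Fin d → Space d → ℝ,
      (∀ i, MemSobolev (k + 1) Ω (u i)) →
        M.energyNormV k μ lam (fun T i => toWeakFn T (u i) - projWeakFn k T (u i))
          ≤ C * M.meshSize ^ k * sobolevNormVec (k + 1) Ω u := by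
  obtain ⟨C, hC, h⟩ := exists_weakForm_bound hd hΩ hk (k - 1 + 2 * c.maxFaces) c
  -- Used only for the square integrability of the projection errors, which the splitting of the
  -- divergence requires.
  obtain ⟨_, _, hproj⟩ := exists_projError_le hd hΩ k c
  set A := (2 * μ + lam) * d * C
  have hd0 : (0 : ℝ) < d := by exact_mod_cast hd
  have hA : 0 < A := by positivity
  refine ⟨√A, Real.sqrt_pos.2 hA, ?_⟩
  intro M hM u hu
  choose ε hε hsum using fun i => h M hM (u i) (hu i)
  have hmesh := M.meshSize_nonneg
  have e : √A * M.meshSize ^ k * sobolevNormVec (k + 1) Ω u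
      = √(A * M.meshSize ^ (2 * k) * ∑ i, sobolevNormSq (k + 1) Ω (u i)) :=
    sqrt_mul_pow_mul_sqrt hA.le hmesh k _
  rw [e]
  refine Real.sqrt_le_sqrt ?_
  calc _ ≤ ∑ T ∈ M.elems, (2 * μ * (d * ∑ i, ε i T) + lam * (d * ∑ i, ε i T)) := by
        refine Finset.sum_le_sum fun T hT => ?_
        have hm := fun i => hproj M hM T hT (u i) _ ((hu i).hasWeakGrad hΩ.1 hΩ.2.2.1) (hu i).1
          fun j => (hu i).memLp_weakDeriv _ (by simp)
        have h1 := integral_weakStrain_sq_le hT (r := M.weakDegree k T)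
          (v := fun i => toWeakFn T (u i) - projWeakFn k T (u i)) (ε := fun i => ε i T) fun i j =>
            integral_weakGradVec_sq_le (hM.weakDegree_le k hT) (hε i T hT).1 (hε i T hT).2 j
        have h2 := integral_weakDiv_sq_le hd (hM.weakDegree_le k hT) hT
          (v := fun i => toWeakFn T (u i) - projWeakFn k T (u i)) (fun i => (hm i).1)
          (fun i => (hm i).2.1) (fun i => (hε i T hT).1) fun i => (hε i T hT).2
        gcongr
    _ = (2 * μ + lam) * d * ∑ i, ∑ T ∈ M.elems, ε i T := by
        rw [Finset.sum_comm, Finset.mul_sum]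
        exact Finset.sum_congr rfl fun T _ => by ring
    _ ≤ (2 * μ + lam) * d
          * ∑ i, C * M.meshSize ^ (2 * k) * sobolevNormSq (k + 1) Ω (u i) := by
        gcongr
        exact hsum _
    _ = _ := by
        rw [← Finset.mul_sum]
        ring

end PolytopalMesh

end WeakGalerkin

end

theorem mainTheorem6 (d : ℕ) (hd1 : 1 ≤ d) (hd3 : d ≤ 3) (Ω : Set (WeakGalerkin.Space d))
    (hΩ : WeakGalerkin.IsLipschitzDomain Ω) (k : ℕ) (hk : 1 ≤ k)
    (c : WeakGalerkin.RegularityConstants) (μ lam : ℝ) (hμ : 0 < μ) (hlam : 0 ≤ lam)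
    (K : WeakGalerkin.Space d → Matrix (Fin d) (Fin d) ℝ)
    (hKm : ∀ i j, Measurable fun x => K x i j) (hKpos : ∀ x ∈ Ω, (K x).PosDef)
    (hKb : ∃ B : ℝ, ∀ x ∈ Ω, ∀ i j, |K x i j| ≤ B) :
    (∃ C : ℝ, 0 < C ∧ ∀ M : WeakGalerkin.PolytopalMesh Ω, M.ShapeRegular c →
      ∀ u : Fin d → WeakGalerkin.Space d → ℝ,
        (∀ i, WeakGalerkin.MemSobolev (k + 1) Ω (u i)) →
        M.energyNormV k μ lam
            (fun T i => WeakGalerkin.toWeakFn T (u i) - WeakGalerkin.projWeakFn k T (u i))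
          ≤ C * M.meshSize ^ k * WeakGalerkin.sobolevNormVec (k + 1) Ω u) ∧
    (∃ C : ℝ, 0 < C ∧ ∀ M : WeakGalerkin.PolytopalMesh Ω, M.ShapeRegular c →
      ∀ p : WeakGalerkin.Space d → ℝ,
        WeakGalerkin.MemSobolev (k + 1) Ω p →
        M.energyNormW k K
            (fun T => WeakGalerkin.toWeakFn T p - WeakGalerkin.projWeakFn k T p)
          ≤ C * M.meshSize ^ k * WeakGalerkin.sobolevNorm (k + 1) Ω p) :=
  ⟨WeakGalerkin.PolytopalMesh.exists_energyNormV_le hd1 hΩ hk c hμ hlam,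
    WeakGalerkin.PolytopalMesh.exists_energyNormW_le hd1 hΩ hk c hKb⟩
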